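/- Let $n\ge 1$, $\mathrm{Pol}=\mathbb Z[\tfrac12][x_1,\dots,x_n]$, and let $X=\{x_1,\dots,x_n\}$, $Y=\{y_1,\dots,y_n\}$ be two sets of indeterminates. Let $\mathrm{Sym}(n)\subset \mathrm{Pol}$ be the symmetric polynomials. Let $\mathfrak S_n$ be the symmetric group with simple transpositions $s_1,\dots,s_{n-1}$, and let $\mathfrak D_n\supset\mathfrak S_n$ be the group of signed permutations with an even number of sign changes (the Weyl group of type $D_n$), generated by $\mathfrak S_n$ and, if $n\ge2$, by $s_\heartsuit$. They act on polynomials on the right, $f\mapsto f^w$, where $s_i$ exchanges $x_i,x_{i+1}$ and $s_\heartsuit$ sends $x_1\mapsto -x_2$, $x_2\mapsto -x_1$. Put $f\partial_i=(f-f^{s_i})/(x_i-x_{i+1})$ and $f\partial_\heartsuit=(f-f^{s_\heartsuit})/(-x_1-x_2)$, operators being composed from left to right; for $w\in\mathfrak D_n$ let $\partial_w$ be the composition of these along a reduced decomposition of $w$. Let $w_0^D$ be the longest element of $\mathfrak D_n$ (it changes all signs if $n$ is even, all but the first if $n$ is odd), and let $$\partial_v=(\partial_\heartsuit\partial_2\cdots\partial_{n-1}\,\partial_1\cdots\partial_{n-2})(\partial_\heartsuit\partial_2\cdots\partial_{n-3}\,\partial_1\cdots\partial_{n-4})\cdots,$$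 the last factor being $\partial_\heartsuit$ for $n$ even and $\partial_\heartsuit\partial_2\partial_1$ for $n\geq 3$ odd ($\partial_v$ is the identity for $n=1$). Put $\langle f,g\rangle=(fg)\,\partial_v$ and $[f,g]=(fg)\,\partial_{w_0^D}$; these operators act on the variables $x_i$, the $y_i$ being treated as constants. Let $\widetilde Q_i=e_i(X)$ be the elementary symmetric polynomials, $\widetilde Q_{i,j}=\widetilde Q_i\widetilde Q_j+2\sum_{p=1}^{j}(-1)^p\widetilde Q_{i+p}\widetilde Q_{j-p}$ for $i\ge j$, $\widetilde Q_\emptyset=1$, and, for a partition $I=(i_1\ge\dots\ge i_\ell>0)$, let $\widetilde Q_I=\sum_{j=1}^{\ell}(-1)^{j-1}\widetilde Q_{i_j}\widetilde Q_{I\smallsetminus i_j}$ if $\ell$ is odd and $\widetilde Q_I=\sum_{j=2}^{\ell}(-1)^{j}\widetilde Q_{i_1,i_j}\widetilde Q_{I\smallsetminus\{i_1,i_j\}}$ if $\ell>0$ is even (the indicated entries being removed). For strict $I$ put $\widetilde P_I=2^{-\ell(I)}\widetilde Q_I$. Let $\rho(n-1)=(n-1,\dots,1)$; for a strict partition $I\subseteq\rho(n-1)$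 let $\rho(n-1)\smallsetminus I$ be the strict partition whose parts complement those of $I$ in $\{1,\dots,n-1\}$. Put $$\widetilde P(X,Y)=\sum_{I\subseteq\rho(n-1)\text{ strict}}\widetilde P_I(X)\,\widetilde P_{\rho(n-1)\smallsetminus I}(Y),\qquad F(X,Y)=\det\bigl(c_{n+j-2i}\bigr)_{1\le i,j\le n-1},$$ where $c_k=\widetilde P_k(X)+\widetilde P_k(Y)=\tfrac12(e_k(X)+e_k(Y))$ for $k>0$, $c_0=1$ and $c_k=0$ for $k<0$. Write $\equiv$ for congruence in $\mathbb Z[\tfrac12][X,Y]$ modulo the ideal generated by all $f(x_1^2,\dots,x_n^2)-f(y_1^2,\dots,y_n^2)$ with $f\in\mathrm{Sym}(n)$, together with $x_1\cdots x_n-y_1\cdots y_n$. Then: (i) $F(X,Y)\equiv\widetilde P(X,Y)$. (ii) $\widetilde P(X^w,X)=0$ for every $w\in\mathfrak D_n\smallsetminus\mathfrak S_n$, and $\widetilde P(X^w,X)=\widetilde P(X,X)=s_{\rho(n-1)}(X)$, the Schur polynomial, for every $w\in\mathfrak S_n$. (iii) $\langle f(X),F(X,Y)\rangle\equiv(-1)^{\binom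 n2}f(Y)$ for every $f\in\mathrm{Sym}(n)$. (iv) $\bigl[f(X),\prod_{n\ge i>j\ge1}(x_i-y_j)\,F(X,Y)\bigr]\equiv f(Y)$ for every $f\in\mathrm{Pol}$. -/

import Mathlib

open MvPolynomial

noncomputable section

namespace TypeD

/-! ### The Weyl groups -/

/-- The hyperoctahedral group of signed permutations of `n` coordinates. The pair `⟨ε, σ⟩` is coded
by the vector `[1, …, n] w` whose entry at position `i` is `ε (σ i) * σ i`. -/
abbrev Hyperoctahedral (n : ℕ) : Type :=
  (Fin n → ℤˣ) ⋊[mulAutArrow] Equiv.Perm (Fin n)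

/-- The Weyl group of type `D`: signed permutations with an even number of sign changes. -/
def weylD (n : ℕ) : Subgroup (Hyperoctahedral n) where
  carrier := {w | ∏ i, w.left i = 1}
  one_mem' := by simp
  mul_mem' := by
    intro a b ha hb
    simp only [Set.mem_ofPred_eq, SemidirectProduct.mul_left, Pi.mul_apply, Finset.prod_mul_distrib,
      mulAutArrow_apply_apply] at *
    rw [ha, one_mul, ← hb]
    exact Equiv.prod_comp (a.right⁻¹ : Equiv.Perm (Fin n)) b.left
  inv_mem' := by
    intro a ha
    simp only [Set.mem_ofPred_eq, SemidirectProduct.inv_left, mulAutArrow_apply_apply] at *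
    refine (Equiv.prod_comp (a.right⁻¹⁻¹ : Equiv.Perm (Fin n)) (a.left⁻¹)).trans ?_
    simp [ha]

/-- The symmetric group inside the hyperoctahedral group: no sign changes. -/
def weylA (n : ℕ) : Subgroup (Hyperoctahedral n) :=
  (SemidirectProduct.inr : Equiv.Perm (Fin n) →* Hyperoctahedral n).range

/-- The simple reflections of type `D`. With `0`-based indices, `s i` is the transposition of the
coordinates `i` and `i + 1`, and `heart` exchanges the first two coordinates and changes
both of their signs. -/
inductive Simple (n : ℕ) : Type
  | s (i : ℕ) (h : i + 1 < n) : Simple n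
  | heart (h : 1 < n) : Simple n

/-- The signed permutation of a simple reflection. -/
def Simple.toWeyl {n : ℕ} : Simple n → Hyperoctahedral n
  | .s i h => ⟨1, Equiv.swap ⟨i, by omega⟩ ⟨i + 1, h⟩⟩
  | .heart h => ⟨Pi.mulSingle ⟨0, by omega⟩ (-1) * Pi.mulSingle ⟨1, h⟩ (-1),
      Equiv.swap ⟨0, by omega⟩ ⟨1, h⟩⟩

/-- The list `l` of simple reflections is a reduced decomposition of `w`. -/
def IsReduced {n : ℕ} (l : List (Simple n)) (w : Hyperoctahedral n) : Prop :=
  (l.map Simple.toWeyl).prod = w ∧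
    ∀ l' : List (Simple n), (l'.map Simple.toWeyl).prod = w → l.length ≤ l'.length

theorem inr_mem_closure {n : ℕ} (σ : Equiv.Perm (Fin n)) :
    (SemidirectProduct.inr σ : Hyperoctahedral n) ∈
      Submonoid.closure (Set.range (Simple.toWeyl (n := n))) := by
  cases n with
  | zero =>
    have : σ = 1 := Subsingleton.elim _ _
    rw [this, map_one]
    exact one_mem _
  | succ m =>
    have h : σ ∈ Submonoid.closure
        (Set.range fun i : Fin m ↦ Equiv.swap i.castSucc i.succ) := by
      rw [Equiv.Perm.mclosure_swap_castSucc_succ]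
      trivial
    have h2 : Submonoid.closure (Set.range fun i : Fin m ↦ Equiv.swap i.castSucc i.succ) ≤
        (Submonoid.closure (Set.range (Simple.toWeyl (n := m + 1)))).comap
          (SemidirectProduct.inr : Equiv.Perm (Fin (m + 1)) →* Hyperoctahedral (m + 1)) := by
      rw [Submonoid.closure_le]
      rintro _ ⟨i, rfl⟩
      exact Submonoid.subset_closure ⟨.s i (by omega), rfl⟩
    exact h2 h

theorem flip_mem_closure {n : ℕ} (i j : Fin n) (hij : i ≠ j) :
    (SemidirectProduct.inl (Pi.mulSingle i (-1) * Pi.mulSingle j (-1)) : Hyperoctahedral n) ∈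
      Submonoid.closure (Set.range (Simple.toWeyl (n := n))) := by
  have hn : 1 < n := by
    have := i.2; have := j.2
    have : (i : ℕ) ≠ j := fun h ↦ hij (Fin.ext h)
    omega
  set a : Fin n := ⟨0, by omega⟩ with ha
  set b : Fin n := ⟨1, hn⟩ with hb
  have hab : a ≠ b := by simp [ha, hb]
  obtain ⟨σ, h1, h2⟩ : ∃ σ : Equiv.Perm (Fin n), σ a = i ∧ σ b = j := by
    refine ⟨Equiv.swap (Equiv.swap a i b) j * Equiv.swap a i, ?_, ?_⟩
    · rw [Equiv.Perm.mul_apply, Equiv.swap_apply_left, Equiv.swap_apply_of_ne_of_ne _ hij]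
      intro h
      have := (Equiv.swap a i).injective ((Equiv.swap_apply_left a i).trans h)
      exact hab this
    · rw [Equiv.Perm.mul_apply, Equiv.swap_apply_left]
  have hs : (Simple.heart hn).toWeyl = SemidirectProduct.inl
      (Pi.mulSingle a (-1) * Pi.mulSingle b (-1)) * SemidirectProduct.inr (Equiv.swap a b) := by
    rw [← SemidirectProduct.mk_eq_inl_mul_inr]
    rfl
  have key : (SemidirectProduct.inl (Pi.mulSingle i (-1) * Pi.mulSingle j (-1)) :
      Hyperoctahedral n) = SemidirectProduct.inr σ * ((Simple.heart hn).toWeyl *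
        SemidirectProduct.inr (Equiv.swap a b)) * SemidirectProduct.inr σ⁻¹ := by
    rw [hs, mul_assoc (SemidirectProduct.inl _), ← map_mul, Equiv.swap_mul_self, map_one, mul_one,
      map_inv, ← map_inv, ← SemidirectProduct.inl_aut]
    congr 1
    funext k
    have e1 : ∀ c : Fin n, (Pi.mulSingle (σ c) (-1 : ℤˣ) : Fin n → ℤˣ) k =
        (Pi.mulSingle c (-1 : ℤˣ) : Fin n → ℤˣ) (σ⁻¹ k) := by
      intro c
      by_cases h : k = σ c
      · subst h; simp
      · have h' : σ⁻¹ k ≠ c := by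
          rintro rfl; simp at h
        rw [Pi.mulSingle_eq_of_ne h, Pi.mulSingle_eq_of_ne h']
    have := e1 a
    have := e1 b
    simp only [← h1, ← h2, Pi.mul_apply, e1]
    rfl
  rw [key]
  exact mul_mem (mul_mem (inr_mem_closure _) (mul_mem (Submonoid.subset_closure ⟨_, rfl⟩)
    (inr_mem_closure _))) (inr_mem_closure _)

theorem exists_word {n : ℕ} (w : weylD n) :
    ∃ l : List (Simple n), (l.map Simple.toWeyl).prod = (w : Hyperoctahedral n) := by
  have hw : (w : Hyperoctahedral n) ∈ Submonoid.closure (Set.range (Simple.toWeyl (n := n))) := by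
    obtain ⟨⟨ε, σ⟩, h⟩ := w
    have h : ∏ i, ε i = 1 := h
    change (⟨ε, σ⟩ : Hyperoctahedral n) ∈ _
    rw [SemidirectProduct.mk_eq_inl_mul_inr]
    refine mul_mem ?_ (inr_mem_closure σ)
    rcases Nat.eq_zero_or_pos n with rfl | hn
    · have : ε = 1 := Subsingleton.elim _ _
      rw [this, map_one]
      exact one_mem _
    · set a : Fin n := ⟨0, hn⟩
      have e1 : ε = ∏ i, (Pi.mulSingle a (ε i) * Pi.mulSingle i (ε i)) := by
        rw [Finset.prod_mul_distrib, Finset.univ_prod_mulSingle]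
        have : ∏ i, (Pi.mulSingle a (ε i) : Fin n → ℤˣ) = Pi.mulSingle a (∏ i, ε i) :=
          (map_prod (MonoidHom.mulSingle (fun _ : Fin n ↦ ℤˣ) a) ε Finset.univ).symm
        rw [this, h, Pi.mulSingle_one, one_mul]
      suffices h : ε ∈ (Submonoid.closure (Set.range (Simple.toWeyl (n := n)))).comap
          (SemidirectProduct.inl : (Fin n → ℤˣ) →* Hyperoctahedral n) from h
      rw [e1]
      refine Submonoid.prod_mem _ fun i _ ↦ ?_
      rw [Submonoid.mem_comap]
      rcases Int.units_eq_one_or (ε i) with hi | hi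
      · rw [hi, Pi.mulSingle_one, Pi.mulSingle_one, one_mul, map_one]
        exact one_mem _
      · rw [hi]
        by_cases hia : a = i
        · rw [← hia, ← Pi.mulSingle_mul]
          simp
        · exact flip_mem_closure a i hia
  obtain ⟨l, hl, hp⟩ := Submonoid.exists_list_of_mem_closure hw
  obtain ⟨l', rfl⟩ : l ∈ Set.range (List.map (Simple.toWeyl (n := n))) := by
    rw [Set.range_list_map]
    exact hl
  exact ⟨l', hp⟩

theorem exists_isReduced {n : ℕ} (w : weylD n) :
    ∃ l : List (Simple n), IsReduced l (w : Hyperoctahedral n) := by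
  classical
  have h : ∃ k, ∃ l : List (Simple n),
      (l.map Simple.toWeyl).prod = (w : Hyperoctahedral n) ∧ l.length = k := by
    obtain ⟨l, hl⟩ := exists_word w
    exact ⟨_, l, hl, rfl⟩
  obtain ⟨l, hl, hk⟩ := Nat.find_spec h
  exact ⟨l, hl, fun l' hl' ↦ hk ▸ Nat.find_min' h ⟨l', hl', rfl⟩⟩

/-- The longest element of the Weyl group of type `D`: it changes all signs if `n` is even, and all
signs but the first if `n` is odd. -/
def longest (n : ℕ) : weylD n :=
  ⟨⟨fun i ↦ if Odd n ∧ (i : ℕ) = 0 then 1 else -1, 1⟩, by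
    change ∏ i : Fin n, (if Odd n ∧ (i : ℕ) = 0 then (1 : ℤˣ) else -1) = 1
    cases n with
    | zero => simp
    | succ m =>
      rw [Fin.prod_univ_succ]
      by_cases h : Odd (m + 1)
      · have hm : Even m := by
          rcases Nat.even_or_odd m with h' | h'
          · exact h'
          · exact absurd (h'.add_one) (Nat.not_even_iff_odd.mpr h)
        simp [h, hm.neg_one_pow]
      · have hm : Odd m := by
          rcases Nat.even_or_odd m with h' | h'
          · exact absurd h'.add_one h
          · exact h'
        simp [h, hm.neg_one_pow]⟩

/-! ### Divided differences -/

section DividedDifferences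

variable {n : ℕ} {A : Type*} [CommRing A]

/-- The right action `f ↦ f ^ w` of signed permutations on polynomials in `x_1, …, x_n` with
coefficients in `A`. A simple transposition exchanges its two variables, and `heart`
sends `x_1` to `-x_2` and `x_2` to `-x_1`. -/
def act (w : Hyperoctahedral n) : MvPolynomial (Fin n) A →ₐ[A] MvPolynomial (Fin n) A :=
  aeval fun i ↦ ((w.left i : ℤ) : MvPolynomial (Fin n) A) * X (w.right⁻¹ i)

/-- The denominator in the simple divided difference. -/
def Simple.root : Simple n → MvPolynomial (Fin n) A
  | .s i h => X ⟨i, by omega⟩ - X ⟨i + 1, h⟩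
  | .heart h => -X ⟨0, by omega⟩ - X ⟨1, h⟩

theorem dvd_sub_of_dvd_X {d : MvPolynomial (Fin n) A}
    (φ : MvPolynomial (Fin n) A →ₐ[A] MvPolynomial (Fin n) A)
    (h : ∀ i, d ∣ X i - φ (X i)) (f : MvPolynomial (Fin n) A) : d ∣ f - φ f := by
  have e : (Ideal.Quotient.mkₐ A (Ideal.span {d})).comp φ = Ideal.Quotient.mkₐ A (Ideal.span {d}) :=
    MvPolynomial.algHom_ext fun i ↦ by
      have := (Ideal.Quotient.mk_eq_mk_iff_sub_mem (I := Ideal.span {d}) (X i) (φ (X i))).mpr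
        (Ideal.mem_span_singleton.mpr (h i))
      simpa using this.symm
  have e2 := congrArg (fun g ↦ g f) e
  rw [← Ideal.mem_span_singleton]
  exact (Ideal.Quotient.mk_eq_mk_iff_sub_mem _ _).mp (by simpa using e2.symm)

theorem Simple.root_dvd (g : Simple n) (f : MvPolynomial (Fin n) A) :
    (g.root : MvPolynomial (Fin n) A) ∣ f - act g.toWeyl f := by
  refine dvd_sub_of_dvd_X _ (fun k ↦ ?_) f
  cases g with
  | s i h =>
    simp only [act, aeval_X, Simple.toWeyl, Simple.root, Equiv.swap_inv]
    by_cases h1 : k = ⟨i, by omega⟩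
    · subst h1; simp
    by_cases h2 : k = ⟨i + 1, h⟩
    · subst h2
      rw [Equiv.swap_apply_right]
      exact ⟨-1, by simp⟩
    · rw [Equiv.swap_apply_of_ne_of_ne h1 h2]; simp
  | heart h =>
    simp only [act, aeval_X, Simple.toWeyl, Simple.root, Equiv.swap_inv]
    by_cases h1 : k = ⟨0, by omega⟩
    · subst h1
      refine ⟨-1, ?_⟩
      simp
      ring
    by_cases h2 : k = ⟨1, h⟩
    · subst h2
      refine ⟨-1, ?_⟩
      simp
    · rw [Equiv.swap_apply_of_ne_of_ne h1 h2]
      simp [Pi.mulSingle_eq_of_ne h1, Pi.mulSingle_eq_of_ne h2]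

/-- The simple divided difference `f ↦ (f - f ^ s) / (x_i - x_{i+1})` for a simple transposition,
`f ↦ (f - f ^ s) / (-x_1 - x_2)` for `heart`; the quotient is unique,
since the denominator is not a zero divisor. -/
def Simple.divDiff (g : Simple n) (f : MvPolynomial (Fin n) A) : MvPolynomial (Fin n) A :=
  (g.root_dvd f).choose

/-- Composition of simple divided differences along a word, from left to right. -/
def wordDivDiff (l : List (Simple n)) (f : MvPolynomial (Fin n) A) : MvPolynomial (Fin n) A :=
  l.foldl (fun f g ↦ g.divDiff f) f

/-- The divided difference `∂_w`, computed along some reduced decomposition of `w`. -/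
def divDiff (w : weylD n) (f : MvPolynomial (Fin n) A) : MvPolynomial (Fin n) A :=
  wordDivDiff (exists_isReduced w).choose f

/-- The word `(♥ 2 ⋯ m-1 1 ⋯ m-2) (♥ 2 ⋯ m-3 1 ⋯ m-4) ⋯` ending in `(♥ 2 3 1 2) (♥)` if `m` is even
and in `(♥ 2 3 4 1 2 3) (♥ 2 1)` if `m` is odd; recall that `s i` is the
`(i+1)`-st simple transposition. -/
def vWord (n : ℕ) : (m : ℕ) → m ≤ n → List (Simple n)
  | 0, _ => []
  | 1, _ => []
  | m + 2, h =>
    .heart (by omega) ::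
      ((List.finRange m).map (fun k ↦ .s (k + 1) (by omega)) ++
        (List.finRange m).map (fun k ↦ .s k (by omega))) ++ vWord n m (by omega)

/-- The divided difference `∂_v`. -/
def divDiffV (f : MvPolynomial (Fin n) A) : MvPolynomial (Fin n) A :=
  wordDivDiff (vWord n n le_rfl) f

/-- The scalar product `⟨f, g⟩ = (f g) ∂_v`. -/
def angle (f g : MvPolynomial (Fin n) A) : MvPolynomial (Fin n) A :=
  divDiffV (f * g)

/-- The scalar product `[f, g] = (f g) ∂_{w_0}`, where `w_0` is the longest element. -/
def bracket (f g : MvPolynomial (Fin n) A) : MvPolynomial (Fin n) A :=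
  divDiff (longest n) (f * g)

end DividedDifferences

/-! ### The polynomials -/

/-- The ring `ℤ[1/2]`. -/
def ZHalf : Type := Localization.Away (2 : ℤ)

instance : CommRing ZHalf := inferInstanceAs (CommRing (Localization.Away (2 : ℤ)))

instance : IsDomain ZHalf :=
  IsLocalization.isDomain_localization
    (powers_le_nonZeroDivisors_of_noZeroDivisors (two_ne_zero' ℤ))

/-- The element `1/2` of `ℤ[1/2]`. -/
def half : ZHalf := (IsLocalization.Away.invSelf (2 : ℤ) : Localization.Away (2 : ℤ))

theorem two_mul_half : 2 * half = 1 := by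
  have h := IsLocalization.Away.mul_invSelf (S := Localization.Away (2 : ℤ)) (2 : ℤ)
  rw [map_ofNat] at h
  exact h

/-- The ring `ℤ[1/2][x_1, …, x_n]`. -/
abbrev Pol (n : ℕ) : Type := MvPolynomial (Fin n) ZHalf

/-- `Q̃_{i,j} = Q̃_i Q̃_j + 2 ∑_{p=1}^{j} (-1)^p Q̃_{i+p} Q̃_{j-p}`, where `Q̃_i = e_i`. -/
def Qtilde₂ (n i j : ℕ) : Pol n :=
  esymm (Fin n) ZHalf i * esymm (Fin n) ZHalf j +
    2 * ∑ p ∈ Finset.Icc 1 j,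
      (-1) ^ p * esymm (Fin n) ZHalf (i + p) * esymm (Fin n) ZHalf (j - p)

/-- The polynomial `Q̃_I` of a partition `I`, given as the weakly decreasing list of its parts:
`Q̃_∅ = 1`; for an odd number of parts
`Q̃_I = ∑_j (-1)^(j-1) Q̃_{i_j} Q̃_{I without i_j}`, the sum over all parts; for an even number of parts
`Q̃_I = ∑_{j ≥ 2} (-1)^j Q̃_{i_1,i_j} Q̃_{I without i_1, i_j}`. In the code the second sum
runs over the positions of the list `t` of all parts but the first. -/
def Qtilde (n : ℕ) : List ℕ → Pol n
  | [] => 1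
  | a :: t =>
    if Odd (a :: t).length then
      ∑ j : Fin (a :: t).length, (-1) ^ (j : ℕ) * esymm (Fin n) ZHalf (a :: t)[j] *
        Qtilde n ((a :: t).eraseIdx j)
    else
      ∑ j : Fin t.length, (-1) ^ (j : ℕ) * Qtilde₂ n a t[j] * Qtilde n (t.eraseIdx j)
termination_by l => l.length
decreasing_by
  all_goals
    have := j.2
    simp only [List.length_eraseIdx, List.length_cons] at *
    split <;> omega

/-- `P̃_I = 2^(-ℓ(I)) Q̃_I` for a strict partition `I`, given as the finite set of its parts. -/
def Ptilde (n : ℕ) (I : Finset ℕ) : Pol n :=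
  C (half ^ I.card) * Qtilde n (I.sort (· ≥ ·))

/-- Polynomials in two sets of variables: the outer variables are the `x_i`, and the
coefficients are polynomials in the `y_i`. -/
abbrev Pol₂ (n : ℕ) : Type := MvPolynomial (Fin n) (Pol n)

/-- The polynomial `f(x_1, …, x_n)` in two sets of variables. -/
def inX {n : ℕ} (f : Pol n) : Pol₂ n := MvPolynomial.map C f

/-- The polynomial `f(y_1, …, y_n)` in two sets of variables. -/
def inY {n : ℕ} (f : Pol n) : Pol₂ n := C f

/-- The ideal generated by the elements `f(x_1², …, x_n²) - f(y_1², …, y_n²)` for symmetric `f` and by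
`x_1 ⋯ x_n - y_1 ⋯ y_n`. -/
def relIdeal (n : ℕ) : Ideal (Pol₂ n) :=
  Ideal.span
    ({r | ∃ f : Pol n, f.IsSymmetric ∧ r = inX (expand 2 f) - inY (expand 2 f)} ∪
      {inX (∏ i, X i) - inY (∏ i, X i)})

/-- Congruence modulo `relIdeal`. -/
def CongrRel {n : ℕ} (f g : Pol₂ n) : Prop := f - g ∈ relIdeal n

/-- The entry of index `k` of the determinant: `P̃_k(X) + P̃_k(Y)` for `k > 0`, `1` for `k = 0`,
and `0` for `k < 0`. -/
def fultonEntry (n : ℕ) (k : ℤ) : Pol₂ n :=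
  if 0 < k then inX (Ptilde n {k.toNat}) + inY (Ptilde n {k.toNat}) else if k = 0 then 1 else 0

/-- The determinant `F(X, Y)` of order `n - 1`, whose entry in row `i` and column `j`, for
`1 ≤ i, j ≤ n - 1`, has index `n + j - 2 i`. -/
def fulton (n : ℕ) : Pol₂ n :=
  Matrix.det (Matrix.of fun i j : Fin (n - 1) ↦
    fultonEntry n ((n : ℤ) + ((j : ℤ) + 1) - 2 * ((i : ℤ) + 1)))

/-- `P̃(X, Y) = ∑_I P̃_I(X) P̃_{ρ(n-1) ∖ I}(Y)`, the sum over all strict partitions `I ⊆ ρ(n-1)`, that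
is, over all sets of parts contained in `{1, …, n-1}`. -/
def PtildeXY (n : ℕ) : Pol₂ n :=
  ∑ I ∈ (Finset.Icc 1 (n - 1)).powerset,
    inX (Ptilde n I) * inY (Ptilde n (Finset.Icc 1 (n - 1) \ I))

/-- `K(X ^ w, X)`: substitute `x_i ^ w` for `x_i` and `x_i` for `y_i` in `K(X, Y)`. -/
def specialize {n : ℕ} (w : Hyperoctahedral n) (K : Pol₂ n) : Pol n :=
  aeval (fun i ↦ act w (X i : Pol n)) K

/-- The product of `x_i - y_j` over all `i > j`. -/
def kernelA (n : ℕ) : Pol₂ n :=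
  ∏ p : Fin n × Fin n with p.2 < p.1, (inX (X p.1) - inY (X p.2))

/-! ### Schur polynomials -/

/-- The alternant `det (x_i ^ α_j)`. -/
def alternant {n : ℕ} (α : Fin n → ℕ) : Pol n :=
  Matrix.det (Matrix.of fun i j : Fin n ↦ (X i : Pol n) ^ α j)

/-- The vector `[n-1, …, 1, 0]`. -/
def rho (n : ℕ) : Fin n → ℕ := fun j ↦ n - 1 - j

theorem vandermonde_dvd_alternant {n : ℕ} (α : Fin n → ℕ) (S : Finset (Fin n × Fin n))
    (hS : ∀ p ∈ S, p.1 < p.2) : (∏ p ∈ S, (X p.1 - X p.2 : Pol n)) ∣ alternant α := by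
  induction S using Finset.induction_on with
  | empty => simp
  | insert p S hp ih =>
    obtain ⟨g, hg⟩ := ih fun q hq ↦ hS q (Finset.mem_insert_of_mem hq)
    have hpl := hS p (Finset.mem_insert_self _ _)
    let φ : Pol n →ₐ[ZHalf] Pol n := aeval fun k ↦ if k = p.2 then X p.1 else X k
    have hφ : ∀ k, φ (X k) = if k = p.2 then X p.1 else X k := fun k ↦ by simp [φ]
    have h0 : φ (alternant α) = 0 := by
      rw [alternant, AlgHom.map_det φ]
      refine Matrix.det_zero_of_row_eq hpl.ne ?_
      funext j
      simp [hφ]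
    have h1 : φ (∏ q ∈ S, (X q.1 - X q.2 : Pol n)) ≠ 0 := by
      rw [map_prod, Finset.prod_ne_zero_iff]
      intro q hq h
      have hql := hS q (Finset.mem_insert_of_mem hq)
      have hqp : q ≠ p := fun h ↦ hp (h ▸ hq)
      rw [map_sub, hφ, hφ, sub_eq_zero] at h
      split_ifs at h with a b b
      · exact hql.ne (a.trans b.symm)
      · have := X_injective h
        rw [a, ← this] at hql
        exact lt_asymm hql hpl
      · exact hqp (Prod.ext (X_injective h) b)
      · exact hql.ne (X_injective h)
    rw [hg, map_mul, mul_eq_zero, or_iff_right h1] at h0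
    have h2 : (X p.1 - X p.2 : Pol n) ∣ g - φ g := by
      refine dvd_sub_of_dvd_X φ (fun k ↦ ?_) g
      rw [hφ]
      split_ifs with hk
      · subst hk; exact ⟨-1, by ring⟩
      · simp
    have h2 : (X p.1 - X p.2 : Pol n) ∣ g := by simpa [h0] using h2
    obtain ⟨c, rfl⟩ := h2
    rw [Finset.prod_insert hp, hg]
    exact ⟨c, by ring⟩

theorem exists_schur {n : ℕ} (l : Fin n → ℕ) :
    ∃ s : Pol n, s * alternant (rho n) = alternant (fun j ↦ l j + rho n j) := by
  have hv : alternant (rho n) = ∏ p : Fin n × Fin n with p.1 < p.2, (X p.1 - X p.2 : Pol n) := by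
    have h1 : alternant (rho n) =
        (Matrix.projVandermonde (fun _ ↦ 1) (fun i ↦ (X i : Pol n))).det := by
      rw [alternant]
      congr 1
      refine Matrix.ext fun i j ↦ ?_
      simp only [Matrix.of_apply, Matrix.projVandermonde_apply, one_pow, one_mul, rho]
      congr 1
      have := Fin.val_rev j
      omega
    rw [h1, Matrix.det_projVandermonde]
    rw [Finset.prod_filter, Fintype.prod_prod_type]
    refine Finset.prod_congr rfl fun i _ ↦ ?_
    rw [← Finset.prod_filter]
    refine Finset.prod_congr (by ext; simp) fun j _ ↦ ?_
    simp
  obtain ⟨c, hc⟩ := vandermonde_dvd_alternant (fun j ↦ l j + rho n j)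
    (Finset.univ.filter fun p : Fin n × Fin n ↦ p.1 < p.2) (by simp)
  exact ⟨c, by rw [hv, hc, mul_comm]⟩

/-- The Schur polynomial `s_l(x_1, …, x_n)` of a partition `l` with at most `n` parts (padded with
zeros): the quotient of alternants `det (x_i ^ (l_j + n - j)) / det (x_i ^ (n - j))`. -/
def schur {n : ℕ} (l : Fin n → ℕ) : Pol n := (exists_schur l).choose

end TypeD

end

open MvPolynomial

noncomputable section

namespace TypeD

/-! ### The action and the positive roots -/

section Action

variable {n : ℕ} {A : Type*} [CommRing A]

/-! Everything reduces to the specializations `K(X^w, X)`, with `w` in the Weyl group of type D. The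
central fact, `mem_relIdeal_of_specialize`, is that a polynomial all of whose specializations vanish
lies in the ideal of relations. It needs a reproducing kernel: a `K(X, Y)` of degree at most
`n(n-1)` that vanishes at `(X^w, X)` for `w ≠ 1` and equals the product `disc` of the positive roots
at `(X, X)`. The kernel used is `kernelA n * fulton n`: the first factor vanishes at nontrivial
permutations, the second at elements outside the symmetric group.

Such a kernel also controls divided differences without braid relations. Along any word, a
composition of divided differences expands as a sum over group elements with rational coefficients
(`specialize_wordDivDiff`). For a word of length `n(n-1)`, applying it to a translate of the kernel
isolates one coefficient, and by degree the result is a constant. Dedekind independence determines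
these constants up to a common factor, and the coefficient at the longest element fixes that factor.
Hence a word of this length for the longest element computes antisymmetrization divided by `disc`
(`disc_mul_wordDivDiff`). In particular the result is invariant under the group. To prove the
central fact for `H`, take a third set of variables `Z` and antisymmetrize `H(Z, Y) K(Z, X)` in `Z`.
The quotient is invariant in `Z`, is `H(X, Y)` at `Z = X` and `0` at `Z = Y`. Invariants are
generated, 2 being invertible, by symmetric functions of the squares and the product of the
variables, so the two values are congruent.

It remains to specialize. Write `E(t) = ∏ (1 + x_i t) = A(t) B(t)`, where `B` collects the variables
whose sign `w` changes; then `E^w(t) = A(t) B(-t)`. Outside the symmetric group at least two signs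
change, so `deg A ≤ n - 2`. The entries of the determinant are coefficients of `A G` with `G = (B(t)
+ B(-t))/2` even, and the coefficients of `1/G` give a relation between its rows
(`det_intCoeff_eq_zero`). For the sum of products, each `Q̃_I` is a Pfaffian, realized by a
functional on an exterior algebra. The sum over complementary partitions becomes the Pfaffian of the
vectors `ξ_k + η_k`, for the orthogonal sum of the forms attached to `E^w(t)` and, with a minus
sign, to `E(-t)`. It vanishes because `1/B(-t)` provides a vector in the radical up to a boundary
term (`pfaffian_descList_eq_zero`, `coeff_mul_mk_pairQ`). Both polynomials have the same value at
`(X, X)`, namely `∏_{i<j} (x_i + x_j)`. This follows from vanishing at `x_b = -x_a`, degree, and the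
behaviour at `x_n = 0` (`eq_sumProd`), and it is the staircase Schur polynomial.

Thus (i) and (ii) are comparisons of specializations. For (iv), the bracket is invariant, so all its
specializations equal the one at the identity, where the kernel returns `f`. For (iii), choose a
longest word consisting of a type A word followed by that of `∂_v`. The type A part passes over `f`
and `F`, both symmetric in `X`, and turns the product of the `x_i - y_j` into a sign. -/

theorem act_X (w : Hyperoctahedral n) (i : Fin n) :
    act w (X i : MvPolynomial (Fin n) A) = ((w.left i : ℤ) : MvPolynomial (Fin n) A) *
      X (w.right⁻¹ i) := by
  simp [act]

theorem act_mul (v w : Hyperoctahedral n) (f : MvPolynomial (Fin n) A) :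
    act (v * w) f = act w (act v f) := by
  have : (act (v * w) : MvPolynomial (Fin n) A →ₐ[A] _) = (act w).comp (act v) := by
    refine MvPolynomial.algHom_ext fun i ↦ ?_
    rw [AlgHom.comp_apply, act_X, act_X, map_mul, act_X, map_intCast, ← mul_assoc]
    congr 1
    simp only [SemidirectProduct.mul_left, Pi.mul_apply, Units.val_mul, Int.cast_mul]
    rfl
  rw [this, AlgHom.comp_apply]

theorem act_one (f : MvPolynomial (Fin n) A) : act (1 : Hyperoctahedral n) f = f := by
  have : (act (1 : Hyperoctahedral n) : MvPolynomial (Fin n) A →ₐ[A] _) = AlgHom.id A _ :=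
    MvPolynomial.algHom_ext fun i ↦ by simp [act_X]
  rw [this, AlgHom.id_apply]

theorem act_injective (w : Hyperoctahedral n) :
    Function.Injective (act w : MvPolynomial (Fin n) A → _) := by
  refine Function.LeftInverse.injective (g := act w⁻¹) fun f ↦ ?_
  rw [← act_mul, mul_inv_cancel, act_one]

theorem act_map {B : Type*} [CommRing B] (φ : A →+* B) (w : Hyperoctahedral n)
    (f : MvPolynomial (Fin n) A) : act w (map φ f) = map φ (act w f) := by
  have : ((act w : MvPolynomial (Fin n) B →ₐ[B] MvPolynomial (Fin n) B) :
      MvPolynomial (Fin n) B →+* MvPolynomial (Fin n) B).comp (map φ) =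
      (map φ).comp ((act w : MvPolynomial (Fin n) A →ₐ[A] MvPolynomial (Fin n) A) :
        MvPolynomial (Fin n) A →+* MvPolynomial (Fin n) A) := by
    refine MvPolynomial.ringHom_ext (fun r ↦ ?_) fun i ↦ ?_
    · simp [← MvPolynomial.algebraMap_eq]
    · simp [act_X]
  exact congrArg (fun g ↦ g f) this

theorem Simple.toWeyl_mul_self (s : Simple n) : s.toWeyl * s.toWeyl = 1 := by
  cases s with
  | s i h =>
    refine SemidirectProduct.ext ?_ ?_
    · simp [Simple.toWeyl]
    · simp [Simple.toWeyl]
  | heart h =>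
    refine SemidirectProduct.ext ?_ ?_
    · funext k
      simp only [Simple.toWeyl, SemidirectProduct.mul_left, Pi.mul_apply, mulAutArrow_apply_apply,
        SemidirectProduct.one_left, Pi.one_apply]
      change _ * ((Pi.mulSingle _ _ : Fin n → ℤˣ) ((Equiv.swap _ _)⁻¹ k) *
        (Pi.mulSingle _ _ : Fin n → ℤˣ) ((Equiv.swap _ _)⁻¹ k)) = _
      rw [Equiv.swap_inv]
      by_cases h1 : k = ⟨0, by omega⟩
      · subst h1; simp
      by_cases h2 : k = ⟨1, h⟩
      · subst h2; simp
      rw [Equiv.swap_apply_of_ne_of_ne h1 h2]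
      simp [Pi.mulSingle_eq_of_ne h1, Pi.mulSingle_eq_of_ne h2]
    · simp [Simple.toWeyl]

theorem Simple.toWeyl_mem (s : Simple n) : s.toWeyl ∈ weylD n := by
  change ∏ i, s.toWeyl.left i = 1
  cases s with
  | s i h => simp [Simple.toWeyl]
  | heart h =>
    simp only [Simple.toWeyl, Pi.mul_apply, Finset.prod_mul_distrib]
    simp

/-- A simple reflection as an element of the Weyl group. -/
def Simple.refl (s : Simple n) : weylD n := ⟨s.toWeyl, s.toWeyl_mem⟩

theorem Simple.refl_mul_self (s : Simple n) : s.refl * s.refl = 1 :=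
  Subtype.ext s.toWeyl_mul_self

theorem Simple.root_mul_divDiff (s : Simple n) (f : MvPolynomial (Fin n) A) :
    s.root * s.divDiff f = f - act s.toWeyl f :=
  (s.root_dvd f).choose_spec.symm

/-- The positive roots, indexed by pairs of distinct indices. -/
def posRoot (a : Fin n × Fin n) : MvPolynomial (Fin n) A :=
  if a.1 < a.2 then X a.1 - X a.2 else -X a.1 - X a.2

/-- The index of a simple root among the positive roots. -/
def Simple.idx : Simple n → Fin n × Fin n
  | .s i h => (⟨i, by omega⟩, ⟨i + 1, h⟩)
  | .heart h => (⟨1, h⟩, ⟨0, by omega⟩)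

theorem Simple.posRoot_idx (s : Simple n) : posRoot s.idx = (s.root : MvPolynomial (Fin n) A) := by
  cases s with
  | s i h => simp [Simple.idx, posRoot, Simple.root]
  | heart h =>
    simp [Simple.idx, posRoot, Simple.root]
    ring

/-- The permutation of the positive roots other than a simple root, induced by its reflection. -/
def Simple.rootPerm : Simple n → Fin n × Fin n → Fin n × Fin n
  | .s i h => fun a ↦
    let τ := Equiv.swap (⟨i, by omega⟩ : Fin n) ⟨i + 1, h⟩
    if τ a.1 = a.2 then a else (τ a.1, τ a.2)
  | .heart h => fun a ↦
    let τ := Equiv.swap (⟨0, by omega⟩ : Fin n) ⟨1, h⟩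
    if τ a.1 = a.1 ∧ τ a.2 = a.2 ∨ τ a.1 = a.2 then a else (τ a.2, τ a.1)

theorem Simple.rootPerm_idx (s : Simple n) : s.rootPerm s.idx = s.idx := by
  cases s <;> simp [Simple.rootPerm, Simple.idx]

theorem Simple.rootPerm_ne (s : Simple n) {a : Fin n × Fin n} (ha : a.1 ≠ a.2) :
    (s.rootPerm a).1 ≠ (s.rootPerm a).2 := by
  cases s <;> simp only [Simple.rootPerm] <;> split <;> simp [ha, ha.symm]

theorem Simple.rootPerm_rootPerm (s : Simple n) (a : Fin n × Fin n) :
    s.rootPerm (s.rootPerm a) = a := by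
  cases s <;> simp only [Simple.rootPerm] <;> split <;> simp_all [Equiv.swap_apply_def] <;> grind

/-- No index lies between `b` and `c`, so exchanging them preserves the order within every pair
other than `{b, c}`. On that pair, `(c, b)` indexes a root fixed by the exchange and `(b, c)` the
excluded simple root. -/
theorem swap_posRoot {b c x y : Fin n} (hbc : b < c)
    (hadj : ∀ z, z ≠ b → z ≠ c → (z < b ↔ z < c)) (ha : x ≠ y) (h : ¬(x = b ∧ y = c)) :
    (if x < y then X (Equiv.swap b c x) - X (Equiv.swap b c y)
      else -X (Equiv.swap b c x) - X (Equiv.swap b c y) : MvPolynomial (Fin n) A) =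
      posRoot (if Equiv.swap b c x = y then (x, y) else (Equiv.swap b c x, Equiv.swap b c y)) := by
  have := hadj x
  have := hadj y
  simp only [posRoot, Equiv.swap_apply_def]
  grind

/-- Here `b` and `c` are the two smallest indices. Changing the sign of one term turns a difference
into a negative sum and conversely, which is why the index pair is reversed as well as swapped. -/
theorem flip_posRoot {b c x y : Fin n} (hbc : b < c) (hadj : ∀ z, z ≠ b → z ≠ c → c < z)
    (ha : x ≠ y) (h : ¬(x = c ∧ y = b)) (g : Fin n → MvPolynomial (Fin n) A) (hb : g b = -X c)
    (hc : g c = -X b) (hg : ∀ z, z ≠ b → z ≠ c → g z = X z) :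
    (if x < y then g x - g y else -g x - g y) =
      posRoot (if Equiv.swap b c x = x ∧ Equiv.swap b c y = y ∨ Equiv.swap b c x = y then (x, y)
        else (Equiv.swap b c y, Equiv.swap b c x)) := by
  have := hadj x
  have := hadj y
  have := hg x
  have := hg y
  simp only [posRoot, Equiv.swap_apply_def]
  grind

theorem Simple.act_posRoot (s : Simple n) {a : Fin n × Fin n} (ha : a.1 ≠ a.2) (h : a ≠ s.idx) :
    act s.toWeyl (posRoot a : MvPolynomial (Fin n) A) = posRoot (s.rootPerm a) := by
  obtain ⟨x, y⟩ := a
  cases s with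
  | s i hi =>
    have h1 := swap_posRoot (A := A) (b := ⟨i, by omega⟩) (c := ⟨i + 1, hi⟩) (x := x) (y := y)
      (by simp) (fun z h1 h2 ↦ by simp only [ne_eq, Fin.ext_iff, Fin.lt_def] at *; omega) ha
      (by simpa [Simple.idx] using h)
    rw [Simple.rootPerm]
    refine Eq.trans ?_ h1
    simp only [posRoot, apply_ite (act _), map_sub, map_neg, act_X, Simple.toWeyl,
      Equiv.swap_inv, Pi.one_apply, Units.val_one, Int.cast_one, one_mul]
  | heart hi =>
    have h1 := flip_posRoot (A := A) (b := ⟨0, by omega⟩) (c := ⟨1, hi⟩) (x := x) (y := y)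
      (by simp) (fun z h1 h2 ↦ by simp only [ne_eq, Fin.ext_iff, Fin.lt_def] at *; omega) ha
      (by simpa [Simple.idx] using h) (fun z ↦ act (Simple.heart hi).toWeyl (X z))
      (by simp [act_X, Simple.toWeyl]) (by simp [act_X, Simple.toWeyl])
      (fun z h1 h2 ↦ by
        simp [act_X, Simple.toWeyl, Equiv.swap_apply_of_ne_of_ne h1 h2, Pi.mulSingle_eq_of_ne h1,
          Pi.mulSingle_eq_of_ne h2])
    rw [Simple.rootPerm]
    refine Eq.trans ?_ h1
    simp only [posRoot, apply_ite (act _), map_sub, map_neg]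

theorem Simple.act_root (s : Simple n) :
    act s.toWeyl (s.root : MvPolynomial (Fin n) A) = -s.root := by
  cases s with
  | s i hi => simp [Simple.root, act_X, Simple.toWeyl]
  | heart hi => simp [Simple.root, act_X, Simple.toWeyl]

end Action

/-! ### Inversions -/

section Inversions

variable {n : ℕ}

/-- The indices of the positive roots that `w` makes negative; the sign of a root is that
of its value at `(0, -1, -2, …)`. -/
def invSet (w : Hyperoctahedral n) : Finset (Fin n × Fin n) :=
  Finset.univ.offDiag.filter fun a ↦
    eval (fun i : Fin n ↦ -(i : ℤ)) (act w (posRoot a : MvPolynomial (Fin n) ℤ)) < 0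

theorem mem_invSet {w : Hyperoctahedral n} {a : Fin n × Fin n} : a ∈ invSet w ↔ a.1 ≠ a.2 ∧
    eval (fun i : Fin n ↦ -(i : ℤ)) (act w (posRoot a : MvPolynomial (Fin n) ℤ)) < 0 := by
  simp [invSet]

/-- The product of the negative images of the positive roots. -/
def invProd (A : Type*) [CommRing A] (w : Hyperoctahedral n) : MvPolynomial (Fin n) A :=
  ∏ a ∈ invSet w, act w (posRoot a)

theorem Simple.rootPerm_ne_idx (s : Simple n) {a : Fin n × Fin n} (h : a ≠ s.idx) :
    s.rootPerm a ≠ s.idx := fun h1 ↦ h <| by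
  rw [← s.rootPerm_rootPerm a, h1, s.rootPerm_idx]

theorem Simple.rootPerm_mem_invSet (s : Simple n) (w : Hyperoctahedral n) {a : Fin n × Fin n}
    (h : a ≠ s.idx) : s.rootPerm a ∈ invSet w ↔ a ∈ invSet (s.toWeyl * w) := by
  rw [mem_invSet, mem_invSet]
  constructor
  · rintro ⟨h1, h2⟩
    have h1 : a.1 ≠ a.2 := by
      have := s.rootPerm_ne h1
      rwa [s.rootPerm_rootPerm] at this
    rw [act_mul, s.act_posRoot h1 h]
    exact ⟨h1, h2⟩
  · rintro ⟨h1, h2⟩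
    rw [act_mul, s.act_posRoot h1 h] at h2
    exact ⟨s.rootPerm_ne h1, h2⟩

/-- A simple reflection permutes the positive roots other than its own, so away from that root the
inversions of `s w` and of `w` correspond, with the same images. -/
theorem prod_invSet_erase {A : Type*} [CommRing A] (s : Simple n) (w : Hyperoctahedral n) :
    ∏ a ∈ (invSet (s.toWeyl * w)).erase s.idx, act (s.toWeyl * w) (posRoot a) =
      ∏ a ∈ (invSet w).erase s.idx, act w (posRoot a : MvPolynomial (Fin n) A) := by
  refine Finset.prod_nbij' s.rootPerm s.rootPerm ?_ ?_ ?_ ?_ ?_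
  · intro a ha
    rw [Finset.mem_erase] at *
    exact ⟨s.rootPerm_ne_idx ha.1, (s.rootPerm_mem_invSet w ha.1).2 ha.2⟩
  · intro a ha
    rw [Finset.mem_erase] at *
    refine ⟨s.rootPerm_ne_idx ha.1, ?_⟩
    rw [← s.rootPerm_mem_invSet w (s.rootPerm_ne_idx ha.1), s.rootPerm_rootPerm]
    exact ha.2
  · exact fun a _ ↦ s.rootPerm_rootPerm a
  · exact fun a _ ↦ s.rootPerm_rootPerm a
  · intro a ha
    rw [Finset.mem_erase] at ha
    rw [act_mul, s.act_posRoot (mem_invSet.1 ha.2).1 ha.1]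

theorem card_invSet_erase (s : Simple n) (w : Hyperoctahedral n) :
    ((invSet (s.toWeyl * w)).erase s.idx).card = ((invSet w).erase s.idx).card := by
  refine Finset.card_nbij' s.rootPerm s.rootPerm ?_ ?_ ?_ ?_
  · intro a ha
    rw [Finset.mem_coe, Finset.mem_erase] at *
    exact ⟨s.rootPerm_ne_idx ha.1, (s.rootPerm_mem_invSet w ha.1).2 ha.2⟩
  · intro a ha
    rw [Finset.mem_coe, Finset.mem_erase] at *
    refine ⟨s.rootPerm_ne_idx ha.1, ?_⟩
    rw [← s.rootPerm_mem_invSet w (s.rootPerm_ne_idx ha.1), s.rootPerm_rootPerm]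
    exact ha.2
  · exact fun a _ ↦ s.rootPerm_rootPerm a
  · exact fun a _ ↦ s.rootPerm_rootPerm a

theorem card_invSet_mul_le (s : Simple n) (w : Hyperoctahedral n) :
    (invSet (s.toWeyl * w)).card ≤ (invSet w).card + 1 := by
  have h1 := card_invSet_erase s w
  have h2 := Finset.pred_card_le_card_erase (s := invSet (s.toWeyl * w)) (a := s.idx)
  have h3 := Finset.card_erase_le (s := invSet w) (a := s.idx)
  omega

theorem invSet_one : invSet (1 : Hyperoctahedral n) = ∅ := by
  refine Finset.eq_empty_of_forall_notMem fun a ha ↦ ?_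
  rw [mem_invSet, act_one] at ha
  obtain ⟨h1, h2⟩ := ha
  rw [posRoot] at h2
  split_ifs at h2 with h
  · rw [Fin.lt_def] at h
    simp at h2
    omega
  · simp at h2
    omega

/-- The number of inversions bounds word length from below. Only this half of the length formula is
needed: for the longest element an explicit word attains the bound. -/
theorem card_invSet_prod_le (l : List (Simple n)) :
    (invSet (l.map Simple.toWeyl).prod).card ≤ l.length := by
  induction l with
  | nil => simp [invSet_one]
  | cons s l ih =>
    have := card_invSet_mul_le s (l.map Simple.toWeyl).prod
    simp only [List.map_cons, List.prod_cons, List.length_cons]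
    omega

theorem invProd_mul {A : Type*} [CommRing A] (s : Simple n) (w : Hyperoctahedral n)
    (h : (invSet w).card + 1 = (invSet (s.toWeyl * w)).card) :
    invProd A (s.toWeyl * w) = act (s.toWeyl * w) s.root * invProd A w := by
  have h1 := card_invSet_erase s w
  have h3 := Finset.card_erase_le (s := invSet w) (a := s.idx)
  -- The counts agree away from the simple root, so the extra inversion can only be the simple root
  -- itself.
  have h4 : s.idx ∈ invSet (s.toWeyl * w) := by
    by_contra h4
    rw [Finset.erase_eq_of_notMem h4] at h1
    omega
  have h5 : s.idx ∉ invSet w := by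
    rw [mem_invSet, act_mul, s.posRoot_idx, s.act_root] at h4
    rw [mem_invSet, s.posRoot_idx]
    have := h4.2
    simp only [map_neg] at this
    exact fun h ↦ by linarith [h.2]
  rw [invProd, ← Finset.mul_prod_erase _ _ h4, prod_invSet_erase, Finset.erase_eq_of_notMem h5,
    invProd, s.posRoot_idx]

end Inversions

/-! ### Expansion of a composition of divided differences -/

section Expansion

variable {n : ℕ}

instance : Finite (Hyperoctahedral n) := Finite.of_equiv _ SemidirectProduct.equivProd.symm

instance : Fintype (weylD n) := Fintype.ofFinite _

instance : DecidableEq (weylD n) := Classical.decEq _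

theorem act_root_ne_zero {A : Type*} [CommRing A] [Nontrivial A] (w : Hyperoctahedral n)
    (s : Simple n) : act w (s.root : MvPolynomial (Fin n) A) ≠ 0 := by
  rw [← map_zero (act w), (act_injective w).ne_iff]
  intro h
  cases s with
  | s i hi =>
    have := congrArg (coeff (Finsupp.single ⟨i, by omega⟩ 1)) h
    simp [Simple.root, coeff_X, Finsupp.single_left_inj] at this
  | heart hi =>
    have := congrArg (coeff (Finsupp.single ⟨0, by omega⟩ 1)) h
    simp [Simple.root, coeff_X, Finsupp.single_left_inj] at this

theorem specialize_X (w : Hyperoctahedral n) (i : Fin n) :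
    specialize w (X i : Pol₂ n) = act w (X i) := by simp [specialize]

theorem specialize_C (w : Hyperoctahedral n) (f : Pol n) : specialize w (C f : Pol₂ n) = f := by
  simp [specialize]

/-- `specialize` as a ring homomorphism. -/
def specializeHom (w : Hyperoctahedral n) : Pol₂ n →ₐ[Pol n] Pol n :=
  aeval fun i ↦ act w (X i : Pol n)

theorem specialize_eq (w : Hyperoctahedral n) (f : Pol₂ n) :
    specialize w f = specializeHom w f := rfl

theorem specialize_act (v w : Hyperoctahedral n) (f : Pol₂ n) :
    specialize w (act v f) = specialize (v * w) f := by
  have : (specializeHom w).comp (act v) = specializeHom (v * w) :=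
    MvPolynomial.algHom_ext fun i ↦ by
      have := act_mul v w (X i : Pol n)
      simp only [AlgHom.comp_apply, act_X, map_mul, map_intCast, ← specialize_eq,
        specialize_X] at this ⊢
      exact this.symm
  exact congrArg (fun g ↦ g f) this

theorem specialize_inX (w : Hyperoctahedral n) (f : Pol n) : specialize w (inX f) = act w f := by
  have : (specializeHom w : Pol₂ n →+* Pol n).comp (map C) = (act w : Pol n →ₐ[ZHalf] Pol n) := by
    refine MvPolynomial.ringHom_ext (fun r ↦ ?_) fun i ↦ ?_
    · simp [specializeHom, ← MvPolynomial.algebraMap_eq]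
    · simp [specializeHom]
  exact congrArg (fun g ↦ g f) this

theorem specialize_inY (w : Hyperoctahedral n) (f : Pol n) : specialize w (inY f) = f :=
  specialize_C w f

theorem inX_root (s : Simple n) : inX (s.root : Pol n) = s.root := by
  cases s <;> simp [inX, Simple.root]

theorem specialize_root (w : Hyperoctahedral n) (s : Simple n) :
    specialize w (s.root : Pol₂ n) = act w s.root := by
  rw [← inX_root, specialize_inX]

/-- The coefficients of the expansion of a composition of divided differences, followed by the
specialization at `v`, in terms of specializations. -/
def coef (v : weylD n) : List (Simple n) → weylD n → FractionRing (Pol n)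
  | [], u => if u = v then 1 else 0
  | s :: l, u => (coef v l u + coef v l (s.refl * u)) /
      algebraMap (Pol n) (FractionRing (Pol n)) (act u.1 s.root)

/-- The value of `∂_s f` at `u` involves only the values of `f` at `u` and `s u`; iterating along
the word gives a finite expansion over the group. -/
theorem specialize_wordDivDiff (v : weylD n) (l : List (Simple n)) (f : Pol₂ n) :
    algebraMap (Pol n) (FractionRing (Pol n)) (specialize v.1 (wordDivDiff l f)) =
      ∑ u, coef v l u * algebraMap (Pol n) (FractionRing (Pol n)) (specialize u.1 f) := by
  induction l generalizing f with
  | nil => simp [wordDivDiff, coef]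
  | cons s l ih =>
    have hne (u : weylD n) : algebraMap (Pol n) (FractionRing (Pol n)) (act u.1 s.root) ≠ 0 := by
      rw [Ne, IsFractionRing.to_map_eq_zero_iff]
      exact act_root_ne_zero _ s
    have h1 (u : weylD n) : algebraMap (Pol n) (FractionRing (Pol n))
        (specialize u.1 (s.divDiff f)) =
        (algebraMap (Pol n) (FractionRing (Pol n)) (specialize u.1 f) -
          algebraMap (Pol n) (FractionRing (Pol n)) (specialize (s.refl * u).1 f)) /
          algebraMap (Pol n) (FractionRing (Pol n)) (act u.1 s.root) := by
      rw [eq_div_iff (hne u), ← map_sub, ← map_mul]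
      congr 1
      have := congrArg (specializeHom u.1) (s.root_mul_divDiff f)
      rw [map_mul, map_sub, ← specialize_eq, ← specialize_eq, ← specialize_eq, ← specialize_eq,
        specialize_root, specialize_act] at this
      rw [mul_comm, this]
      rfl
    have h2 : wordDivDiff (s :: l) f = wordDivDiff l (s.divDiff f) := rfl
    -- Reindexing by `u ↦ s u` changes the sign of the denominator, since `s` negates its root. This
    -- is the origin of the plus sign in `coef`.
    have h3 : ∑ u, coef v l u * (algebraMap (Pol n) (FractionRing (Pol n))
        (specialize (s.refl * u).1 f) / algebraMap (Pol n) (FractionRing (Pol n)) (act u.1 s.root)) =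
        - ∑ u, coef v l (s.refl * u) * (algebraMap (Pol n) (FractionRing (Pol n))
        (specialize u.1 f) / algebraMap (Pol n) (FractionRing (Pol n)) (act u.1 s.root)) := by
      rw [← Equiv.sum_comp (Equiv.mulLeft s.refl), ← Finset.sum_neg_distrib]
      refine Finset.sum_congr rfl fun u _ ↦ ?_
      rw [Equiv.coe_mulLeft, ← mul_assoc s.refl, s.refl_mul_self, one_mul]
      have : act (s.refl * u).1 (s.root : Pol n) = - act u.1 s.root := by
        change act (s.toWeyl * u.1) _ = _
        rw [act_mul, s.act_root, map_neg]
      rw [this, map_neg, div_neg, mul_neg]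
    simp only [h2, ih, h1, coef, sub_div, mul_sub, Finset.sum_sub_distrib]
    rw [h3, sub_neg_eq_add, ← Finset.sum_add_distrib]
    refine Finset.sum_congr rfl fun u _ ↦ ?_
    ring

/-- Only products of subwords can occur in the expansion at the identity, and each letter adds at
most one inversion. -/
theorem coef_one_eq_zero (l : List (Simple n)) (u : weylD n) (h : l.length < (invSet u.1).card) :
    coef 1 l u = 0 := by
  induction l generalizing u with
  | nil =>
    rw [coef, if_neg]
    rintro rfl
    simp [invSet_one] at h
  | cons s l ih =>
    rw [List.length_cons] at h
    have h1 := card_invSet_mul_le s (s.toWeyl * u.1)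
    rw [← mul_assoc, s.toWeyl_mul_self, one_mul] at h1
    rw [coef, ih u (by omega), ih (s.refl * u) (by change _ < (invSet (s.toWeyl * u.1)).card; omega),
      add_zero, zero_div]

/-- No proper subword reaches an element with as many inversions as letters, so at each letter one
of the two summands drops out and the denominators multiply to the product over all inversions. -/
theorem coef_one_mul_invProd (l : List (Simple n)) (w : weylD n)
    (hw : (l.map Simple.toWeyl).prod = w.1) (h : l.length = (invSet w.1).card) :
    coef 1 l w * algebraMap (Pol n) (FractionRing (Pol n)) (invProd ZHalf w.1) = 1 := by
  induction l generalizing w with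
  | nil =>
    have : w = 1 := Subtype.ext hw.symm
    subst this
    simp [coef, invProd, invSet_one]
  | cons s l ih =>
    have hw' : (l.map Simple.toWeyl).prod = (s.refl * w).1 := by
      change _ = s.toWeyl * w.1
      rw [← hw, List.map_cons, List.prod_cons, ← mul_assoc, s.toWeyl_mul_self, one_mul]
    have h1 := card_invSet_prod_le l
    have h2 := card_invSet_mul_le s (l.map Simple.toWeyl).prod
    have h3 : s.toWeyl * (l.map Simple.toWeyl).prod = w.1 := by rw [← hw]; simp
    rw [h3] at h2
    rw [List.length_cons] at h
    have h4 := ih (s.refl * w) hw' (by rw [← hw']; omega)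
    have h5 := invProd_mul (A := ZHalf) s (l.map Simple.toWeyl).prod (by rw [h3]; omega)
    rw [h3, hw'] at h5
    have hne : algebraMap (Pol n) (FractionRing (Pol n)) (act w.1 s.root) ≠ 0 := by
      rw [Ne, IsFractionRing.to_map_eq_zero_iff]
      exact act_root_ne_zero _ s
    rw [coef, coef_one_eq_zero l w (by omega), zero_add, h5, map_mul, ← mul_assoc,
      div_mul_cancel₀ _ hne, h4]

end Expansion

/-! ### Linearity of divided differences -/

section Linear

variable {n : ℕ} {A : Type*} [CommRing A]

theorem map_root {B : Type*} [CommRing B] (φ : A →+* B) (s : Simple n) :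
    map φ s.root = s.root := by
  cases s <;> simp [Simple.root]

theorem wordDivDiff_append (l l' : List (Simple n)) (f : MvPolynomial (Fin n) A) :
    wordDivDiff (l ++ l') f = wordDivDiff l' (wordDivDiff l f) := by
  simp [wordDivDiff]

variable [IsDomain A]

theorem Simple.root_ne_zero (s : Simple n) : (s.root : MvPolynomial (Fin n) A) ≠ 0 := by
  have := act_root_ne_zero (A := A) 1 s
  rwa [act_one] at this

theorem Simple.divDiff_eq_of_mul (s : Simple n) {f g : MvPolynomial (Fin n) A}
    (h : s.root * g = f - act s.toWeyl f) : s.divDiff f = g :=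
  mul_left_cancel₀ s.root_ne_zero ((s.root_mul_divDiff f).trans h.symm)

theorem Simple.divDiff_add (s : Simple n) (f g : MvPolynomial (Fin n) A) :
    s.divDiff (f + g) = s.divDiff f + s.divDiff g :=
  s.divDiff_eq_of_mul <| by
    rw [mul_add, s.root_mul_divDiff, s.root_mul_divDiff, map_add]; ring

/-- Divided differences are linear over the polynomials invariant under the reflection. -/
theorem Simple.divDiff_mul (s : Simple n) (f g : MvPolynomial (Fin n) A)
    (hf : act s.toWeyl f = f) : s.divDiff (f * g) = f * s.divDiff g :=
  s.divDiff_eq_of_mul <| by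
    rw [mul_left_comm, s.root_mul_divDiff, map_mul, hf]; ring

theorem Simple.divDiff_map {B : Type*} [CommRing B] (φ : B →+* A) (s : Simple n)
    (f : MvPolynomial (Fin n) B) : s.divDiff (map φ f) = map φ (s.divDiff f) :=
  s.divDiff_eq_of_mul <| by
    rw [act_map, ← map_sub, ← s.root_mul_divDiff, map_mul, map_root]

theorem wordDivDiff_add (l : List (Simple n)) (f g : MvPolynomial (Fin n) A) :
    wordDivDiff l (f + g) = wordDivDiff l f + wordDivDiff l g := by
  induction l generalizing f g with
  | nil => rfl
  | cons s l ih =>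
    change wordDivDiff l (s.divDiff (f + g)) = _
    rw [s.divDiff_add, ih]
    rfl

theorem wordDivDiff_mul (l : List (Simple n)) (f g : MvPolynomial (Fin n) A)
    (hf : ∀ s ∈ l, act s.toWeyl f = f) : wordDivDiff l (f * g) = f * wordDivDiff l g := by
  induction l generalizing g with
  | nil => rfl
  | cons s l ih =>
    change wordDivDiff l (s.divDiff (f * g)) = _
    rw [s.divDiff_mul f g (hf s (by simp)), ih _ fun t ht ↦ hf t (by simp [ht])]
    rfl

theorem wordDivDiff_map {B : Type*} [CommRing B] (φ : B →+* A)
    (l : List (Simple n)) (f : MvPolynomial (Fin n) B) :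
    wordDivDiff l (map φ f) = map φ (wordDivDiff l f) := by
  induction l generalizing f with
  | nil => rfl
  | cons s l ih =>
    change wordDivDiff l (s.divDiff (map φ f)) = _
    rw [s.divDiff_map, ih]
    rfl

end Linear

/-! ### Degrees in two sets of variables -/

section Degree

variable {n : ℕ}

/-- The homomorphism multiplying each variable by a new variable. -/
def scale (n : ℕ) : Pol n →+* Polynomial (Pol n) :=
  eval₂Hom (Polynomial.C.comp C) fun i ↦ Polynomial.X * Polynomial.C (X i)

/-- The homomorphism multiplying each variable of both sets by a new variable. -/
def scale₂ (n : ℕ) : Pol₂ n →+* Polynomial (Pol₂ n) :=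
  eval₂Hom ((Polynomial.mapRingHom C).comp (scale n)) fun i ↦ Polynomial.X * Polynomial.C (X i)

theorem scale_X (i : Fin n) : scale n (X i) = Polynomial.X * Polynomial.C (X i) := by
  simp [scale]

theorem scale_C (c : ZHalf) : scale n (C c) = Polynomial.C (C c) := by
  simp [scale]

theorem scale₂_X (i : Fin n) : scale₂ n (X i) = Polynomial.X * Polynomial.C (X i) := by
  simp [scale₂]

theorem scale₂_inX (f : Pol n) : scale₂ n (inX f) = Polynomial.mapRingHom (map C) (scale n f) := by
  have : (scale₂ n).comp (map C) = (Polynomial.mapRingHom (map C)).comp (scale n) := by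
    refine MvPolynomial.ringHom_ext (fun r ↦ ?_) fun i ↦ ?_
    · simp [scale₂, scale]
    · simp [scale₂, scale]
  exact congrArg (fun g ↦ g f) this

theorem scale₂_inY (f : Pol n) : scale₂ n (inY f) = Polynomial.mapRingHom C (scale n f) := by
  simp [inY, scale₂]

theorem scale₂_act (w : Hyperoctahedral n) (f : Pol₂ n) : scale₂ n (act w f) =
    Polynomial.mapRingHom (act w : Pol₂ n →ₐ[Pol n] Pol₂ n) (scale₂ n f) := by
  have : (scale₂ n).comp (act w : Pol₂ n →ₐ[Pol n] Pol₂ n) =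
      (Polynomial.mapRingHom (act w : Pol₂ n →ₐ[Pol n] Pol₂ n)).comp (scale₂ n) := by
    refine MvPolynomial.ringHom_ext (fun r ↦ ?_) fun i ↦ ?_
    · have h : (((act w : Pol₂ n →ₐ[Pol n] Pol₂ n) : Pol₂ n →+* Pol₂ n)).comp C = C := by
        ext <;> simp [← MvPolynomial.algebraMap_eq]
      have h2 : (act w : Pol₂ n →ₐ[Pol n] Pol₂ n) (C r) = C r := by
        simp [← MvPolynomial.algebraMap_eq]
      simp only [RingHom.comp_apply, RingHom.coe_coe, h2]
      change scale₂ n (inY r) = Polynomial.mapRingHom _ (scale₂ n (inY r))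
      rw [scale₂_inY, Polynomial.coe_mapRingHom, Polynomial.coe_mapRingHom, Polynomial.map_map, h]
    · simp only [RingHom.comp_apply, RingHom.coe_coe, act_X, map_mul, map_intCast, scale₂_X,
        Polynomial.coe_mapRingHom, Polynomial.map_X, Polynomial.map_C]
      ring
  exact congrArg (fun g ↦ g f) this

theorem scale₂_specialize (w : Hyperoctahedral n) (f : Pol₂ n) : scale n (specialize w f) =
    Polynomial.mapRingHom (specializeHom w : Pol₂ n →+* Pol n) (scale₂ n f) := by
  have : (scale n).comp (specializeHom w : Pol₂ n →+* Pol n) =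
      (Polynomial.mapRingHom (specializeHom w : Pol₂ n →+* Pol n)).comp (scale₂ n) := by
    refine MvPolynomial.ringHom_ext (fun r ↦ ?_) fun i ↦ ?_
    · have h : (specializeHom w : Pol₂ n →+* Pol n).comp C = RingHom.id _ := by
        ext <;> simp [specializeHom]
      simp only [RingHom.comp_apply, RingHom.coe_coe]
      rw [show specializeHom w (C r) = r from specialize_C w r]
      change _ = Polynomial.mapRingHom _ (scale₂ n (inY r))
      rw [scale₂_inY, ← RingHom.comp_apply, Polynomial.mapRingHom_comp, h]
      simp
    · simp only [RingHom.comp_apply, RingHom.coe_coe, scale₂_X, ← specialize_eq, specialize_X,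
        Polynomial.coe_mapRingHom, Polynomial.map_X, Polynomial.map_C, Polynomial.map_mul]
      simp only [act_X, map_mul, map_intCast, scale_X]
      ring
  exact congrArg (fun g ↦ g f) this

theorem scale_eval_one (f : Pol n) : (scale n f).eval 1 = f := by
  have : (Polynomial.evalRingHom 1).comp (scale n) = RingHom.id _ := by
    ext <;> simp [scale]
  exact congrArg (fun g ↦ g f) this

theorem scale₂_eval_one (f : Pol₂ n) : (scale₂ n f).eval 1 = f := by
  have : (Polynomial.evalRingHom 1).comp (scale₂ n) = RingHom.id _ := by
    ext <;> simp [scale₂, scale]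
  exact congrArg (fun g ↦ g f) this

theorem scale_eval_zero (f : Pol n) : (scale n f).eval 0 = C (constantCoeff f) := by
  have : (Polynomial.evalRingHom 0).comp (scale n) = C.comp constantCoeff := by
    ext <;> simp [scale]
  exact congrArg (fun g ↦ g f) this

theorem scale₂_eval_zero (f : Pol₂ n) :
    (scale₂ n f).eval 0 = C (C (constantCoeff (constantCoeff f))) := by
  have : (Polynomial.evalRingHom 0).comp (scale₂ n) =
      ((C.comp C).comp constantCoeff).comp constantCoeff := by
    ext <;> simp [scale₂, scale]
  exact congrArg (fun g ↦ g f) this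

theorem eq_C_of_natDegree_scale {f : Pol n} (h : (scale n f).natDegree = 0) : ∃ c, f = C c := by
  refine ⟨constantCoeff f, ?_⟩
  rw [← scale_eval_zero, Polynomial.eq_C_of_natDegree_eq_zero h, Polynomial.eval_C]
  conv_lhs => rw [← scale_eval_one f, Polynomial.eq_C_of_natDegree_eq_zero h, Polynomial.eval_C]

theorem eq_C_of_natDegree_scale₂ {f : Pol₂ n} (h : (scale₂ n f).natDegree = 0) :
    ∃ c, f = C (C c) := by
  refine ⟨constantCoeff (constantCoeff f), ?_⟩
  rw [← scale₂_eval_zero, Polynomial.eq_C_of_natDegree_eq_zero h, Polynomial.eval_C]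
  conv_lhs => rw [← scale₂_eval_one f, Polynomial.eq_C_of_natDegree_eq_zero h, Polynomial.eval_C]

theorem scale₂_root (s : Simple n) :
    scale₂ n s.root = Polynomial.X * Polynomial.C (s.root : Pol₂ n) := by
  cases s <;> simp only [Simple.root, map_sub, map_neg, scale₂_X] <;> ring

/-- The root is homogeneous of degree one and the group action does not raise degrees, so dividing
by the root lowers the degree bound by one. -/
theorem natDegree_scale₂_divDiff (s : Simple n) (f : Pol₂ n) :
    (scale₂ n (s.divDiff f)).natDegree ≤ (scale₂ n f).natDegree - 1 := by
  rcases eq_or_ne (scale₂ n (s.divDiff f)) 0 with h | h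
  · simp [h]
  have h1 := congrArg (fun g ↦ (scale₂ n g).natDegree) (s.root_mul_divDiff f)
  simp only [map_mul, map_sub, scale₂_act] at h1
  have h2 : scale₂ n (s.root : Pol₂ n) ≠ 0 := by
    rw [scale₂_root]
    exact mul_ne_zero Polynomial.X_ne_zero (Polynomial.C_ne_zero.2 s.root_ne_zero)
  rw [Polynomial.natDegree_mul h2 h, scale₂_root, Polynomial.natDegree_X_mul
    (Polynomial.C_ne_zero.2 s.root_ne_zero), Polynomial.natDegree_C] at h1
  have h3 := Polynomial.natDegree_sub_le (scale₂ n f)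
    (Polynomial.mapRingHom (act s.toWeyl : Pol₂ n →ₐ[Pol n] Pol₂ n) (scale₂ n f))
  have h4 := Polynomial.natDegree_map_le (f := ((act s.toWeyl : Pol₂ n →ₐ[Pol n] Pol₂ n) :
    Pol₂ n →+* Pol₂ n)) (p := scale₂ n f)
  rw [Polynomial.coe_mapRingHom] at h1 h3
  omega

theorem natDegree_scale₂_wordDivDiff (l : List (Simple n)) (f : Pol₂ n) :
    (scale₂ n (wordDivDiff l f)).natDegree ≤ (scale₂ n f).natDegree - l.length := by
  induction l generalizing f with
  | nil => simp [wordDivDiff]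
  | cons s l ih =>
    have h1 := ih (s.divDiff f)
    have h2 := natDegree_scale₂_divDiff s f
    change (scale₂ n (wordDivDiff l (s.divDiff f))).natDegree ≤ _
    rw [List.length_cons]
    omega

end Degree

/-! ### Composition of divided differences along a word of the longest element -/

section Symmetrizer

variable {n : ℕ}

theorem two_ne_zero_ZHalf : (2 : ZHalf) ≠ 0 := fun h ↦ by
  have := two_mul_half
  rw [h, zero_mul] at this
  exact zero_ne_one this

/-- The product of the positive roots. -/
def disc (n : ℕ) (A : Type*) [CommRing A] : MvPolynomial (Fin n) A :=
  (Matrix.vandermonde fun i : Fin n ↦ (X i : MvPolynomial (Fin n) A) ^ 2).det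

theorem disc_eq_prod (A : Type*) [CommRing A] :
    disc n A = ∏ i : Fin n, ∏ j ∈ Finset.Ioi i, (X j ^ 2 - X i ^ 2) :=
  Matrix.det_vandermonde _

theorem disc_eq_prod_posRoot (A : Type*) [CommRing A] :
    disc n A = ∏ a ∈ Finset.univ.offDiag, posRoot a := by
  have h1 : (Finset.univ : Finset (Fin n)).offDiag =
      (Finset.univ.filter fun a : Fin n × Fin n ↦ a.1 < a.2) ∪
        (Finset.univ.filter fun a : Fin n × Fin n ↦ a.2 < a.1) := by
    ext a
    simp [lt_or_lt_iff_ne]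
  have h2 : Disjoint (Finset.univ.filter fun a : Fin n × Fin n ↦ a.1 < a.2)
      (Finset.univ.filter fun a : Fin n × Fin n ↦ a.2 < a.1) :=
    Finset.disjoint_filter.2 fun a _ h ↦ h.asymm
  have h3 : ∏ a : Fin n × Fin n with a.2 < a.1, (posRoot a : MvPolynomial (Fin n) A) =
      ∏ a : Fin n × Fin n with a.1 < a.2, (-X a.1 - X a.2) := by
    refine Finset.prod_nbij' Prod.swap Prod.swap ?_ ?_ ?_ ?_ ?_
    · simp
    · simp
    · simp
    · simp
    · intro a ha
      rw [Finset.mem_filter] at ha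
      rw [posRoot, if_neg ha.2.asymm]
      simp only [Prod.fst_swap, Prod.snd_swap]
      ring
  rw [h1, Finset.prod_union h2, h3, ← Finset.prod_mul_distrib, disc_eq_prod,
    Finset.prod_filter, Fintype.prod_prod_type]
  refine Finset.prod_congr rfl fun i _ ↦ ?_
  rw [← Finset.prod_filter]
  refine Finset.prod_congr (by ext; simp) fun j hj ↦ ?_
  rw [Finset.mem_filter] at hj
  rw [posRoot, if_pos hj.2]
  ring

/-- The Vandermonde matrix is formed from squares, which do not see sign changes; the underlying
permutation only permutes its rows. -/
theorem act_disc {A : Type*} [CommRing A] (w : Hyperoctahedral n) :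
    act w (disc n A) = ((Equiv.Perm.sign w.right : ℤ) : MvPolynomial (Fin n) A) * disc n A := by
  have h1 : (act w).mapMatrix (Matrix.vandermonde fun i : Fin n ↦
      (X i : MvPolynomial (Fin n) A) ^ 2) = (Matrix.vandermonde fun i : Fin n ↦
      (X i : MvPolynomial (Fin n) A) ^ 2).submatrix (w.right⁻¹ : Equiv.Perm (Fin n)) id := by
    ext1 i j
    have h2 : ((w.left i : ℤ) : MvPolynomial (Fin n) A) ^ 2 = 1 := by
      rcases Int.units_eq_one_or (w.left i) with h | h <;> simp [h]
    simp only [AlgHom.mapMatrix_apply, Matrix.map_apply, Matrix.vandermonde_apply, map_pow, act_X,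
      Matrix.submatrix_apply, id_eq, mul_pow, h2, one_mul]
  rw [disc, AlgHom.map_det, h1, Matrix.det_permute]
  simp

theorem disc_ne_zero (A : Type*) [CommRing A] [IsDomain A] :
    disc n A ≠ 0 := by
  rw [disc_eq_prod_posRoot, Finset.prod_ne_zero_iff]
  intro a ha h0
  rw [Finset.mem_offDiag] at ha
  have := congrArg (coeff (Finsupp.single a.1 1)) h0
  rw [posRoot] at this
  split_ifs at this <;> simp [coeff_X, Finsupp.single_left_inj, ha.2.2.symm] at this

theorem map_disc {A B : Type*} [CommRing A] [CommRing B] (φ : A →+* B) :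
    map φ (disc n A) = disc n B := by
  simp [disc_eq_prod]

theorem X_ne_neg_X {i j : Fin n} : (X i : Pol n) ≠ -X j := by
  intro h
  have h1 := congrArg (coeff (Finsupp.single i 1)) h
  rw [coeff_neg, coeff_X, coeff_X, if_pos rfl] at h1
  split_ifs at h1
  · exact two_ne_zero_ZHalf (by linear_combination h1)
  · simp at h1

/-- Faithfulness of the action, required for the linear independence of these characters; it fails
in characteristic 2. -/
theorem act_toMonoidHom_injective : Function.Injective
    fun w : Hyperoctahedral n ↦ ((act w : Pol n →ₐ[ZHalf] Pol n) : Pol n →* Pol n) := by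
  intro v w h
  have h1 (i : Fin n) : v.left i = w.left i ∧ v.right⁻¹ i = w.right⁻¹ i := by
    have h2 : act v (X i : Pol n) = act w (X i) := congrArg (fun g ↦ g (X i)) h
    rw [act_X, act_X] at h2
    rcases Int.units_eq_one_or (v.left i) with hv | hv <;>
      rcases Int.units_eq_one_or (w.left i) with hw | hw <;> simp only [hv, hw] at h2 ⊢ <;>
      simp only [Units.val_one, Units.val_neg, Int.cast_one, Int.cast_neg, one_mul, neg_mul,
        neg_inj] at h2
    · exact ⟨trivial, X_injective h2⟩
    · exact absurd h2 X_ne_neg_X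
    · exact absurd h2.symm X_ne_neg_X
    · exact ⟨trivial, X_injective h2⟩
  refine SemidirectProduct.ext (funext fun i ↦ (h1 i).1) ?_
  rw [← inv_inj]
  exact Equiv.ext fun i ↦ (h1 i).2

/-- The coefficients of the expansion along a word of length `n (n - 1)` are constant multiples of
the inverse of the product of the positive roots. -/
theorem exists_coef_eq {K : Pol₂ n} (hK : ∀ w ∈ weylD n, w ≠ 1 → specialize w K = 0)
    (hK1 : specialize 1 K = disc n ZHalf) (hdeg : (scale₂ n K).natDegree ≤ n * (n - 1))
    (l : List (Simple n)) (hl : l.length = n * (n - 1)) :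
    ∃ κ : weylD n → ZHalf, ∀ v u, coef v l u * algebraMap (Pol n) (FractionRing (Pol n))
      (disc n ZHalf) = algebraMap (Pol n) (FractionRing (Pol n)) (C (κ u)) := by
  -- The word has as many letters as the degree bound of the kernel, so only a constant is left.
  have h1 (u : weylD n) : ∃ c : ZHalf, wordDivDiff l (act u.1⁻¹ K) = C (C c) := by
    refine eq_C_of_natDegree_scale₂ ?_
    have h2 := natDegree_scale₂_wordDivDiff l (act u.1⁻¹ K)
    have h3 : (scale₂ n (act u.1⁻¹ K)).natDegree ≤ (scale₂ n K).natDegree := by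
      rw [scale₂_act]
      exact Polynomial.natDegree_map_le
    omega
  choose κ hκ using h1
  refine ⟨κ, fun v u ↦ ?_⟩
  have h4 := specialize_wordDivDiff v l (act u.1⁻¹ K)
  -- The translated kernel has a nonzero specialization only at `u`. The constant it isolates does
  -- not depend on `v`.
  rw [hκ, specialize_C, Finset.sum_eq_single u] at h4
  · rw [h4, specialize_act, inv_mul_cancel, hK1]
  · intro w _ hw
    rw [specialize_act, hK _ (mul_mem (inv_mem u.2) w.2), map_zero, mul_zero]
    intro h
    exact hw (Subtype.ext (inv_mul_eq_one.1 h).symm)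
  · simp

variable (n) in
theorem invSet_longest : invSet (longest n).1 = Finset.univ.offDiag := by
  ext a
  rw [mem_invSet]
  simp only [Finset.mem_offDiag, Finset.mem_univ, true_and, and_iff_left_iff_imp]
  intro ha
  have h1 (i : Fin n) : eval (fun i : Fin n ↦ -(i : ℤ)) (act (longest n).1 (X i)) = (i : ℤ) := by
    rw [act_X]
    by_cases h : Odd n ∧ (i : ℕ) = 0
    · simp [longest, h]
    · simp [longest, h]
  rw [posRoot]
  split_ifs with h
  · rw [map_sub, map_sub, h1, h1]
    rw [Fin.lt_def] at h
    omega
  · rw [map_sub, map_sub, map_neg, map_neg, h1, h1]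
    have : (a.1 : ℕ) ≠ a.2 := fun h ↦ ha (Fin.ext h)
    omega

variable (n) in
theorem card_invSet_longest : (invSet (longest n).1).card = n * (n - 1) := by
  rw [invSet_longest, Finset.offDiag_card, Finset.card_univ, Fintype.card_fin, Nat.mul_sub,
    mul_one]

variable (n) in
theorem invProd_longest : invProd ZHalf (longest n).1 = disc n ZHalf := by
  rw [invProd, invSet_longest, ← map_prod, ← disc_eq_prod_posRoot, act_disc]
  simp [longest]

/-- The expansions at `v` and at the identity share the constants `κ`. Transporting one to the other
makes `κ` alternating, so the single value at the longest element determines it. -/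
theorem disc_mul_wordDivDiff_Pol {K : Pol₂ n}
    (hK : ∀ w ∈ weylD n, w ≠ 1 → specialize w K = 0)
    (hK1 : specialize 1 K = disc n ZHalf) (hdeg : (scale₂ n K).natDegree ≤ n * (n - 1))
    (l : List (Simple n)) (hl : l.length = n * (n - 1))
    (hw : (l.map Simple.toWeyl).prod = (longest n).1) (g : Pol n) :
    disc n ZHalf * wordDivDiff l g =
      ∑ u : weylD n, ((Equiv.Perm.sign u.1.right : ℤ) : Pol n) * act u.1 g := by
  obtain ⟨κ, hκ⟩ := exists_coef_eq hK hK1 hdeg l hl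
  have h1 (v : weylD n) (g : Pol n) : disc n ZHalf * act v.1 (wordDivDiff l g) =
      ∑ u : weylD n, C (κ u) * act u.1 g := by
    apply IsFractionRing.injective (Pol n) (FractionRing (Pol n))
    have h2 := specialize_wordDivDiff v l (inX g)
    rw [inX, wordDivDiff_map, ← inX, ← inX, specialize_inX] at h2
    rw [map_mul, h2, Finset.mul_sum, map_sum]
    refine Finset.sum_congr rfl fun u _ ↦ ?_
    rw [map_mul, ← hκ v u, specialize_inX]
    ring
  have h2 (v u : weylD n) : κ (u * v⁻¹) = (Equiv.Perm.sign v.1.right : ℤ) * κ u := by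
    have h3 (g : Pol n) : ∑ u : weylD n, (C (κ (u * v⁻¹)) -
        ((Equiv.Perm.sign v.1.right : ℤ) : Pol n) * C (κ u)) * act u.1 g = 0 := by
      simp only [sub_mul, Finset.sum_sub_distrib, mul_assoc]
      rw [← Finset.mul_sum, ← h1 v, ← mul_assoc, ← act_disc, ← map_mul, sub_eq_zero]
      have h4 := h1 1 g
      rw [OneMemClass.coe_one, act_one] at h4
      rw [h4, ← Equiv.sum_comp (Equiv.mulRight v), map_sum]
      refine Finset.sum_congr rfl fun u _ ↦ ?_
      rw [Equiv.coe_mulRight, mul_inv_cancel_right, map_mul, Subgroup.coe_mul, act_mul]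
      congr 1
      simp [← MvPolynomial.algebraMap_eq]
    -- Dedekind independence turns an identity valid for all `g` into equality of coefficients.
    have h5 := (linearIndependent_monoidHom (Pol n) (Pol n)).comp
      (fun w : weylD n ↦ ((act w.1 : Pol n →ₐ[ZHalf] Pol n) : Pol n →* Pol n))
      fun v w h ↦ Subtype.ext (act_toMonoidHom_injective h)
    rw [Fintype.linearIndependent_iff] at h5
    have h6 := h5 (fun u ↦ C (κ (u * v⁻¹)) -
        ((Equiv.Perm.sign v.1.right : ℤ) : Pol n) * C (κ u)) (by
      funext g
      rw [Finset.sum_apply]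
      exact h3 g) u
    rw [sub_eq_zero, ← map_intCast (C : ZHalf →+* Pol n), ← C_mul] at h6
    exact C_injective _ _ h6
  -- All positive roots are inversions of the longest element, and its coefficient is the inverse of
  -- the product of their images, which is `disc` itself.
  have h7 : κ (longest n) = 1 := by
    have h8 := coef_one_mul_invProd l (longest n) hw (by rw [hl, card_invSet_longest])
    rw [invProd_longest, hκ, map_eq_one_iff _ (IsFractionRing.injective _ _), ← C_1] at h8
    exact C_injective _ _ h8
  have h9 (u : weylD n) : κ u = (Equiv.Perm.sign u.1.right : ℤ) := by
    have h10 := h2 (u⁻¹ * longest n) (longest n)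
    rw [mul_inv_rev, inv_inv, mul_inv_cancel_left, h7, mul_one] at h10
    rw [h10]
    simp [longest]
  have := h1 1 g
  rw [OneMemClass.coe_one, act_one] at this
  rw [this]
  refine Finset.sum_congr rfl fun u _ ↦ ?_
  rw [h9, map_intCast]

/-- Composition of divided differences along a word of the longest element of minimal length is
antisymmetrization divided by the product of the positive roots. -/
theorem disc_mul_wordDivDiff {K : Pol₂ n} (hK : ∀ w ∈ weylD n, w ≠ 1 → specialize w K = 0)
    (hK1 : specialize 1 K = disc n ZHalf) (hdeg : (scale₂ n K).natDegree ≤ n * (n - 1))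
    (l : List (Simple n)) (hl : l.length = n * (n - 1))
    (hw : (l.map Simple.toWeyl).prod = (longest n).1) {A : Type*} [CommRing A] [IsDomain A]
    (φ : ZHalf →+* A) (f : MvPolynomial (Fin n) A) :
    disc n A * wordDivDiff l f =
      ∑ u : weylD n, ((Equiv.Perm.sign u.1.right : ℤ) : MvPolynomial (Fin n) A) * act u.1 f := by
  induction f using MvPolynomial.induction_on' with
  | monomial m a =>
    -- Both sides are linear over the coefficients, so monomials with coefficient one suffice, and
    -- these come from `ZHalf`.
    have h1 : (monomial m a : MvPolynomial (Fin n) A) = C a * map φ (monomial m 1) := by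
      rw [map_monomial, map_one, C_mul_monomial, mul_one]
    have h2 (w : Hyperoctahedral n) :
        act w (C a : MvPolynomial (Fin n) A) = C a := (act w).commutes a
    have h3 := congrArg (map φ) (disc_mul_wordDivDiff_Pol hK hK1 hdeg l hl hw (monomial m 1))
    rw [map_mul, map_disc, ← wordDivDiff_map] at h3
    rw [h1, wordDivDiff_mul _ _ _ fun s _ ↦ h2 _, mul_left_comm, h3, map_sum, Finset.mul_sum]
    refine Finset.sum_congr rfl fun u _ ↦ ?_
    rw [map_mul (act u.1), h2, act_map, map_mul, map_intCast]
    ring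
  | add f g hf hg =>
    rw [wordDivDiff_add, mul_add, hf, hg, ← Finset.sum_add_distrib]
    simp only [map_add, mul_add]

end Symmetrizer

/-! ### Words of the longest elements -/

section Words

variable {n : ℕ}

/-- The action of a simple reflection on sequences by places. -/
def Simple.place : Simple n → (ℕ → ℤ) → ℕ → ℤ
  | .s i _, q => fun k ↦ if k = i then q (i + 1) else if k = i + 1 then q i else q k
  | .heart _, q => fun k ↦ if k = 0 then -q 1 else if k = 1 then -q 0 else q k

/-- A word is followed through the values of the transformed variables at the point `(0, -1, -2,
…)`, on which the simple reflections act by places. -/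
theorem prod_word_apply (l : List (Simple n)) (i : Fin n) :
    ((l.map Simple.toWeyl).prod.left i : ℤ) * -((l.map Simple.toWeyl).prod.right⁻¹ i : ℕ) =
      l.foldr Simple.place (fun k ↦ -(k : ℤ)) i := by
  induction l generalizing i with
  | nil => simp
  | cons s l ih =>
    rw [List.map_cons, List.prod_cons, List.foldr_cons]
    generalize hw : (l.map Simple.toWeyl).prod = w at ih
    have h1 : ((s.toWeyl * w).left i : ℤ) * -((s.toWeyl * w).right⁻¹ i : ℕ) =
        s.toWeyl.left i * ((w.left (s.toWeyl.right⁻¹ i) : ℤ) *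
          -(w.right⁻¹ (s.toWeyl.right⁻¹ i) : ℕ)) := by
      rw [← mul_assoc]
      congr 1
    rw [h1, ih]
    cases s with
    | s j h =>
      simp only [Simple.toWeyl, Simple.place, Equiv.swap_inv, Equiv.swap_apply_def, Fin.ext_iff]
      split_ifs <;> simp
    | heart h =>
      have h0 : 0 < n := by omega
      by_cases h1 : i = ⟨0, h0⟩
      · subst h1; simp [Simple.toWeyl, Simple.place]
      by_cases h2 : i = ⟨1, h⟩
      · subst h2; simp [Simple.toWeyl, Simple.place]
      simp only [Simple.toWeyl, Simple.place, Equiv.swap_inv, Equiv.swap_apply_of_ne_of_ne h1 h2]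
      rw [Fin.ext_iff] at h1 h2
      simp only at h1 h2
      rw [if_neg h1, if_neg h2]
      simp [Fin.ext_iff, h1, h2]

theorem prod_word_mem (l : List (Simple n)) : (l.map Simple.toWeyl).prod ∈ weylD n :=
  Subgroup.list_prod_mem _ fun x hx ↦ by
    obtain ⟨s, _, rfl⟩ := List.mem_map.1 hx
    exact s.toWeyl_mem

theorem eq_longest {w : Hyperoctahedral n} (hw : w ∈ weylD n)
    (h : ∀ i, (w.left i : ℤ) * -(w.right⁻¹ i : ℕ) = (i : ℕ)) : w = (longest n).1 := by
  have h1 (i : Fin n) : w.right⁻¹ i = i ∧ ((i : ℕ) ≠ 0 → w.left i = -1) := by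
    have := h i
    rcases Int.units_eq_one_or (w.left i) with hi | hi <;> rw [hi] at this ⊢
    · simp only [Units.val_one, one_mul] at this
      refine ⟨Fin.ext (by omega), fun h ↦ by omega⟩
    · simp only [Units.val_neg, Units.val_one, neg_mul, one_mul, neg_neg] at this
      exact ⟨Fin.ext (by omega), fun _ ↦ rfl⟩
  have h2 (i : Fin n) (hi : (i : ℕ) ≠ 0) : w.left i = (longest n).1.left i := by
    rw [(h1 i).2 hi]
    simp [longest, hi]
  refine SemidirectProduct.ext ?_ ?_
  · rcases Nat.eq_zero_or_pos n with rfl | hn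
    · exact Subsingleton.elim _ _
    · funext i
      by_cases hi : (i : ℕ) = 0
      · have h3 : ∏ j, w.left j = ∏ j, (longest n).1.left j :=
          Eq.trans hw (longest n).2.symm
        rw [← Finset.mul_prod_erase _ _ (Finset.mem_univ i),
          ← Finset.mul_prod_erase _ _ (Finset.mem_univ i),
          Finset.prod_congr rfl fun j hj ↦ h2 j ?_] at h3
        · exact mul_right_cancel h3
        · rw [Finset.mem_erase] at hj
          intro h4
          exact hj.1 (Fin.ext (h4.trans hi.symm))
      · exact h2 i hi
  · rw [← inv_inj]
    refine Equiv.ext fun i ↦ ?_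
    rw [(h1 i).1]
    simp [longest]

theorem foldr_place_up (j m : ℕ) (h : ∀ k : Fin m, (k : ℕ) + j + 1 < n) (q : ℕ → ℤ) (k : ℕ) :
    ((List.finRange m).map fun a : Fin m ↦ (Simple.s ((a : ℕ) + j) (h a) : Simple n)).foldr Simple.place q k
      = if k = j then q (j + m) else if j < k ∧ k ≤ j + m then q (k - 1) else q k := by
  induction m generalizing q k with
  | zero =>
    simp
    grind
  | succ m ih =>
    rw [List.finRange_succ_last, List.map_append, List.foldr_append, List.map_map]
    have := ih (fun k ↦ h k.castSucc)
    simp only [Function.comp_def, Fin.val_castSucc]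
    rw [this]
    simp only [List.map_cons, List.map_nil, List.foldr_cons, List.foldr_nil, Simple.place,
      Fin.val_last]
    grind

/-- Read from the right, a block moves the entries `-m` and `-(m+1)` to the first two places, and
then `♥` turns them into `m+1` and `m`, ahead of the entries `m-1, …, 0` already produced. -/
theorem foldr_place_vWord (m : ℕ) (h : m ≤ n) (k : ℕ) :
    (vWord n m h).foldr Simple.place (fun k ↦ -(k : ℤ)) k =
      if k < m then (m : ℤ) - 1 - k else -k := by
  induction m using Nat.twoStepInduction generalizing k with
  | zero => simp [vWord]
  | one =>
    simp only [vWord, List.foldr_nil]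
    split_ifs with h1
    · have : k = 0 := by omega
      simp [this]
    · rfl
  | more m ih _ =>
    have h1 := foldr_place_up (n := n) 1 m (fun k ↦ by omega)
    have h2 := foldr_place_up (n := n) 0 m (fun k ↦ by omega)
    simp only [add_zero] at h2
    simp only [vWord, List.foldr_cons, List.foldr_append, List.cons_append]
    have h3 : (vWord n m (by omega)).foldr Simple.place (fun k ↦ -(k : ℤ)) =
        fun k ↦ if k < m then (m : ℤ) - 1 - k else -k := funext (ih (by omega))
    rw [h3]
    simp only [Simple.place, h1, h2]
    push_cast
    rcases k with _ | _ | k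
    · grind
    · grind
    · grind

theorem length_vWord (m : ℕ) (h : m ≤ n) : 2 * (vWord n m h).length = m * (m - 1) := by
  induction m using Nat.twoStepInduction with
  | zero => simp [vWord]
  | one => simp [vWord]
  | more m ih _ =>
    have := ih (by omega)
    simp only [vWord, List.length_cons, List.length_append, List.length_map, List.length_finRange]
    rcases m with _ | m
    · simp [vWord]
    · simp only [Nat.add_sub_cancel] at this
      have e : m + 1 + 2 - 1 = m + 2 := by omega
      rw [e]
      nlinarith

/-- The word `s (j + m - 1), …, s j`. -/
def downWord (j : ℕ) : (m : ℕ) → j + m < n → List (Simple n)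
  | 0, _ => []
  | m + 1, h => .s (j + m) h :: downWord j m (by omega)

variable (n) in
/-- A reduced word of the reversal of the last `m + 1` coordinates. -/
def aWord : (m : ℕ) → m < n → List (Simple n)
  | 0, _ => []
  | m + 1, h => downWord (n - 1 - (m + 1)) (m + 1) (by omega) ++ aWord m (by omega)

theorem length_downWord (j m : ℕ) (h : j + m < n) : (downWord j m h).length = m := by
  induction m with
  | zero => rfl
  | succ m ih => rw [downWord, List.length_cons, ih]

theorem length_aWord (m : ℕ) (h : m < n) : 2 * (aWord n m h).length = (m + 1) * m := by
  induction m with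
  | zero => rfl
  | succ m ih =>
    have := ih (by omega)
    rw [aWord, List.length_append, length_downWord]
    nlinarith

theorem foldr_place_downWord (j m : ℕ) (h : j + m < n) (q : ℕ → ℤ) (k : ℕ) :
    (downWord j m h).foldr Simple.place q k =
      if j ≤ k ∧ k < j + m then q (k + 1) else if k = j + m then q j else q k := by
  induction m generalizing k with
  | zero =>
    simp [downWord]
    grind
  | succ m ih =>
    have := ih (by omega)
    simp only [downWord, List.foldr_cons, Simple.place, this]
    grind

theorem foldr_place_aWord (m : ℕ) (h : m < n) (q : ℕ → ℤ) (hq : ∀ k < n, q k = n - 1 - k) (k : ℕ)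
    (hk : k < n) : (aWord n m h).foldr Simple.place q k =
      if n ≤ k + 1 + m then (k : ℤ) + 1 + m - n else n - 1 - k := by
  induction m generalizing k with
  | zero =>
    simp only [aWord, List.foldr_nil]
    rw [hq k hk]
    grind
  | succ m ih =>
    simp only [aWord, List.foldr_append, foldr_place_downWord]
    have := ih (by omega)
    rw [this k hk]
    by_cases h1 : k + 1 < n
    · rw [this (k + 1) h1, this _ (by omega)]
      grind
    · rw [this (n - 1 - (m + 1)) (by omega)]
      grind

/-- A reduced word of the longest element. -/
def longWord (n : ℕ) (hn : 0 < n) : List (Simple n) :=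
  aWord n (n - 1) (by omega) ++ vWord n n le_rfl

theorem length_longWord (hn : 0 < n) : (longWord n hn).length = n * (n - 1) := by
  have h1 := length_aWord (n - 1) (n := n) (by omega)
  have h2 := length_vWord n (n := n) le_rfl
  rw [longWord, List.length_append]
  rw [Nat.sub_add_cancel hn] at h1
  omega

theorem prod_longWord (hn : 0 < n) : ((longWord n hn).map Simple.toWeyl).prod = (longest n).1 := by
  refine eq_longest (prod_word_mem _) fun i ↦ ?_
  rw [prod_word_apply, longWord, List.foldr_append, foldr_place_aWord _ _ _ _ _ i.2]
  · rw [if_pos (by omega)]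
    push_cast [Nat.cast_sub (show 1 ≤ n from hn)]
    ring
  · intro k hk
    rw [foldr_place_vWord, if_pos hk]

/-- The inversion count and the explicit word bound the minimal length from both sides. -/
theorem length_of_isReduced_longest (hn : 0 < n) {l : List (Simple n)}
    (hl : IsReduced l (longest n).1) : l.length = n * (n - 1) := by
  have h1 := hl.2 _ (prod_longWord hn)
  rw [length_longWord] at h1
  have h2 := card_invSet_prod_le l
  rw [hl.1, card_invSet_longest] at h2
  omega

end Words

/-! ### The type `A` kernel -/

section KernelA

variable {n : ℕ}

/-- The product of the `x_i - y_j` over `j < e i`. -/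
def stairProd (n : ℕ) (e : ℕ → ℕ) : Pol₂ n :=
  ∏ i : Fin n, ∏ j ∈ Finset.univ.filter fun j : Fin n ↦ (j : ℕ) < e i, (X i - C (X j))

theorem kernelA_eq_stairProd : kernelA n = stairProd n id := by
  rw [kernelA, stairProd, Finset.prod_filter, Fintype.prod_prod_type]
  refine Finset.prod_congr rfl fun i _ ↦ ?_
  rw [← Finset.prod_filter]
  refine Finset.prod_congr (by ext; simp) fun j _ ↦ ?_
  simp [inX, inY]

/-- The two rows differ by a single factor `x_{i+1} - y`, and the rest is symmetric in `x_i,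
x_{i+1}`. The divided difference of that factor is `-1`. -/
theorem divDiff_stairProd (i : ℕ) (hi : i + 1 < n) (e : ℕ → ℕ) (he : e (i + 1) = e i + 1)
    (hn : e i < n) : (Simple.s i hi).divDiff (stairProd n e) =
      -stairProd n (Function.update e (i + 1) (e i)) := by
  apply Simple.divDiff_eq_of_mul
  set a : Fin n := ⟨i, by omega⟩
  set b : Fin n := ⟨i + 1, hi⟩
  have hab : a ≠ b := by simp [a, b]
  set g : ℕ → Fin n → Pol₂ n := fun k z ↦ ∏ j ∈ Finset.univ.filter fun j : Fin n ↦ (j : ℕ) < k, (X z - C (X j))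
  have hg (z : Fin n) : g (e i + 1) z = (X z - C (X ⟨e i, hn⟩)) * g (e i) z := by
    have : (Finset.univ.filter fun j : Fin n ↦ (j : ℕ) < e i + 1) =
        insert ⟨e i, hn⟩ (Finset.univ.filter fun j : Fin n ↦ (j : ℕ) < e i) := by
      ext j
      simp only [Finset.mem_filter, Finset.mem_univ, true_and, Finset.mem_insert, Fin.ext_iff]
      omega
    simp only [g]
    rw [this, Finset.prod_insert (by simp)]
  have split (e' : ℕ → ℕ) : stairProd n e' = g (e' i) a * g (e' (i + 1)) b *
      ∏ z ∈ (Finset.univ.erase a).erase b, g (e' z) z := by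
    rw [mul_assoc, Finset.mul_prod_erase _ (fun z : Fin n ↦ g (e' z) z) (a := b) (by
      simp [hab.symm]), Finset.mul_prod_erase _ (fun z : Fin n ↦ g (e' z) z) (Finset.mem_univ a)]
    rfl
  have hact (k : ℕ) (z : Fin n) : act (Simple.s i hi).toWeyl (g k z) = g k (Equiv.swap a b z) := by
    simp only [g, map_prod, map_sub, act_X, Simple.toWeyl, Equiv.swap_inv]
    refine Finset.prod_congr rfl fun j _ ↦ ?_
    simp [a, b, ← MvPolynomial.algebraMap_eq]
  have hrest : act (Simple.s i hi).toWeyl (∏ z ∈ (Finset.univ.erase a).erase b, g (e z) z) =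
      ∏ z ∈ (Finset.univ.erase a).erase b, g (e z) z := by
    rw [map_prod]
    refine Finset.prod_congr rfl fun z hz ↦ ?_
    rw [Finset.mem_erase, Finset.mem_erase] at hz
    rw [hact, Equiv.swap_apply_of_ne_of_ne hz.2.1 hz.1]
  have hupd : ∏ z ∈ (Finset.univ.erase a).erase b, g (Function.update e (i + 1) (e i) z) z =
      ∏ z ∈ (Finset.univ.erase a).erase b, g (e z) z := by
    refine Finset.prod_congr rfl fun z hz ↦ ?_
    rw [Finset.mem_erase, Finset.mem_erase] at hz
    rw [Function.update_of_ne]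
    intro h
    exact hz.1 (Fin.ext h)
  rw [split, split, hupd, map_mul, map_mul, hact, hact, hrest, Equiv.swap_apply_left,
    Equiv.swap_apply_right, he, hg, hg, Function.update_self, Function.update_of_ne (by omega)]
  simp only [Simple.root]
  change (X a - X b) * _ = _
  ring

theorem stairProd_congr {e e' : ℕ → ℕ} (h : ∀ k < n, e k = e' k) :
    stairProd n e = stairProd n e' := by
  refine Finset.prod_congr rfl fun i _ ↦ ?_
  rw [h i i.2]

theorem act_neg_one_pow {A : Type*} [CommRing A] (w : Hyperoctahedral n) (k : ℕ) :
    act w ((-1) ^ k : MvPolynomial (Fin n) A) = (-1) ^ k := by simp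

theorem wordDivDiff_neg_one_pow_mul (l : List (Simple n)) (k : ℕ) (f : Pol₂ n) :
    wordDivDiff l ((-1) ^ k * f) = (-1) ^ k * wordDivDiff l f :=
  wordDivDiff_mul l _ f fun s _ ↦ act_neg_one_pow s.toWeyl k

theorem wordDivDiff_neg_one_mul (l : List (Simple n)) (f : Pol₂ n) :
    wordDivDiff l (-1 * f) = -1 * wordDivDiff l f := by
  simpa using wordDivDiff_neg_one_pow_mul l 1 f

theorem wordDivDiff_nil {A : Type*} [CommRing A] (f : MvPolynomial (Fin n) A) :
    wordDivDiff [] f = f := rfl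

/-- The rows are shortened from the highest index downwards, so that whenever a letter is applied
its two rows still differ by exactly one. Truncated subtraction keeps the empty rows empty. -/
theorem wordDivDiff_downWord (r m : ℕ) (h : r + m < n) :
    wordDivDiff (downWord r m h)
      (stairProd n fun k ↦ if k ≤ r + m then k - r else k - (r + 1)) =
      (-1) ^ m * stairProd n fun k ↦ k - (r + 1) := by
  induction m with
  | zero =>
    rw [downWord, pow_zero, one_mul, wordDivDiff_nil]
    refine stairProd_congr fun k _ ↦ ?_
    split_ifs <;> omega
  | succ m ih =>
    change wordDivDiff (downWord r m _) ((Simple.s (r + m) h).divDiff _) = _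
    rw [divDiff_stairProd, ← neg_one_mul (stairProd n _), wordDivDiff_neg_one_mul, pow_succ', mul_assoc]
    · congr 1
      rw [← ih (by omega)]
      congr 1
      refine stairProd_congr fun k _ ↦ ?_
      rw [Function.update_apply]
      split_ifs <;> omega
    · split_ifs <;> omega
    · split_ifs <;> omega

/-- Each pass shortens every nonempty row by one, until all rows are empty; every letter contributes
a sign. -/
theorem wordDivDiff_aWord (m : ℕ) (h : m < n) :
    wordDivDiff (aWord n m h) (stairProd n fun k ↦ k - (n - 1 - m)) =
      (-1) ^ (m + 1).choose 2 := by
  induction m with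
  | zero =>
    rw [aWord, wordDivDiff_nil, stairProd]
    refine (Finset.prod_eq_one fun i _ ↦ ?_).trans (by simp)
    refine Finset.prod_eq_one fun j hj ↦ ?_
    rw [Finset.mem_filter] at hj
    omega
  | succ m ih =>
    rw [aWord, wordDivDiff_append]
    have h1 : stairProd n (fun k ↦ k - (n - 1 - (m + 1))) = stairProd n fun k ↦
        if k ≤ n - 1 - (m + 1) + (m + 1) then k - (n - 1 - (m + 1)) else
          k - (n - 1 - (m + 1) + 1) := stairProd_congr fun k _ ↦ by split_ifs <;> omega
    have h2 : n - 1 - (m + 1) + 1 = n - 1 - m := by omega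
    rw [h1, wordDivDiff_downWord, wordDivDiff_neg_one_pow_mul, h2, ih, ← pow_add,
      Nat.choose_succ_succ' (m + 1) 1, Nat.choose_one_right]

theorem wordDivDiff_kernelA (hn : 0 < n) :
    wordDivDiff (aWord n (n - 1) (by omega)) (kernelA n) = (-1) ^ n.choose 2 := by
  have := wordDivDiff_aWord (n := n) (n - 1) (by omega)
  rw [Nat.sub_self, Nat.sub_add_cancel hn] at this
  rw [kernelA_eq_stairProd, ← this]
  rfl

theorem forall_mem_aWord (m : ℕ) (h : m < n) : ∀ s ∈ aWord n m h, ∃ i hi, s = Simple.s i hi := by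
  have h1 (j m : ℕ) (h : j + m < n) : ∀ s ∈ downWord j m h, ∃ i hi, s = Simple.s i hi := by
    induction m with
    | zero => simp [downWord]
    | succ m ih =>
      intro s hs
      rw [downWord, List.mem_cons] at hs
      rcases hs with rfl | hs
      · exact ⟨_, _, rfl⟩
      · exact ih _ s hs
  induction m with
  | zero => simp [aWord]
  | succ m ih =>
    intro s hs
    rw [aWord, List.mem_append] at hs
    rcases hs with hs | hs
    · exact h1 _ _ _ s hs
    · exact ih _ s hs

end KernelA

/-! ### Invariants of the Weyl group -/

section Invariants

variable {n : ℕ} {A : Type*} [CommRing A]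

/-- The product of the signs of a signed permutation. -/
def signProd (w : Hyperoctahedral n) : ℤˣ := ∏ i, w.left i

theorem signProd_mul (v w : Hyperoctahedral n) : signProd (v * w) = signProd v * signProd w := by
  simp only [signProd, SemidirectProduct.mul_left, Pi.mul_apply, Finset.prod_mul_distrib]
  congr 1
  exact Equiv.prod_comp (v.right⁻¹ : Equiv.Perm (Fin n)) w.left

theorem mem_weylD_iff {w : Hyperoctahedral n} : w ∈ weylD n ↔ signProd w = 1 := Iff.rfl

/-- The change of one sign. -/
def flip (i : Fin n) : Hyperoctahedral n := ⟨Pi.mulSingle i (-1), 1⟩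

theorem signProd_flip (i : Fin n) : signProd (flip i) = -1 := by
  simp [signProd, flip]

theorem flip_mul_self (i : Fin n) : flip i * flip i = 1 := by
  refine SemidirectProduct.ext ?_ ?_
  · simp only [flip, SemidirectProduct.mul_left, SemidirectProduct.one_left]
    rw [map_one, MulAut.one_apply, ← Pi.mulSingle_mul]
    simp
  · simp [flip]

theorem act_inr (σ : Equiv.Perm (Fin n)) (f : MvPolynomial (Fin n) A) :
    act (SemidirectProduct.inr σ) f = rename (σ⁻¹ : Equiv.Perm (Fin n)) f := by
  have : (act (SemidirectProduct.inr σ) : MvPolynomial (Fin n) A →ₐ[A] _) =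
      rename (σ⁻¹ : Equiv.Perm (Fin n)) := MvPolynomial.algHom_ext fun i ↦ by simp [act_X]
  rw [this]

theorem coeff_act_flip (i : Fin n) (m : Fin n →₀ ℕ) (f : MvPolynomial (Fin n) A) :
    coeff m (act (flip i) f) = (-1) ^ m i * coeff m f := by
  induction f using MvPolynomial.induction_on' with
  | monomial d c =>
    have h1 : act (flip i) (monomial d c) = (-1) ^ d i * monomial d c := by
      rw [monomial_eq, Finsupp.prod_fintype _ _ (by simp), map_mul, map_prod]
      have h2 (j : Fin n) : act (flip i) (X j ^ d j : MvPolynomial (Fin n) A) =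
          (if j = i then (-1) ^ d i else 1) * X j ^ d j := by
        rw [map_pow, act_X]
        simp only [flip]
        split_ifs with h
        · subst h
          simp [← neg_pow]
        · simp [Pi.mulSingle_eq_of_ne h]
      have h3 : act (flip i) (C c : MvPolynomial (Fin n) A) = C c := (act (flip i)).commutes c
      rw [h3, Finset.prod_congr rfl fun j _ ↦ h2 j, Finset.prod_mul_distrib,
        Finset.prod_ite_eq' Finset.univ i, if_pos (Finset.mem_univ i), mul_left_comm]
    have h4 : ((-1) ^ d i : MvPolynomial (Fin n) A) = C ((-1) ^ d i) := by simp
    rw [h1, h4, coeff_C_mul, coeff_monomial]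
    split_ifs with h
    · rw [h]
    · simp
  | add f g hf hg => rw [map_add, coeff_add, hf, hg, coeff_add, mul_add]

theorem monomial_eq_prod (m : Fin n →₀ ℕ) (c : A) :
    monomial m c = C c * ∏ i, (X i : MvPolynomial (Fin n) A) ^ m i := by
  rw [monomial_eq, Finsupp.prod_fintype _ _ (by simp)]

theorem exists_expand_of_even {f : MvPolynomial (Fin n) A}
    (h : ∀ m ∈ f.support, ∀ i, Even (m i)) : ∃ a, f = expand 2 a := by
  refine ⟨∑ m ∈ f.support, monomial (m.mapRange (· / 2) (by simp)) (coeff m f), ?_⟩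
  conv_lhs => rw [← support_sum_monomial_coeff f]
  rw [map_sum]
  refine Finset.sum_congr rfl fun m hm ↦ ?_
  rw [monomial_eq_prod, monomial_eq_prod, map_mul, map_prod, expand_C]
  congr 1
  refine Finset.prod_congr rfl fun i _ ↦ ?_
  obtain ⟨k, hk⟩ := h m hm i
  rw [map_pow, expand_X, Finsupp.mapRange_apply, ← pow_mul]
  congr 1
  omega

theorem exists_expand_of_odd {f : MvPolynomial (Fin n) A}
    (h : ∀ m ∈ f.support, ∀ i, Odd (m i)) : ∃ a, f = (∏ i, X i) * expand 2 a := by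
  refine ⟨∑ m ∈ f.support, monomial (m.mapRange (· / 2) (by simp)) (coeff m f), ?_⟩
  conv_lhs => rw [← support_sum_monomial_coeff f]
  rw [map_sum, Finset.mul_sum]
  refine Finset.sum_congr rfl fun m hm ↦ ?_
  rw [monomial_eq_prod, monomial_eq_prod, map_mul, map_prod, expand_C, mul_left_comm,
    ← Finset.prod_mul_distrib]
  congr 1
  refine Finset.prod_congr rfl fun i _ ↦ ?_
  obtain ⟨k, hk⟩ := h m hm i
  rw [map_pow, expand_X, Finsupp.mapRange_apply, ← pow_mul, ← pow_succ']
  congr 1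
  omega

theorem isSymmetric_of_expand {a : MvPolynomial (Fin n) A} (h : (expand 2 a).IsSymmetric) :
    a.IsSymmetric := fun e ↦ by
  apply expand_injective two_pos
  rw [← rename_expand, h e]

theorem isSymmetric_prod_X : (∏ i, X i : MvPolynomial (Fin n) A).IsSymmetric := fun e ↦ by
  rw [map_prod]
  simp only [rename_X]
  exact Equiv.prod_comp e _

variable [IsDomain A]

/-- With `ε` a single sign change, `2f = (f + f^ε) + (f - f^ε)`. Any element with an odd number of
sign changes acts on `f` as `ε` does, so the first summand is even in every variable and the second
is odd in every variable. -/
theorem exists_expand_add_of_invariant (hn : 0 < n) (h2 : (2 : A) ≠ 0) {f : MvPolynomial (Fin n) A}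
    (hf : ∀ w ∈ weylD n, act w f = f) : ∃ a b : MvPolynomial (Fin n) A,
    a.IsSymmetric ∧ b.IsSymmetric ∧ 2 * f = expand 2 a + (∏ i, X i) * expand 2 b := by
  set ε : Hyperoctahedral n := flip ⟨0, hn⟩
  have hε : signProd ε = -1 := signProd_flip _
  have hεε : ε * ε = 1 := flip_mul_self _
  have h1 (g : Hyperoctahedral n) (hg : signProd g = -1) : act g f = act ε f := by
    rw [← mul_one g, ← hεε, ← mul_assoc, act_mul, hf]
    rw [mem_weylD_iff, signProd_mul, hg, hε]
    simp
  have h3 (g : Hyperoctahedral n) (hg : signProd g = -1) : act g (act ε f) = f := by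
    rw [← act_mul, hf]
    rw [mem_weylD_iff, signProd_mul, hg, hε]
    simp
  have h4 (g : Hyperoctahedral n) (hg : signProd g = 1) : act g (act ε f) = act ε f := by
    rw [← act_mul, h1]
    rw [signProd_mul, hg, hε]
    simp
  have hinr (σ : Equiv.Perm (Fin n)) : signProd (SemidirectProduct.inr σ) = 1 := by
    simp [signProd]
  have hsymm (e : Equiv.Perm (Fin n)) (g : MvPolynomial (Fin n) A) :
      rename e g = act (SemidirectProduct.inr e⁻¹) g := by rw [act_inr, inv_inv]
  have hcancel (c : A) (h : c = -c) : c = 0 := by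
    have : 2 * c = 0 := by linear_combination h
    exact (mul_eq_zero.1 this).resolve_left h2
  obtain ⟨a, ha⟩ := exists_expand_of_even (f := f + act ε f) fun m hm i ↦ by
    by_contra hi
    rw [Nat.not_even_iff_odd] at hi
    have := coeff_act_flip i m (f + act ε f)
    rw [map_add, h1 _ (signProd_flip i), h3 _ (signProd_flip i), add_comm, hi.neg_one_pow,
      neg_one_mul] at this
    exact mem_support_iff.1 hm (hcancel _ this)
  obtain ⟨b, hb⟩ := exists_expand_of_odd (f := f - act ε f) fun m hm i ↦ by
    by_contra hi
    rw [Nat.not_odd_iff_even] at hi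
    have := coeff_act_flip i m (f - act ε f)
    rw [map_sub, h1 _ (signProd_flip i), h3 _ (signProd_flip i), ← neg_sub, coeff_neg,
      hi.neg_one_pow, one_mul] at this
    exact mem_support_iff.1 hm (hcancel _ this.symm)
  refine ⟨a, b, isSymmetric_of_expand fun e ↦ ?_, isSymmetric_of_expand fun e ↦ ?_, ?_⟩
  · rw [← ha, hsymm, map_add, hf _ (hinr _), h4 _ (hinr _)]
  · have h5 : (∏ i, X i : MvPolynomial (Fin n) A) ≠ 0 :=
      Finset.prod_ne_zero_iff.2 fun i _ ↦ X_ne_zero i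
    apply mul_left_cancel₀ h5
    conv_lhs => rw [← isSymmetric_prod_X e]
    rw [← map_mul, ← hb, hsymm, map_sub, hf _ (hinr _), h4 _ (hinr _)]
  · rw [← ha, ← hb]
    ring

/-- The algebra of invariants is generated by the elementary symmetric polynomials of the squares
of the variables and by the product of the variables. -/
theorem algHom_sub_mem_of_invariant (hn : 0 < n) (I : Ideal A) {c : A} (hc : 2 * c = 1)
    (ψ₁ ψ₂ : MvPolynomial (Fin n) A →ₐ[A] A)
    (hs : ∀ k, ψ₁ (expand 2 (esymm (Fin n) A k)) - ψ₂ (expand 2 (esymm (Fin n) A k)) ∈ I)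
    (hp : ψ₁ (∏ i, X i) - ψ₂ (∏ i, X i) ∈ I) {f : MvPolynomial (Fin n) A}
    (hf : ∀ w ∈ weylD n, act w f = f) : ψ₁ f - ψ₂ f ∈ I := by
  have h2 : (2 : A) ≠ 0 := fun h ↦ by simp [h] at hc
  obtain ⟨a, b, ha, hb, hab⟩ := exists_expand_add_of_invariant hn h2 hf
  let π := Ideal.Quotient.mkₐ A I
  have hπ {x y : A} : x - y ∈ I ↔ π x = π y := (Ideal.Quotient.mk_eq_mk_iff_sub_mem x y).symm
  simp only [hπ] at hs hp ⊢
  have h1 {a : MvPolynomial (Fin n) A} (ha : a.IsSymmetric) :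
      π (ψ₁ (expand 2 a)) = π (ψ₂ (expand 2 a)) := by
    -- By the fundamental theorem on symmetric polynomials it is enough to compare the elementary
    -- ones.
    obtain ⟨q, hq⟩ := esymmAlgHom_surjective (σ := Fin n) (n := n) A (by simp) ⟨a, ha⟩
    have hq := congrArg Subtype.val hq
    rw [esymmAlgHom_apply] at hq
    simp only at hq
    rw [← hq]
    have : ((π.comp ψ₁).comp (expand 2)).comp (aeval fun i : Fin n ↦ esymm (Fin n) A (i + 1)) =
        ((π.comp ψ₂).comp (expand 2)).comp (aeval fun i : Fin n ↦ esymm (Fin n) A (i + 1)) :=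
      MvPolynomial.algHom_ext fun i ↦ by simpa using hs (i + 1)
    exact congrArg (fun g ↦ g q) this
  have h3 : π (ψ₁ (2 * f)) = π (ψ₂ (2 * f)) := by
    rw [hab, map_add ψ₁, map_add ψ₂, map_add, map_add, map_mul ψ₁, map_mul ψ₂, map_mul, map_mul,
      h1 ha, h1 hb, hp]
  have h4 (ψ : MvPolynomial (Fin n) A →ₐ[A] A) : ψ f = c * ψ (2 * f) := by
    rw [map_mul, map_ofNat, ← mul_assoc, mul_comm c, hc, one_mul]
  rw [h4 ψ₁, h4 ψ₂, map_mul π, map_mul π, h3]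

end Invariants

/-! ### The ideal of relations -/

section RelIdeal

variable {n : ℕ}

/-- Both the antisymmetrization and `disc` change by the sign of the underlying permutation, so
their quotient is invariant. -/
theorem act_eq_self_of_disc_mul {A : Type*} [CommRing A] [IsDomain A]
    {f g : MvPolynomial (Fin n) A} (h : disc n A * g =
      ∑ u : weylD n, ((Equiv.Perm.sign u.1.right : ℤ) : MvPolynomial (Fin n) A) * act u.1 f)
    (v : weylD n) : act v.1 g = g := by
  have h1 := congrArg (act v.1) h
  rw [map_mul, act_disc, map_sum, ← Equiv.sum_comp (Equiv.mulRight v⁻¹)] at h1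
  have h2 : ((Equiv.Perm.sign v.1.right : ℤ) : MvPolynomial (Fin n) A) *
      (Equiv.Perm.sign v.1.right : ℤ) = 1 := by
    rw [← Int.cast_mul, ← Units.val_mul, Int.units_mul_self]
    simp
  have h3 : disc n A * act v.1 g = disc n A * g := by
    rw [h, ← one_mul (disc n A * _), ← h2, mul_assoc, ← mul_assoc _ (disc n A), h1, Finset.mul_sum]
    refine Finset.sum_congr rfl fun u _ ↦ ?_
    rw [Equiv.coe_mulRight, map_mul, map_intCast, ← act_mul, ← mul_assoc]
    congr 1
    · simp only [Subgroup.coe_mul, SemidirectProduct.mul_right, InvMemClass.coe_inv,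
        SemidirectProduct.inv_right, map_mul, Equiv.Perm.sign_inv, Units.val_mul, Int.cast_mul]
      linear_combination ((Equiv.Perm.sign u.1.right : ℤ) : MvPolynomial (Fin n) A) * h2
    · rw [← Subgroup.coe_mul, inv_mul_cancel_right]
  exact mul_left_cancel₀ (disc_ne_zero A) h3

theorem inX_eq (f : Pol n) : inX f = (map C f : Pol₂ n) := rfl

theorem aeval_map_C (G : Pol₂ n) :
    aeval (fun i ↦ map C (X i : Pol n)) (map C G : MvPolynomial (Fin n) (Pol₂ n)) = G := by
  have : ((aeval fun i ↦ map C (X i : Pol n) : MvPolynomial (Fin n) (Pol₂ n) →ₐ[Pol₂ n] Pol₂ n) :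
      MvPolynomial (Fin n) (Pol₂ n) →+* Pol₂ n).comp (map C) = RingHom.id _ := by
    refine MvPolynomial.ringHom_ext (fun r ↦ ?_) fun i ↦ ?_ <;> simp
  exact congrArg (fun g ↦ g G) this

theorem aeval_act_map {S : Type*} [CommRing S] (θ : Pol n →+* S) (w : Hyperoctahedral n)
    (G : Pol₂ n) : aeval (fun i ↦ θ (X i)) (act w (map θ G)) = θ (specialize w G) := by
  have : (((aeval fun i ↦ θ (X i) : MvPolynomial (Fin n) S →ₐ[S] S).comp (act w) :
      MvPolynomial (Fin n) S →ₐ[S] S) : MvPolynomial (Fin n) S →+* S).comp (map θ) =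
      θ.comp (specializeHom w) := by
    refine MvPolynomial.ringHom_ext (fun r ↦ ?_) fun i ↦ ?_
    · rw [RingHom.comp_apply, map_C]
      simp only [RingHom.coe_coe, AlgHom.comp_apply]
      rw [show act w (C (θ r) : MvPolynomial (Fin n) S) = C (θ r) from (act w).commutes _]
      simp [specializeHom]
    · simp [specializeHom, act_X]
  exact congrArg (fun g ↦ g G) this

theorem aeval_expand_esymm {S : Type*} [CommRing S] (θ : Pol n →+* S) (k : ℕ) :
    aeval (fun i ↦ θ (X i)) (expand 2 (esymm (Fin n) S k)) =
      θ (expand 2 (esymm (Fin n) ZHalf k)) := by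
  simp only [esymm, map_sum, map_prod, aeval_X, expand_X, map_pow]

theorem aeval_prod_X {S : Type*} [CommRing S] (θ : Pol n →+* S) :
    aeval (fun i ↦ θ (X i)) (∏ i, X i : MvPolynomial (Fin n) S) = θ (∏ i, X i) := by
  simp only [map_prod, aeval_X]

theorem two_mul_C_half : (2 : Pol₂ n) * C (C half) = 1 := by
  have := congrArg (fun c ↦ (C (C c) : Pol₂ n)) two_mul_half
  simpa only [C_mul, C_1, map_ofNat] using this

/-- If there is a kernel, then the ideal of relations consists of the polynomials all of whose
specializations vanish. -/
theorem mem_relIdeal_of_specialize (hn : 0 < n) {K : Pol₂ n}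
    (hK : ∀ w ∈ weylD n, w ≠ 1 → specialize w K = 0)
    (hK1 : specialize 1 K = disc n ZHalf) (hdeg : (scale₂ n K).natDegree ≤ n * (n - 1))
    {H : Pol₂ n} (hH : ∀ w ∈ weylD n, specialize w H = 0) : H ∈ relIdeal n := by
  set φ : Pol n →+* Pol₂ n := map C
  -- The outer variables form a third set `Z`; this is `H(Z, Y) K(Z, X)`.
  set f : MvPolynomial (Fin n) (Pol₂ n) := map C H * map φ K
  set R := wordDivDiff (longWord n hn) f
  have h1 : disc n (Pol₂ n) * R = _ := disc_mul_wordDivDiff hK hK1 hdeg (longWord n hn)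
    (length_longWord hn) (prod_longWord hn) ((C : Pol n →+* Pol₂ n).comp C) f
  have hinv (w : Hyperoctahedral n) (hw : w ∈ weylD n) : act w R = R :=
    act_eq_self_of_disc_mul h1 ⟨w, hw⟩
  let evX : MvPolynomial (Fin n) (Pol₂ n) →ₐ[Pol₂ n] Pol₂ n := aeval fun i ↦ φ (X i)
  let evY : MvPolynomial (Fin n) (Pol₂ n) →ₐ[Pol₂ n] Pol₂ n := aeval fun i ↦ C (X i)
  have hX1 : evX (map C H) = H := aeval_map_C H
  have hX2 (w : Hyperoctahedral n) (G : Pol₂ n) :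
      evX (act w (map φ G)) = φ (specialize w G) := aeval_act_map φ w G
  have hY (w : Hyperoctahedral n) (G : Pol₂ n) :
      evY (act w (map C G)) = C (specialize w G) := aeval_act_map C w G
  have hdX : evX (disc n (Pol₂ n)) = φ (disc n ZHalf) := by
    simp [disc_eq_prod, evX, φ]
  have hdY : evY (disc n (Pol₂ n)) = C (disc n ZHalf) := by
    simp [disc_eq_prod, evY]
  -- At `Z = X` the kernel kills every term except the one of the identity.
  have hRX : evX R = H := by
    have h2 := congrArg evX h1
    rw [map_mul, map_sum, Finset.sum_eq_single 1, hdX] at h2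
    · rw [map_mul evX, OneMemClass.coe_one, map_mul (act 1), map_mul evX, hX2, hK1, act_one, hX1,
        SemidirectProduct.one_right, Equiv.Perm.sign_one, Units.val_one, Int.cast_one, map_one,
        one_mul, mul_comm H] at h2
      have h3 : φ (disc n ZHalf) ≠ 0 := by
        rw [Ne, map_eq_zero_iff _ (map_injective _ (C_injective _ _))]
        exact disc_ne_zero ZHalf
      exact mul_left_cancel₀ h3 h2
    · intro w _ hw
      rw [map_mul evX, map_mul (act w.1), map_mul evX, hX2, hK _ w.2 fun h ↦ hw (Subtype.ext h)]
      simp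
    · simp
  -- At `Z = Y` each term contains a specialization of `H`, which vanishes by hypothesis.
  have hRY : evY R = 0 := by
    have h2 := congrArg evY h1
    rw [map_mul, map_sum, Finset.sum_eq_zero, hdY, mul_eq_zero, C_eq_zero] at h2
    · exact h2.resolve_left (disc_ne_zero ZHalf)
    · intro w _
      rw [map_mul evY, map_mul (act w.1), map_mul evY, hY, hH _ w.2]
      simp
  have key := algHom_sub_mem_of_invariant hn (relIdeal n) two_mul_C_half evX evY ?_ ?_ hinv
  · rwa [hRX, hRY, sub_zero] at key
  · intro k
    rw [show evX _ = _ from aeval_expand_esymm φ k, show evY _ = _ from aeval_expand_esymm C k]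
    exact Ideal.subset_span (Or.inl ⟨esymm (Fin n) ZHalf k, esymm_isSymmetric _ _ _, rfl⟩)
  · rw [show evX _ = _ from aeval_prod_X φ, show evY _ = _ from aeval_prod_X C]
    exact Ideal.subset_span (Or.inr rfl)

end RelIdeal

/-! ### Polynomials determined by their vanishing -/

section Value

variable {n : ℕ}

variable (n) in
/-- The product of the sums of two distinct variables. -/
def sumProd : Pol n := ∏ p : Fin n × Fin n with p.1 < p.2, (X p.1 + X p.2)

theorem X_add_X_ne_zero {i j : Fin n} : (X i + X j : Pol n) ≠ 0 := fun h ↦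
  X_ne_neg_X (eq_neg_of_add_eq_zero_left h)

theorem sumProd_ne_zero : sumProd n ≠ 0 :=
  Finset.prod_ne_zero_iff.2 fun _ _ ↦ X_add_X_ne_zero

/-- The substitution of `-x_a` for `x_b`. -/
def subst (a b : Fin n) : Pol n →ₐ[ZHalf] Pol n := aeval fun k ↦ if k = b then -X a else X k

theorem subst_X (a b k : Fin n) : subst a b (X k) = if k = b then -X a else X k := by
  simp [subst]

/-- The substitution for one pair kills its own factor and none of the others, so the factors can be
split off one after another. -/
theorem sumProd_dvd {f : Pol n} (hf : ∀ a b, a < b → subst a b f = 0) : sumProd n ∣ f := by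
  suffices h : ∀ S : Finset (Fin n × Fin n), (∀ p ∈ S, p.1 < p.2) →
      (∏ p ∈ S, (X p.1 + X p.2 : Pol n)) ∣ f from h _ (by simp)
  intro S hS
  induction S using Finset.induction_on with
  | empty => simp
  | insert p S hp ih =>
    obtain ⟨g, hg⟩ := ih fun q hq ↦ hS q (Finset.mem_insert_of_mem hq)
    have hpl := hS p (Finset.mem_insert_self _ _)
    have h0 := hf _ _ hpl
    have h1 : subst p.1 p.2 (∏ q ∈ S, (X q.1 + X q.2 : Pol n)) ≠ 0 := by
      rw [map_prod, Finset.prod_ne_zero_iff]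
      intro q hq h
      have hql := hS q (Finset.mem_insert_of_mem hq)
      have hqp : q ≠ p := fun h ↦ hp (h ▸ hq)
      rw [map_add, subst_X, subst_X] at h
      split_ifs at h with a b b
      · exact hql.ne (a.trans b.symm)
      · have := X_injective (neg_add_eq_zero.1 h)
        rw [a, ← this] at hql
        exact lt_asymm hql hpl
      · exact hqp (Prod.ext (X_injective (add_neg_eq_zero.1 h)) b)
      · exact X_add_X_ne_zero h
    rw [hg, map_mul, mul_eq_zero, or_iff_right h1] at h0
    have h2 : (X p.1 + X p.2 : Pol n) ∣ g - subst p.1 p.2 g := by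
      refine dvd_sub_of_dvd_X _ (fun k ↦ ?_) g
      rw [subst_X]
      split_ifs with hk
      · subst hk; exact ⟨1, by ring⟩
      · simp
    have h2 : (X p.1 + X p.2 : Pol n) ∣ g := by simpa [h0] using h2
    obtain ⟨c, rfl⟩ := h2
    rw [Finset.prod_insert hp, hg]
    exact ⟨c, by ring⟩

theorem card_filter_lt : (Finset.univ.filter fun p : Fin n × Fin n ↦ p.1 < p.2).card =
    n.choose 2 := by
  have h := Finset.card_filter (fun p : Fin n × Fin n ↦ p.1 < p.2) Finset.univ
  rw [h, Fintype.sum_prod_type_right]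
  have h2 (j : Fin n) : ∑ i : Fin n, (if i < j then 1 else 0) = (j : ℕ) := by
    rw [← Finset.card_filter]
    have : (Finset.univ.filter fun i : Fin n ↦ i < j) = Finset.Iio j := by ext; simp
    rw [this, Fin.card_Iio]
  simp only [h2]
  rw [Fin.sum_univ_eq_sum_range (fun i ↦ i), Finset.sum_range_id, Nat.choose_two_right]

theorem scale_sumProd : scale n (sumProd n) =
    Polynomial.X ^ n.choose 2 * Polynomial.C (sumProd n) := by
  rw [sumProd, map_prod, map_prod]
  simp only [map_add, scale_X, ← mul_add]
  rw [Finset.prod_mul_distrib, Finset.prod_const, card_filter_lt]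

theorem eq_C_mul_sumProd {f : Pol n} (hf : ∀ a b, a < b → subst a b f = 0)
    (hd : (scale n f).natDegree ≤ n.choose 2) : ∃ c, f = C c * sumProd n := by
  obtain ⟨g, hg⟩ := sumProd_dvd hf
  have hinj : Function.Injective (scale n) := fun f g h ↦ by
    rw [← scale_eval_one f, h, scale_eval_one]
  by_cases h0 : g = 0
  · exact ⟨0, by simp [hg, h0]⟩
  have h1 : (scale n g).natDegree = 0 := by
    rw [hg, map_mul, Polynomial.natDegree_mul ((map_ne_zero_iff _ hinj).2 sumProd_ne_zero)
      ((map_ne_zero_iff _ hinj).2 h0), scale_sumProd, Polynomial.natDegree_X_pow_mul _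
      (Polynomial.C_ne_zero.2 sumProd_ne_zero), Polynomial.natDegree_C] at hd
    omega
  obtain ⟨c, rfl⟩ := eq_C_of_natDegree_scale h1
  exact ⟨c, by rw [hg, mul_comm]⟩

variable (n) in
/-- The substitution of `0` for the last variable. -/
def dropLast : Pol (n + 1) →ₐ[ZHalf] Pol n := aeval (Fin.snoc X 0)

theorem dropLast_sumProd : dropLast n (sumProd (n + 1)) = (∏ i, X i) * sumProd n := by
  have h1 (n : ℕ) : sumProd n = ∏ j : Fin n, ∏ i : Fin n with i < j, (X i + X j) := by
    rw [sumProd, Finset.prod_filter, Fintype.prod_prod_type_right]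
    refine Finset.prod_congr rfl fun i _ ↦ ?_
    rw [Finset.prod_filter]
  have h2 : (Finset.univ.filter fun i ↦ i < Fin.last n) =
      Finset.univ.map Fin.castSuccEmb := by
    ext i
    simp only [Finset.mem_filter, Finset.mem_univ, true_and, Finset.mem_map, Fin.coe_castSuccEmb]
    exact ⟨fun h ↦ ⟨i.castLT h, rfl⟩, by rintro ⟨j, rfl⟩; exact Fin.castSucc_lt_last j⟩
  have h3 (j : Fin n) : (Finset.univ.filter fun i ↦ i < j.castSucc) =
      (Finset.univ.filter fun i ↦ i < j).map Fin.castSuccEmb := by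
    ext i
    simp only [Finset.mem_filter, Finset.mem_univ, true_and, Finset.mem_map, Fin.coe_castSuccEmb]
    constructor
    · intro h
      exact ⟨i.castLT (h.trans (Fin.castSucc_lt_last j)), h, rfl⟩
    · rintro ⟨k, hk, rfl⟩
      exact hk
  rw [h1, h1, Fin.prod_univ_castSucc, map_mul, mul_comm, h2, Finset.prod_map, map_prod, map_prod]
  congr 1
  · simp [dropLast]
  · refine Finset.prod_congr rfl fun j _ ↦ ?_
    rw [h3, Finset.prod_map, map_prod]
    simp [dropLast]

theorem esymm_self : esymm (Fin n) ZHalf n = ∏ i, X i := by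
  have := Finset.powersetCard_self (Finset.univ : Finset (Fin n))
  rw [Finset.card_univ, Fintype.card_fin] at this
  rw [esymm, this, Finset.sum_singleton]

/-- A family of polynomials that vanish when the sum of two variables vanishes and that are
compatible with the vanishing of the last variable. -/
theorem eq_sumProd {G : ∀ n, Pol n} (h1 : G 1 = 1)
    (hG : ∀ n, 0 < n → dropLast n (G (n + 1)) = esymm (Fin n) ZHalf n * G n)
    (hv : ∀ n (a b : Fin n), a < b → subst a b (G n) = 0)
    (hd : ∀ n, (scale n (G n)).natDegree ≤ n.choose 2) (hn : 0 < n) : G n = sumProd n := by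
  induction n, hn using Nat.le_induction with
  | base =>
    rw [h1, sumProd, Finset.prod_eq_one]
    intro p hp
    rw [Finset.mem_filter] at hp
    omega
  | succ n hn ih =>
    -- Vanishing and degree leave a scalar, which is found by setting the last variable to zero.
    obtain ⟨c, hc⟩ := eq_C_mul_sumProd (hv (n + 1)) (hd (n + 1))
    have h2 := hG n hn
    have h3 : dropLast n (C c) = C c := (dropLast n).commutes c
    rw [hc, map_mul, dropLast_sumProd, h3, ih, esymm_self] at h2
    have h4 : (∏ i, X i : Pol n) * sumProd n ≠ 0 :=
      mul_ne_zero (Finset.prod_ne_zero_iff.2 fun i _ ↦ X_ne_zero i) sumProd_ne_zero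
    have h5 : (C c : Pol n) = 1 := mul_right_cancel₀ h4 (by rw [h2, one_mul])
    rw [← C_1] at h5
    rw [hc, C_injective _ _ h5, C_1, one_mul]

/-! ### Vanishing on the hyperplanes `x_a + x_b = 0` and the staircase Schur polynomial -/

/-- The signed permutation exchanging two coordinates and changing both signs. -/
def negSwap (a b : Fin n) : Hyperoctahedral n :=
  ⟨Pi.mulSingle a (-1) * Pi.mulSingle b (-1), Equiv.swap a b⟩

theorem negSwap_mem (a b : Fin n) : negSwap a b ∈ weylD n := by
  change ∏ i, (negSwap a b).left i = 1
  simp [negSwap, Finset.prod_mul_distrib]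

theorem mem_weylA_iff {w : Hyperoctahedral n} : w ∈ weylA n ↔ w.left = 1 := by
  constructor
  · rintro ⟨σ, rfl⟩
    rfl
  · intro h
    exact ⟨w.right, SemidirectProduct.ext h.symm rfl⟩

theorem negSwap_notMem {a b : Fin n} (h : a ≠ b) : negSwap a b ∉ weylA n := by
  rw [mem_weylA_iff]
  intro h1
  have := congrFun h1 a
  simp [negSwap, Pi.mulSingle_eq_of_ne h] at this

/-- Once `x_b = -x_a`, the variables and their images under `negSwap a b` coincide, so the value at
the identity inherits the vanishing outside the symmetric group. -/
theorem subst_specialize_one {K : Pol₂ n} (hK : ∀ w ∈ weylD n, w ∉ weylA n → specialize w K = 0)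
    {a b : Fin n} (h : a < b) : subst a b (specialize 1 K) = 0 := by
  have h1 : ((subst a b : Pol n →+* Pol n).comp ((specializeHom (1 : Hyperoctahedral n) : Pol₂ n →ₐ[Pol n] Pol n) :
        Pol₂ n →+* Pol n)) = (subst a b : Pol n →+* Pol n).comp
        ((specializeHom (negSwap a b) : Pol₂ n →ₐ[Pol n] Pol n) : Pol₂ n →+* Pol n) := by
    refine MvPolynomial.ringHom_ext (fun r ↦ by simp [specializeHom]) fun i ↦ ?_
    simp only [RingHom.comp_apply, RingHom.coe_coe, ← specialize_eq, specialize_X, act_one]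
    rw [act_X, map_mul, map_intCast, subst_X, subst_X]
    simp only [negSwap, Equiv.swap_inv, Pi.mul_apply]
    by_cases ha : i = a
    · subst ha
      simp [h.ne]
    · by_cases hb : i = b
      · subst hb
        simp [h.ne]
      · simp [Equiv.swap_apply_of_ne_of_ne ha hb, hb, Pi.mulSingle_eq_of_ne ha]
  have h2 := congrArg (fun g ↦ g K) h1
  simp only [RingHom.comp_apply, RingHom.coe_coe, ← specialize_eq] at h2
  rw [h2, hK _ (negSwap_mem a b) (negSwap_notMem h.ne), map_zero]

theorem natDegree_scale_specialize (w : Hyperoctahedral n) (K : Pol₂ n) :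
    (scale n (specialize w K)).natDegree ≤ (scale₂ n K).natDegree := by
  rw [scale₂_specialize]
  exact Polynomial.natDegree_map_le

/-- The Schur polynomial of the staircase. -/
theorem schur_rho : schur (rho n) = sumProd n := by
  have h1 (φ : Pol n →ₐ[ZHalf] Pol n) : φ (alternant (rho n)) =
      ∏ p : Fin n × Fin n with p.1 < p.2, (φ (X p.1) - φ (X p.2)) := by
    have h1 : alternant (rho n) =
        (Matrix.projVandermonde (fun _ ↦ 1) (fun i ↦ (X i : Pol n))).det := by
      rw [alternant]
      congr 1
      refine Matrix.ext fun i j ↦ ?_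
      simp only [Matrix.of_apply, Matrix.projVandermonde_apply, one_pow, one_mul, rho]
      congr 1
      have := Fin.val_rev j
      omega
    rw [h1, Matrix.det_projVandermonde, map_prod, Finset.prod_filter, Fintype.prod_prod_type]
    refine Finset.prod_congr rfl fun i _ ↦ ?_
    rw [← Finset.prod_filter, map_prod]
    refine Finset.prod_congr (by ext; simp) fun j _ ↦ ?_
    simp
  -- Doubling the exponents amounts to squaring the variables, so the quotient of alternants is a
  -- product of factors `(x_i² - x_j²)/(x_i - x_j)`.
  have h2 : alternant (fun j ↦ rho n j + rho n j) = expand 2 (alternant (rho n)) := by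
    rw [alternant, alternant, AlgHom.map_det]
    congr 1
    refine Matrix.ext fun i j ↦ ?_
    simp [← pow_mul, two_mul]
  have h3 : alternant (rho n) = ∏ p : Fin n × Fin n with p.1 < p.2, (X p.1 - X p.2) := by
    simpa using h1 (AlgHom.id _ _)
  have h4 : alternant (rho n) ≠ 0 := by
    rw [h3, Finset.prod_ne_zero_iff]
    intro p hp h
    rw [Finset.mem_filter] at hp
    exact hp.2.ne (X_injective (sub_eq_zero.1 h))
  apply mul_right_cancel₀ h4
  rw [schur, (exists_schur (rho n)).choose_spec, h2, h1, h3, sumProd, ← Finset.prod_mul_distrib]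
  refine Finset.prod_congr rfl fun p _ ↦ ?_
  rw [expand_X, expand_X]
  ring

end Value

/-! ### The determinant -/

/-! ### A vanishing criterion for determinants of power series coefficients -/

section PowerSeries

variable {R : Type*} [CommRing R]

theorem coeff_prod_one_add {ι : Type*} (s : Finset ι) (a : ι → R) (k : ℕ) :
    PowerSeries.coeff k (∏ i ∈ s, (1 + PowerSeries.C (a i) * PowerSeries.X)) =
      ∑ t ∈ s.powersetCard k, ∏ i ∈ t, a i := by
  classical
  rw [Finset.prod_one_add, map_sum, Finset.powersetCard_eq_filter, Finset.sum_filter]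
  refine Finset.sum_congr rfl fun t _ ↦ ?_
  rw [Finset.prod_mul_distrib, Finset.prod_const, ← map_prod, PowerSeries.coeff_C_mul,
    PowerSeries.coeff_X_pow]
  simp [eq_comm]

theorem rescale_C (c a : R) : PowerSeries.rescale c (PowerSeries.C a) = PowerSeries.C a := by
  refine PowerSeries.ext fun k ↦ ?_
  rw [PowerSeries.coeff_rescale, PowerSeries.coeff_C]
  split_ifs with h
  · rw [h, pow_zero, one_mul]
  · rw [mul_zero]

/-- The coefficients of a power series, extended by zero to negative indices. -/
def intCoeff (f : PowerSeries R) (k : ℤ) : R :=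
  if 0 ≤ k then PowerSeries.coeff k.toNat f else 0

theorem intCoeff_natCast (f : PowerSeries R) (k : ℕ) :
    intCoeff f k = PowerSeries.coeff k f := by
  simp [intCoeff]

theorem intCoeff_of_neg (f : PowerSeries R) {k : ℤ} (hk : k < 0) : intCoeff f k = 0 :=
  if_neg (not_le.2 hk)

theorem coeff_of_even {f : PowerSeries R} [IsDomain R] (h2 : (2 : R) ≠ 0)
    (hf : PowerSeries.evalNegHom f = f) {k : ℕ} (hk : Odd k) : PowerSeries.coeff k f = 0 := by
  have h := congrArg (PowerSeries.coeff k) hf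
  rw [PowerSeries.evalNegHom, PowerSeries.coeff_rescale, hk.neg_one_pow] at h
  have h3 : 2 * PowerSeries.coeff k f = 0 := by linear_combination -h
  exact (mul_eq_zero.1 h3).resolve_left h2

theorem sum_range_even {M : Type*} [AddCommMonoid M] (g : ℕ → M) (m N : ℕ)
    (hg : ∀ k, Odd k → g k = 0) (h1 : N < 2 * m) (h2 : ∀ k, N < k → g k = 0) :
    ∑ k ∈ Finset.range (N + 1), g k = ∑ i ∈ Finset.range m, g (2 * i) := by
  have h3 : ∑ k ∈ Finset.range (N + 1), g k = ∑ k ∈ Finset.range (2 * m), g k := by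
    refine Finset.sum_subset (Finset.range_mono (by omega)) fun k _ hk ↦ h2 k ?_
    simpa using hk
  rw [h3]
  clear h1 h3 h2
  induction m with
  | zero => simp
  | succ m ih =>
    rw [Nat.mul_succ, Finset.sum_range_succ, Finset.sum_range_succ, Finset.sum_range_succ, ih,
      hg (2 * m + 1) (odd_two_mul_add_one m), add_zero]

/-- Multiplying `Z G` by the even series `1/G` gives `Z`, whose coefficients vanish from `m` on.
Since each row shifts the index by two, this reads as a linear relation between the rows. -/
theorem det_intCoeff_eq_zero [IsDomain R] (h2 : (2 : R) ≠ 0) (m : ℕ) (hm : 0 < m)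
    (Z G : PowerSeries R) (hG : PowerSeries.evalNegHom G = G)
    (hG0 : PowerSeries.constantCoeff G = 1) (hZ : ∀ k, m ≤ k → PowerSeries.coeff k Z = 0) :
    Matrix.det (Matrix.of fun i j : Fin m ↦
      intCoeff (Z * G) (((m + 1 : ℕ) : ℤ) + ((j : ℤ) + 1) - 2 * ((i : ℤ) + 1))) = 0 := by
  set V := PowerSeries.invOfUnit G 1 with hV
  have hGV : G * V = 1 := PowerSeries.mul_invOfUnit G 1 (by simpa using hG0)
  have hVe : PowerSeries.evalNegHom V = V := by
    have h1 : G * PowerSeries.evalNegHom V = 1 := by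
      have := congrArg PowerSeries.evalNegHom hGV
      rwa [map_mul, hG, map_one] at this
    calc PowerSeries.evalNegHom V = (G * V) * PowerSeries.evalNegHom V := by rw [hGV, one_mul]
      _ = (G * PowerSeries.evalNegHom V) * V := by ring
      _ = V := by rw [h1, one_mul]
  rw [← Matrix.exists_vecMul_eq_zero_iff]
  -- The relation has the even coefficients of `1/G` as its coefficients; the first of them is 1, so
  -- it is nontrivial.
  refine ⟨fun i ↦ PowerSeries.coeff (2 * (i : ℕ)) V, fun h ↦ ?_, ?_⟩
  · have h3 := congrFun h ⟨0, hm⟩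
    have h4 := congrArg PowerSeries.constantCoeff hGV
    rw [map_mul, hG0, one_mul, map_one] at h4
    simp [h4] at h3
  · funext j
    simp only [Matrix.vecMul, dotProduct, Matrix.of_apply, Pi.zero_apply]
    have h3 : PowerSeries.coeff (m + j) (V * (Z * G)) = 0 := by
      rw [mul_left_comm, mul_comm V G, hGV, mul_one]
      exact hZ _ (by omega)
    rw [PowerSeries.coeff_mul, Finset.Nat.sum_antidiagonal_eq_sum_range_succ_mk] at h3
    have h4 : ∑ k ∈ Finset.range (m + j + 1),
        PowerSeries.coeff k V * intCoeff (Z * G) ((m + j : ℕ) - (k : ℤ)) = 0 := by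
      rw [← h3]
      refine Finset.sum_congr rfl fun k hk ↦ ?_
      rw [Finset.mem_range] at hk
      rw [← Nat.cast_sub (by omega), intCoeff_natCast]
    -- Odd coefficients of `1/G` vanish, and `m + j < 2m` ensures that the `m` rows account for all
    -- even indices.
    rw [sum_range_even _ m] at h4
    · rw [Fin.sum_univ_eq_sum_range (fun i ↦ PowerSeries.coeff (2 * i) V *
        intCoeff (Z * G) (((m + 1 : ℕ) : ℤ) + ((j : ℤ) + 1) - 2 * ((i : ℤ) + 1))) m, ← h4]
      refine Finset.sum_congr rfl fun k _ ↦ ?_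
      congr 2
      push_cast
      ring
    · intro k hk
      rw [coeff_of_even h2 hVe hk, zero_mul]
    · omega
    · intro k hk
      rw [intCoeff_of_neg, mul_zero]
      omega

end PowerSeries

/-! ### Specializations of the determinant `F` -/

section Fulton

variable {n : ℕ}

theorem two_mul_C_half_Pol : (2 : Pol n) * C half = 1 := by
  rw [← map_ofNat (C : ZHalf →+* Pol n) 2, ← map_mul, two_mul_half, map_one]

variable (n) in
/-- The generating function of the elementary symmetric polynomials. -/
def esymmSeries : PowerSeries (Pol n) := ∏ i : Fin n, (1 + PowerSeries.C (X i) * PowerSeries.X)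

theorem coeff_esymmSeries (k : ℕ) :
    PowerSeries.coeff k (esymmSeries n) = esymm (Fin n) ZHalf k := by
  rw [esymmSeries, coeff_prod_one_add, esymm]

theorem esymm_eq_zero_of_lt {k : ℕ} (hk : n < k) : esymm (Fin n) ZHalf k = 0 := by
  rw [esymm, Finset.powersetCard_eq_empty.2, Finset.sum_empty]
  simpa using hk

/-- The factor of the generating function on which the signed permutation acts with sign `δ`. -/
def signSeries (w : Hyperoctahedral n) (δ : ℤˣ) : PowerSeries (Pol n) :=
  ∏ i : Fin n with w.left i = δ, (1 + PowerSeries.C (X (w.right⁻¹ i)) * PowerSeries.X)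

theorem signSeries_mul (w : Hyperoctahedral n) :
    signSeries w 1 * signSeries w (-1) = esymmSeries n := by
  have h : (Finset.univ.filter fun i ↦ w.left i = -1) =
      Finset.univ.filter fun i ↦ ¬ w.left i = 1 := by
    ext i
    rcases Int.units_eq_one_or (w.left i) with h | h <;> simp [h]
  rw [signSeries, signSeries, h, Finset.prod_filter_mul_prod_filter_not, esymmSeries]
  exact Equiv.prod_comp w.right⁻¹ fun i ↦
    (1 + PowerSeries.C (X i : Pol n) * PowerSeries.X)

theorem map_act_esymmSeries (w : Hyperoctahedral n) :
    (esymmSeries n).map (act w : Pol n →ₐ[ZHalf] Pol n) =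
      signSeries w 1 * PowerSeries.evalNegHom (signSeries w (-1)) := by
  have h : (Finset.univ.filter fun i ↦ w.left i = -1) =
      Finset.univ.filter fun i ↦ ¬ w.left i = 1 := by
    ext i
    rcases Int.units_eq_one_or (w.left i) with h | h <;> simp [h]
  rw [esymmSeries, map_prod, signSeries, signSeries, h, map_prod,
    ← Finset.prod_filter_mul_prod_filter_not _ (fun i ↦ w.left i = 1)]
  congr 1
  · refine Finset.prod_congr rfl fun i hi ↦ ?_
    rw [Finset.mem_filter] at hi
    simp [act_X, hi.2]
  · refine Finset.prod_congr rfl fun i hi ↦ ?_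
    rw [Finset.mem_filter] at hi
    have h1 := (Int.units_eq_one_or (w.left i)).resolve_left hi.2
    simp [act_X, h1, PowerSeries.evalNegHom, rescale_C]

/-- An even, nonzero number of sign changes is at least two, so at most `n - 2` linear factors are
left. -/
theorem coeff_signSeries {w : Hyperoctahedral n} (hw : w ∈ weylD n) (hw' : w ∉ weylA n) {k : ℕ}
    (hk : n - 1 ≤ k) : PowerSeries.coeff k (signSeries w 1) = 0 := by
  rw [signSeries, coeff_prod_one_add, Finset.powersetCard_eq_empty.2, Finset.sum_empty]
  refine lt_of_lt_of_le ?_ hk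
  obtain ⟨a, ha⟩ : ∃ a, w.left a ≠ 1 := by
    by_contra! h
    exact hw' (mem_weylA_iff.2 (funext h))
  obtain ⟨b, hb, hab⟩ : ∃ b, w.left b ≠ 1 ∧ b ≠ a := by
    by_contra! h
    have h1 : ∏ i, w.left i = 1 := hw
    rw [Finset.prod_eq_single a (fun b _ hb ↦ by_contra fun h2 ↦ hb (h b h2)) (by simp)] at h1
    exact ha h1
  have h2 : (Finset.univ.filter fun i ↦ w.left i = 1) ⊆ {a, b}ᶜ := by
    intro i hi
    rw [Finset.mem_filter] at hi
    rw [Finset.mem_compl, Finset.mem_insert, Finset.mem_singleton]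
    rintro (rfl | rfl)
    · exact ha hi.2
    · exact hb hi.2
  have h3 := Finset.card_le_card h2
  rw [Finset.card_compl, Finset.card_pair hab.symm, Fintype.card_fin] at h3
  have := a.2
  have := b.2
  have : (a : ℕ) ≠ b := fun h ↦ hab (Fin.ext h.symm)
  omega

theorem Ptilde_singleton (k : ℕ) : Ptilde n {k} = C half * esymm (Fin n) ZHalf k := by
  rw [Ptilde, Finset.card_singleton, pow_one, Finset.sort_singleton, Qtilde]
  simp [Qtilde]

theorem specialize_fulton (w : Hyperoctahedral n) :
    specialize w (fulton n) = Matrix.det (Matrix.of fun i j : Fin (n - 1) ↦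
      intCoeff (PowerSeries.C (C half) * ((esymmSeries n).map (act w : Pol n →ₐ[ZHalf] Pol n) +
        esymmSeries n)) ((n : ℤ) + ((j : ℤ) + 1) - 2 * ((i : ℤ) + 1))) := by
  have h (k : ℤ) : specialize w (fultonEntry n k) =
      intCoeff (PowerSeries.C (C half) * ((esymmSeries n).map (act w : Pol n →ₐ[ZHalf] Pol n) +
        esymmSeries n)) k := by
    rw [fultonEntry, intCoeff]
    split_ifs with h1 h2 h3 h4 h5
    · rw [specialize_eq, map_add, ← specialize_eq, ← specialize_eq, specialize_inX,
        specialize_inY, Ptilde_singleton, map_mul, PowerSeries.coeff_C_mul, map_add,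
        PowerSeries.coeff_map, coeff_esymmSeries, mul_add, AlgHom.coe_toRingHom]
      congr 2
      exact (act w).commutes half
    · omega
    · subst h3
      rw [specialize_eq, map_one, PowerSeries.coeff_C_mul, map_add, PowerSeries.coeff_map,
        coeff_esymmSeries]
      simp only [Int.toNat_zero, esymm_zero, map_one, ← two_mul, ← mul_assoc]
      rw [mul_one, mul_comm, two_mul_C_half_Pol]
    · omega
    · omega
    · rw [specialize_eq, map_zero]
  rw [fulton, specialize_eq, AlgHom.map_det]
  congr 1
  refine Matrix.ext fun i j ↦ ?_
  exact h _

/-- With `A` and `B` the unchanged and changed factors, the entries are coefficients of `A · (B(t) +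
B(-t))/2`; the second factor is even with constant term 1 and the first has degree at most `n - 2`.
-/
theorem specialize_fulton_eq_zero {w : Hyperoctahedral n} (hw : w ∈ weylD n) (hw' : w ∉ weylA n) :
    specialize w (fulton n) = 0 := by
  rw [specialize_fulton, map_act_esymmSeries, ← signSeries_mul w, ← mul_add, mul_left_comm]
  have hn : 1 < n := by
    by_contra! h
    refine hw' (mem_weylA_iff.2 (funext fun a ↦ ?_))
    have h1 : ∏ i, w.left i = 1 := hw
    have : Subsingleton (Fin n) := Fin.subsingleton_iff_le_one.2 h
    rwa [Fintype.prod_subsingleton _ a] at h1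
  obtain ⟨m, rfl⟩ : ∃ m, n = m + 1 := ⟨n - 1, by omega⟩
  refine det_intCoeff_eq_zero ?_ m (by omega) _ _ ?_ ?_ fun k hk ↦ coeff_signSeries hw hw' hk
  · intro h
    have := two_mul_C_half_Pol (n := m + 1)
    rw [h, zero_mul] at this
    exact zero_ne_one this
  · rw [map_mul, map_add]
    simp only [PowerSeries.evalNegHom, PowerSeries.rescale_rescale, rescale_C]
    simp [add_comm]
  · have h (f : PowerSeries (Pol (m + 1))) : PowerSeries.constantCoeff (PowerSeries.evalNegHom f) =
        PowerSeries.constantCoeff f := by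
      rw [← PowerSeries.coeff_zero_eq_constantCoeff_apply, PowerSeries.evalNegHom,
        PowerSeries.coeff_rescale, pow_zero, one_mul,
        PowerSeries.coeff_zero_eq_constantCoeff_apply]
    rw [map_mul, map_add, h]
    have h1 : PowerSeries.constantCoeff (signSeries w (-1)) = 1 := by
      simp [signSeries, map_prod]
    rw [h1, PowerSeries.constantCoeff_C, one_add_one_eq_two, mul_comm, two_mul_C_half_Pol]

theorem specialize_one_fulton_eq : specialize 1 (fulton n) =
    Matrix.det (Matrix.of fun i j : Fin (n - 1) ↦
      intCoeff (esymmSeries n) ((n : ℤ) + ((j : ℤ) + 1) - 2 * ((i : ℤ) + 1))) := by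
  rw [specialize_fulton]
  have h : (act (1 : Hyperoctahedral n) : Pol n →ₐ[ZHalf] Pol n) = AlgHom.id _ _ :=
    AlgHom.ext fun f ↦ act_one f
  have h2 : (((AlgHom.id ZHalf (Pol n)) : Pol n →ₐ[ZHalf] Pol n) : Pol n →+* Pol n) =
    RingHom.id _ := rfl
  rw [h, h2, PowerSeries.map_id, id_eq, ← two_mul, ← mul_assoc]
  have h3 : (PowerSeries.C (C half : Pol n)) * 2 = 1 := by
    rw [← map_ofNat (PowerSeries.C (R := Pol n)) 2, ← map_mul, mul_comm, two_mul_C_half_Pol, map_one]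
  rw [h3, one_mul]

theorem dropLast_esymm (k : ℕ) :
    dropLast n (esymm (Fin (n + 1)) ZHalf k) = esymm (Fin n) ZHalf k := by
  have h : (esymmSeries (n + 1)).map (dropLast n : Pol (n + 1) →+* Pol n) = esymmSeries n := by
    rw [esymmSeries, Fin.prod_univ_castSucc, esymmSeries, map_mul, map_prod]
    simp [dropLast]
  have h1 := congrArg (PowerSeries.coeff k) h
  rwa [PowerSeries.coeff_map, coeff_esymmSeries, coeff_esymmSeries] at h1

/-- When the last variable is zero, `e_k` vanishes for `k > n`. The first row then has only its
first entry `e_n`, and its minor is the determinant for `n`. -/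
theorem dropLast_specialize_fulton (hn : 0 < n) : dropLast n (specialize 1 (fulton (n + 1))) =
    esymm (Fin n) ZHalf n * specialize 1 (fulton n) := by
  obtain ⟨m, rfl⟩ : ∃ m, n = m + 1 := ⟨n - 1, by omega⟩
  rw [specialize_one_fulton_eq, specialize_one_fulton_eq, AlgHom.map_det]
  have h (k : ℤ) : dropLast (m + 1) (intCoeff (esymmSeries (m + 1 + 1)) k) =
      intCoeff (esymmSeries (m + 1)) k := by
    rw [intCoeff, intCoeff]
    split_ifs
    · rw [coeff_esymmSeries, coeff_esymmSeries, dropLast_esymm]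
    · rw [map_zero]
  have h0 : (dropLast (m + 1)).mapMatrix (Matrix.of fun i j : Fin (m + 1 + 1 - 1) ↦
      intCoeff (esymmSeries (m + 1 + 1))
        (((m + 1 + 1 : ℕ) : ℤ) + ((j : ℤ) + 1) - 2 * ((i : ℤ) + 1))) =
      Matrix.of fun i j : Fin (m + 1) ↦ intCoeff (esymmSeries (m + 1))
        (((m + 1 + 1 : ℕ) : ℤ) + ((j : ℤ) + 1) - 2 * ((i : ℤ) + 1)) :=
    Matrix.ext fun i j ↦ h _
  rw [h0, Matrix.det_succ_row_zero, Finset.sum_eq_single 0]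
  · congr 1
    · have h1 : (((m + 1 + 1 : ℕ) : ℤ) + (((0 : Fin (m + 1)) : ℕ) + 1) -
          2 * (((0 : Fin (m + 1)) : ℕ) + 1)) = (m + 1 : ℕ) := by
        push_cast [Fin.val_zero]; ring
      rw [Matrix.of_apply, h1, intCoeff_natCast, coeff_esymmSeries]
      simp
    · congr 1
      refine Matrix.ext fun i j ↦ ?_
      simp only [Matrix.submatrix_apply, Matrix.of_apply, Fin.zero_succAbove, Fin.val_succ]
      congr 1
      push_cast
      ring
  · intro j _ hj
    have h1 : (((m + 1 + 1 : ℕ) : ℤ) + ((j : ℕ) + 1) -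
        2 * (((0 : Fin (m + 1)) : ℕ) + 1)) = (m + 1 + j : ℕ) := by
      push_cast [Fin.val_zero]; ring
    have hj' : (j : ℕ) ≠ 0 := fun h ↦ hj (Fin.ext h)
    rw [Matrix.of_apply, h1, intCoeff_natCast, coeff_esymmSeries, esymm_eq_zero_of_lt (by omega)]
    simp
  · simp

theorem scale_esymm (k : ℕ) : scale n (esymm (Fin n) ZHalf k) =
    Polynomial.X ^ k * Polynomial.C (esymm (Fin n) ZHalf k) := by
  rw [esymm, map_sum, map_sum, Finset.mul_sum]
  refine Finset.sum_congr rfl fun t ht ↦ ?_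
  rw [map_prod, map_prod]
  simp only [scale_X]
  rw [Finset.prod_mul_distrib, Finset.prod_const, (Finset.mem_powersetCard.1 ht).2]

theorem scale₂_inX_of_scale {f : Pol n} {k : ℕ}
    (hf : scale n f = Polynomial.X ^ k * Polynomial.C f) :
    scale₂ n (inX f) = Polynomial.X ^ k * Polynomial.C (inX f) := by
  rw [scale₂_inX, hf, map_mul, map_pow, Polynomial.coe_mapRingHom, Polynomial.map_X,
    Polynomial.map_C]
  rfl

theorem scale₂_inY_of_scale {f : Pol n} {k : ℕ}
    (hf : scale n f = Polynomial.X ^ k * Polynomial.C f) :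
    scale₂ n (inY f) = Polynomial.X ^ k * Polynomial.C (inY f) := by
  rw [scale₂_inY, hf, map_mul, map_pow, Polynomial.coe_mapRingHom, Polynomial.map_X,
    Polynomial.map_C]
  rfl

theorem scale_C_mul {f : Pol n} {k : ℕ} (c : ZHalf)
    (hf : scale n f = Polynomial.X ^ k * Polynomial.C f) :
    scale n (C c * f) = Polynomial.X ^ k * Polynomial.C (C c * f) := by
  rw [map_mul, hf, scale_C, map_mul, mul_left_comm]

theorem scale₂_fultonEntry (a b : ℕ) :
    Polynomial.X ^ b * scale₂ n (fultonEntry n ((a : ℤ) - b)) =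
      Polynomial.X ^ a * Polynomial.C (fultonEntry n ((a : ℤ) - b)) := by
  rw [fultonEntry]
  split_ifs with h1 h2
  · have h3 := scale_C_mul half (scale_esymm (n := n) ((a : ℤ) - b).toNat)
    rw [← Ptilde_singleton] at h3
    rw [map_add, scale₂_inX_of_scale h3, scale₂_inY_of_scale h3, ← mul_add, ← map_add, ← mul_assoc,
      ← pow_add]
    congr 2
    omega
  · have : a = b := by omega
    rw [map_one, map_one, this]
  · rw [map_zero, map_zero, mul_zero, mul_zero]

/-- The degree of an entry is a column weight minus a row weight. The row weights are kept on the
left to avoid negative exponents. -/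
theorem pow_mul_map_det {S : Type*} [CommRing S] {m : ℕ} (φ : S →+* Polynomial S)
    (M : Matrix (Fin m) (Fin m) S) (a b : Fin m → ℕ)
    (h : ∀ i j, Polynomial.X ^ b i * φ (M i j) = Polynomial.X ^ a j * Polynomial.C (M i j)) :
    Polynomial.X ^ (∑ i, b i) * φ M.det = Polynomial.X ^ (∑ j, a j) * Polynomial.C M.det := by
  rw [← Finset.prod_pow_eq_pow_sum, ← Finset.prod_pow_eq_pow_sum, RingHom.map_det, RingHom.map_det,
    ← Matrix.det_mul_column, ← Matrix.det_mul_row]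
  exact congrArg _ (Matrix.ext h)

theorem scale₂_fulton : scale₂ n (fulton n) =
    Polynomial.X ^ n.choose 2 * Polynomial.C (fulton n) := by
  have h1 := pow_mul_map_det (scale₂ n) (Matrix.of fun i j : Fin (n - 1) ↦
    fultonEntry n ((n : ℤ) + ((j : ℤ) + 1) - 2 * ((i : ℤ) + 1))) (fun j ↦ n + ((j : ℕ) + 1))
    (fun i ↦ 2 * ((i : ℕ) + 1)) fun i j ↦ by
      have := scale₂_fultonEntry (n := n) (n + ((j : ℕ) + 1)) (2 * ((i : ℕ) + 1))
      push_cast at this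
      exact this
  rw [← fulton] at h1
  have h3 : ∑ j : Fin (n - 1), (n + ((j : ℕ) + 1)) =
      n.choose 2 + ∑ i : Fin (n - 1), 2 * ((i : ℕ) + 1) := by
    rw [Fin.sum_univ_eq_sum_range (fun j ↦ n + (j + 1)),
      Fin.sum_univ_eq_sum_range (fun j ↦ 2 * (j + 1)), Finset.sum_add_distrib, ← Finset.mul_sum,
      Finset.sum_const, Finset.card_range, two_mul, ← add_assoc, add_left_inj, smul_eq_mul]
    have h4 : ∑ i ∈ Finset.range (n - 1), (i + 1) = n.choose 2 := by
      cases n with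
      | zero => simp
      | succ m =>
        have := Finset.sum_range_succ' (fun i ↦ i) m
        rw [add_zero] at this
        rw [Nat.add_sub_cancel, ← this, Finset.sum_range_id, Nat.choose_two_right]
    rw [h4, Nat.choose_two_right, ← two_mul, mul_comm n (n - 1),
      Nat.mul_div_cancel' (mul_comm n (n - 1) ▸ (Nat.even_mul_pred_self n).two_dvd)]
  rw [h3, pow_add,
    mul_comm (Polynomial.X ^ n.choose 2), mul_assoc] at h1
  exact mul_left_cancel₀ (pow_ne_zero _ Polynomial.X_ne_zero) h1

theorem natDegree_scale₂_fulton : (scale₂ n (fulton n)).natDegree ≤ n.choose 2 := by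
  rw [scale₂_fulton]
  refine Polynomial.natDegree_mul_le.trans ?_
  rw [Polynomial.natDegree_C, add_zero]
  exact Polynomial.natDegree_X_pow_le _

theorem specialize_one_fulton (hn : 0 < n) : specialize 1 (fulton n) = sumProd n := by
  refine eq_sumProd (G := fun n ↦ specialize 1 (fulton n)) ?_
    (fun n hn ↦ dropLast_specialize_fulton hn) ?_ ?_ hn
  · simp [specialize_one_fulton_eq]
  · intro n a b hab
    exact subst_specialize_one (fun w hw hw' ↦ specialize_fulton_eq_zero hw hw') hab
  · intro n
    exact (natDegree_scale_specialize _ _).trans natDegree_scale₂_fulton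

/-! ### The reproducing kernel -/

theorem scale₂_kernelA : scale₂ n (kernelA n) =
    Polynomial.X ^ n.choose 2 * Polynomial.C (kernelA n) := by
  have h (i : Fin n) : scale n (X i) = Polynomial.X ^ 1 * Polynomial.C (X i) := by
    rw [scale_X, pow_one]
  rw [kernelA, map_prod, map_prod]
  have h1 (p : Fin n × Fin n) : scale₂ n (inX (X p.1) - inY (X p.2)) =
      Polynomial.X * Polynomial.C (inX (X p.1) - inY (X p.2)) := by
    rw [map_sub, map_sub, scale₂_inX_of_scale (h _), scale₂_inY_of_scale (h _), pow_one]
    exact (mul_sub (Polynomial.X : Polynomial (Pol₂ n)) _ _).symm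
  simp only [h1]
  have h2 : (Finset.univ.filter fun p : Fin n × Fin n ↦ p.2 < p.1) =
      (Finset.univ.filter fun p : Fin n × Fin n ↦ p.1 < p.2).map
        (Equiv.prodComm _ _).toEmbedding := by
    ext p
    simp
  rw [Finset.prod_mul_distrib, Finset.prod_const, h2, Finset.card_map, card_filter_lt]

/-- A nontrivial permutation sends some index to a smaller one, and the corresponding factor becomes
zero. -/
theorem specialize_kernelA_eq_zero {w : Hyperoctahedral n} (hw : w ∈ weylA n) (hw1 : w ≠ 1) :
    specialize w (kernelA n) = 0 := by
  obtain ⟨σ, rfl⟩ := hw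
  obtain ⟨i, hi⟩ : ∃ i, σ⁻¹ i < i := by
    by_contra! h
    have h1 : ∑ i : Fin n, (i : ℕ) = ∑ i : Fin n, (σ⁻¹ i : ℕ) :=
      (Equiv.sum_comp σ⁻¹ fun i : Fin n ↦ (i : ℕ)).symm
    have h2 := (Finset.sum_eq_sum_iff_of_le fun i _ ↦ Fin.le_def.1 (h i)).1 h1
    have h3 : σ⁻¹ = 1 := Equiv.ext fun i ↦ Fin.ext (h2 i (Finset.mem_univ i)).symm
    rw [inv_eq_one] at h3
    exact hw1 (by rw [h3, map_one])
  rw [kernelA, specialize_eq, map_prod]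
  refine Finset.prod_eq_zero (i := (i, σ⁻¹ i)) (by simpa using hi) ?_
  rw [map_sub, ← specialize_eq, ← specialize_eq, specialize_inX, specialize_inY, act_X]
  simp

theorem specialize_kernel_eq_zero {w : Hyperoctahedral n} (hw : w ∈ weylD n) (hw1 : w ≠ 1) :
    specialize w (kernelA n * fulton n) = 0 := by
  rw [specialize_eq, map_mul, ← specialize_eq, ← specialize_eq]
  by_cases h : w ∈ weylA n
  · rw [specialize_kernelA_eq_zero h hw1, zero_mul]
  · rw [specialize_fulton_eq_zero hw h, mul_zero]

theorem specialize_one_kernel (hn : 0 < n) :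
    specialize 1 (kernelA n * fulton n) = disc n ZHalf := by
  rw [specialize_eq, map_mul, ← specialize_eq, ← specialize_eq, specialize_one_fulton hn,
    disc_eq_prod, kernelA, specialize_eq, map_prod]
  simp only [map_sub, ← specialize_eq, specialize_inX, specialize_inY, act_one]
  have h2 : (Finset.univ.filter fun p : Fin n × Fin n ↦ p.2 < p.1) =
      (Finset.univ.filter fun p : Fin n × Fin n ↦ p.1 < p.2).map
        (Equiv.prodComm _ _).toEmbedding := by
    ext p
    simp
  rw [h2, Finset.prod_map, sumProd, ← Finset.prod_mul_distrib, Finset.prod_filter,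
    Fintype.prod_prod_type]
  refine Finset.prod_congr rfl fun i _ ↦ ?_
  rw [← Finset.prod_filter]
  refine Finset.prod_congr (by ext; simp) fun j _ ↦ ?_
  simp
  ring

theorem natDegree_scale₂_kernel :
    (scale₂ n (kernelA n * fulton n)).natDegree ≤ n * (n - 1) := by
  rw [map_mul, scale₂_kernelA, scale₂_fulton, mul_mul_mul_comm, ← pow_add, ← map_mul,
    Nat.choose_two_right, ← two_mul, Nat.mul_div_cancel' (Nat.even_mul_pred_self n).two_dvd]
  refine Polynomial.natDegree_mul_le.trans ?_
  rw [Polynomial.natDegree_C, add_zero]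
  exact Polynomial.natDegree_X_pow_le _

theorem specialize_fulton_of_mem {w : Hyperoctahedral n} (hw : w ∈ weylA n) :
    specialize w (fulton n) = specialize 1 (fulton n) := by
  obtain ⟨σ, rfl⟩ := hw
  have h (k : ℕ) : act (SemidirectProduct.inr σ) (esymm (Fin n) ZHalf k) =
      esymm (Fin n) ZHalf k := by
    rw [act_inr]
    exact esymm_isSymmetric _ _ _ _
  have h1 : (esymmSeries n).map ((act (SemidirectProduct.inr σ : Hyperoctahedral n) :
      Pol n →ₐ[ZHalf] Pol n) : Pol n →+* Pol n) = esymmSeries n := by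
    refine PowerSeries.ext fun k ↦ ?_
    rw [PowerSeries.coeff_map, coeff_esymmSeries]
    exact h k
  have h2 : (esymmSeries n).map ((act (1 : Hyperoctahedral n) :
      Pol n →ₐ[ZHalf] Pol n) : Pol n →+* Pol n) = esymmSeries n := by
    refine PowerSeries.ext fun k ↦ ?_
    rw [PowerSeries.coeff_map, coeff_esymmSeries]
    exact act_one _
  rw [specialize_fulton, specialize_fulton, h1, h2]

end Fulton

/-! ### The Pfaffian functional -/

section Pfaffian

variable {R M : Type*} [CommRing R] [AddCommGroup M] [Module R M]

/-- The product of a list of vectors in the exterior algebra. -/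
def wedge (l : List M) : ExteriorAlgebra R M := (l.map (ExteriorAlgebra.ι R)).prod

@[simp]
theorem wedge_nil : wedge ([] : List M) = (1 : ExteriorAlgebra R M) := rfl

theorem wedge_cons (v : M) (l : List M) :
    wedge (v :: l) = ExteriorAlgebra.ι R v * wedge l := by
  simp [wedge]

theorem wedge_append (l l' : List M) :
    wedge (l ++ l') = (wedge l * wedge l' : ExteriorAlgebra R M) := by
  simp [wedge]

theorem wedge_singleton (v : M) : wedge [v] = ExteriorAlgebra.ι R v := by
  simp [wedge]

theorem ι_mul_ι_comm (v w : M) : ExteriorAlgebra.ι R v * ExteriorAlgebra.ι R w =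
    -(ExteriorAlgebra.ι R w * ExteriorAlgebra.ι R v) :=
  eq_neg_of_add_eq_zero_left (ExteriorAlgebra.ι_add_mul_swap v w)

theorem wedge_mul_ι (l : List M) (v : M) : wedge l * ExteriorAlgebra.ι R v =
    (-1) ^ l.length * (ExteriorAlgebra.ι R v * wedge l) := by
  induction l with
  | nil => simp
  | cons a l ih =>
    rw [wedge_cons, mul_assoc, ih, ← mul_assoc _ ((-1) ^ l.length),
      ← ((Commute.neg_one_left (ExteriorAlgebra.ι R a)).pow_left l.length).eq, mul_assoc,
      ← mul_assoc (ExteriorAlgebra.ι R a), ι_mul_ι_comm a v, List.length_cons, pow_succ]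
    simp [mul_assoc]

theorem ι_mul_wedge_mul_ι (l : List M) (v : M) :
    ExteriorAlgebra.ι R v * (wedge l * ExteriorAlgebra.ι R v) = 0 := by
  rw [wedge_mul_ι, ← mul_assoc, ← ((Commute.neg_one_left _).pow_left l.length).eq, mul_assoc,
    ← mul_assoc (ExteriorAlgebra.ι R v), ExteriorAlgebra.ι_sq_zero, zero_mul, mul_zero]

theorem ι_mul_wedge_of_mem {v : M} {l : List M} (h : v ∈ l) :
    ExteriorAlgebra.ι R v * wedge l = 0 := by
  obtain ⟨a, b, rfl⟩ := List.append_of_mem h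
  rw [wedge_append, wedge_cons, ← mul_assoc (wedge a), ← mul_assoc, ι_mul_wedge_mul_ι, zero_mul]

theorem contractLeft_wedge_mul (d : Module.Dual R M) (l : List M) (x : ExteriorAlgebra R M)
    (h : ∀ v ∈ l, d v = 0) : CliffordAlgebra.contractLeft d (wedge l * x) =
      (-1) ^ l.length * (wedge l * CliffordAlgebra.contractLeft d x) := by
  induction l with
  | nil => simp
  | cons a l ih =>
    rw [wedge_cons, mul_assoc]
    refine (CliffordAlgebra.contractLeft_ι_mul d a _).trans ?_
    rw [ih fun v hv ↦ h v (List.mem_cons_of_mem _ hv), h a List.mem_cons_self, zero_smul, zero_sub,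
      List.length_cons, pow_succ, ← mul_assoc _ ((-1) ^ l.length)]
    change -(ExteriorAlgebra.ι R a * (-1) ^ l.length * _) = _
    rw [← ((Commute.neg_one_left (ExteriorAlgebra.ι R a)).pow_left l.length).eq]
    simp [mul_assoc]

theorem contractLeft_wedge (d : Module.Dual R M) (l : List M) (h : ∀ v ∈ l, d v = 0) :
    CliffordAlgebra.contractLeft d (wedge l : ExteriorAlgebra R M) = 0 := by
  have := contractLeft_wedge_mul d l 1 h
  rwa [mul_one, CliffordAlgebra.contractLeft_one, mul_zero, mul_zero] at this

/-- Contraction is an antiderivation; as it kills `x`, only the terms that remove a factor of the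
list remain. -/
theorem contractLeft_wedge_map_mul {α : Type*} (d : Module.Dual R M) (v : α → M) (l : List α)
    (x : ExteriorAlgebra R M) (hx : CliffordAlgebra.contractLeft d x = 0) :
    CliffordAlgebra.contractLeft d (wedge (l.map v) * x) =
      ∑ j : Fin l.length, ((-1) ^ (j : ℕ) * d (v l[j])) •
        (wedge ((l.eraseIdx j).map v) * x) := by
  induction l with
  | nil => simpa using hx
  | cons a l ih =>
    rw [List.map_cons, wedge_cons, mul_assoc]
    refine (CliffordAlgebra.contractLeft_ι_mul d _ _).trans ?_
    rw [ih]
    change _ = ∑ j : Fin (l.length + 1), _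
    rw [Fin.sum_univ_succ, sub_eq_add_neg]
    congr 1
    · simp
    · rw [Finset.mul_sum, ← Finset.sum_neg_distrib]
      refine Finset.sum_congr rfl fun j _ ↦ ?_
      simp only [Fin.val_succ, List.eraseIdx_cons_succ, List.map_cons, wedge_cons, pow_succ,
        Fin.getElem_fin, List.getElem_cons_succ]
      rw [mul_smul_comm, ← neg_smul, mul_assoc]
      change _ • (ExteriorAlgebra.ι R (v a) * _) = _
      rw [← mul_assoc (ExteriorAlgebra.ι R (v a))]
      congr 1
      ring

/-- The functional on the exterior algebra that maps a product of vectors to the Pfaffian of the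
matrix of values of an alternating form. -/
def pfaffian (ω : LinearMap.BilinForm R M) (hω : ω.IsAlt) : ExteriorAlgebra R M →ₗ[R] R :=
  (ExteriorAlgebra.algebraMapInv (R := R) (M := M)).toLinearMap ∘ₗ
    CliffordAlgebra.changeForm (Q := 0) (Q' := 0) (B := -ω)
      (QuadraticMap.ext fun v ↦ by simp [hω v])

variable {ω : LinearMap.BilinForm R M} (hω : ω.IsAlt)

theorem pfaffian_one : pfaffian ω hω 1 = 1 := by
  simp [pfaffian]

/-- This is expansion along the first row: changing the form by `-ω` turns multiplication by `v`
into multiplication minus contraction with `-ω v`, and the scalar part kills the product with `v`.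
-/
theorem pfaffian_ι_mul (v : M) (x : ExteriorAlgebra R M) :
    pfaffian ω hω (ExteriorAlgebra.ι R v * x) =
      pfaffian ω hω (CliffordAlgebra.contractLeft (ω v) x) := by
  have h : CliffordAlgebra.changeForm (Q := 0) (Q' := 0) (B := -ω)
      (QuadraticMap.ext fun v ↦ by simp [hω v]) (ExteriorAlgebra.ι R v * x) = _ :=
    CliffordAlgebra.changeForm_ι_mul _ v x
  have h0 : ExteriorAlgebra.algebraMapInv (CliffordAlgebra.ι (0 : QuadraticForm R M) v) = 0 :=
    (ExteriorAlgebra.lift_ι_apply ..)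
  simp only [pfaffian, LinearMap.comp_apply, AlgHom.toLinearMap_apply, h, map_sub, map_mul, h0,
    zero_mul, zero_sub, LinearMap.neg_apply, map_neg, neg_neg,
    CliffordAlgebra.changeForm_contractLeft]

theorem pfaffian_cons_mul {α : Type*} (a : M) (v : α → M) (l : List α)
    (x : ExteriorAlgebra R M) (hx : CliffordAlgebra.contractLeft (ω a) x = 0) :
    pfaffian ω hω (wedge (a :: l.map v) * x) =
      ∑ j : Fin l.length, ((-1) ^ (j : ℕ) * ω a (v l[j])) *
        pfaffian ω hω (wedge ((l.eraseIdx j).map v) * x) := by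
  rw [wedge_cons, mul_assoc, pfaffian_ι_mul, contractLeft_wedge_map_mul _ _ _ _ hx, map_sum]
  simp only [map_smul, smul_eq_mul]

theorem pfaffian_cons {α : Type*} (a : M) (v : α → M) (l : List α) :
    pfaffian ω hω (wedge (a :: l.map v)) =
      ∑ j : Fin l.length, ((-1) ^ (j : ℕ) * ω a (v l[j])) *
        pfaffian ω hω (wedge ((l.eraseIdx j).map v)) := by
  have := pfaffian_cons_mul hω a v l 1 (CliffordAlgebra.contractLeft_one _ _)
  simpa only [mul_one] using this

theorem length_eraseIdx_fin {α : Type*} {l : List α} (j : Fin l.length) :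
    (l.eraseIdx j).length + 1 = l.length :=
  List.length_eraseIdx_add_one j.2

theorem pfaffian_wedge_of_odd (l : List M) (hl : Odd l.length) : pfaffian ω hω (wedge l) = 0 := by
  induction hk : l.length using Nat.strong_induction_on generalizing l with
  | _ k ih =>
    cases l with
    | nil => simp at hl
    | cons a l =>
      have := pfaffian_cons hω a id l
      rw [List.map_id] at this
      rw [this]
      refine Finset.sum_eq_zero fun j _ ↦ ?_
      have h1 := length_eraseIdx_fin j
      rw [List.length_cons] at hl hk
      rw [List.map_id, ih _ (by omega) _ ?_ rfl, mul_zero]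
      rw [← h1] at hl
      rcases hl with ⟨c, hc⟩
      exact ⟨c - 1, by omega⟩

/-- The Pfaffian of a block diagonal matrix is the product of those of the blocks; the contractions
with vectors of the first list kill the second list. -/
theorem pfaffian_wedge_mul_wedge (l l' : List M) (h : ∀ v ∈ l, ∀ w ∈ l', ω v w = 0) :
    pfaffian ω hω (wedge l * wedge l') = pfaffian ω hω (wedge l) * pfaffian ω hω (wedge l') := by
  induction hk : l.length using Nat.strong_induction_on generalizing l with
  | _ k ih =>
    cases l with
    | nil => simp [pfaffian_one]
    | cons a l =>
      have h1 := pfaffian_cons hω a id l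
      have h2 := pfaffian_cons_mul hω a id l (wedge l')
        (contractLeft_wedge _ _ (h a List.mem_cons_self))
      simp only [List.map_id] at h1 h2
      rw [h1, h2, Finset.sum_mul]
      refine Finset.sum_congr rfl fun j _ ↦ ?_
      have h3 := length_eraseIdx_fin j
      rw [List.length_cons] at hk
      rw [mul_assoc, ih _ (by omega) _ (fun v hv ↦ h v
        (List.mem_cons_of_mem _ (List.mem_of_mem_eraseIdx hv))) rfl, mul_assoc, mul_assoc]

end Pfaffian

/-! ### The Pfaffian recursion for sequences -/

section Sequences

variable {R : Type*} [CommRing R]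

/-- The quadratic expressions of which the polynomials `Q̃_I` are the Pfaffians. -/
def pairQ (p : ℕ → R) (i j : ℕ) : R :=
  p i * p j + 2 * ∑ q ∈ Finset.Icc 1 j, (-1) ^ q * p (i + q) * p (j - q)

/-- The recursion of the polynomials `Q̃_I` for an arbitrary sequence in place of the elementary
symmetric polynomials. -/
def listQ (p : ℕ → R) : List ℕ → R
  | [] => 1
  | a :: t =>
    if Odd (a :: t).length then
      ∑ j : Fin (a :: t).length, (-1) ^ (j : ℕ) * p (a :: t)[j] * listQ p ((a :: t).eraseIdx j)
    else
      ∑ j : Fin t.length, (-1) ^ (j : ℕ) * pairQ p a t[j] * listQ p (t.eraseIdx j)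
termination_by l => l.length
decreasing_by
  all_goals
    have := j.2
    simp only [List.length_eraseIdx, List.length_cons] at *
    split <;> omega

theorem listQ_of_odd (p : ℕ → R) {l : List ℕ} (hl : Odd l.length) : listQ p l =
    ∑ j : Fin l.length, (-1) ^ (j : ℕ) * p l[j] * listQ p (l.eraseIdx j) := by
  cases l with
  | nil => simp at hl
  | cons a t => rw [listQ, if_pos hl]

theorem listQ_of_even (p : ℕ → R) {a : ℕ} {t : List ℕ} (hl : Odd t.length) : listQ p (a :: t) =
    ∑ j : Fin t.length, (-1) ^ (j : ℕ) * pairQ p a t[j] * listQ p (t.eraseIdx j) := by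
  rw [listQ, if_neg]
  rw [List.length_cons, Nat.not_odd_iff_even]
  exact hl.add_one

theorem map_listQ {S F : Type*} [CommRing S] [FunLike F R S] [RingHomClass F R S] (φ : F)
    (p : ℕ → R) (l : List ℕ) : φ (listQ p l) = listQ (fun k ↦ φ (p k)) l := by
  induction hk : l.length using Nat.strong_induction_on generalizing l with
  | _ k ih =>
    cases l with
    | nil => simp [listQ]
    | cons a t =>
      rcases Nat.even_or_odd t.length with h | h
      · have h1 : Odd (a :: t).length := by rw [List.length_cons]; exact h.add_one
        rw [listQ_of_odd _ h1, listQ_of_odd _ h1, map_sum]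
        refine Finset.sum_congr rfl fun j _ ↦ ?_
        have h3 := length_eraseIdx_fin j
        rw [map_mul, map_mul, map_pow, map_neg, map_one, ih _ (by omega) _ rfl]
      · rw [listQ_of_even _ h, listQ_of_even _ h, map_sum]
        refine Finset.sum_congr rfl fun j _ ↦ ?_
        have h3 := length_eraseIdx_fin j
        rw [List.length_cons] at hk
        rw [map_mul, map_mul, map_pow, map_neg, map_one, ih _ (by omega) _ rfl]
        simp [pairQ, map_ofNat φ 2]

theorem pairQ_pow_mul (p : ℕ → R) (c : R) (i j : ℕ) :
    pairQ (fun k ↦ c ^ k * p k) i j = c ^ (i + j) * pairQ p i j := by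
  have h : ∑ q ∈ Finset.Icc 1 j, (-1) ^ q * (c ^ (i + q) * p (i + q)) * (c ^ (j - q) * p (j - q)) =
      c ^ (i + j) * ∑ q ∈ Finset.Icc 1 j, (-1) ^ q * p (i + q) * p (j - q) := by
    rw [Finset.mul_sum]
    refine Finset.sum_congr rfl fun q hq ↦ ?_
    obtain ⟨s, rfl⟩ : ∃ s, j = q + s := Nat.exists_eq_add_of_le (Finset.mem_Icc.1 hq).2
    rw [Nat.add_sub_cancel_left]
    ring
  rw [pairQ, pairQ, h]
  ring

theorem sum_eraseIdx_add (l : List ℕ) (j : Fin l.length) : l[j] + (l.eraseIdx j).sum = l.sum := by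
  have h := List.getElem_cons_eraseIdx_perm j.2
  have h2 := h.sum_nat
  rwa [List.sum_cons] at h2

/-- Homogeneity of weight `|I|`. It serves to count degrees and, with `c = -1`, to remove the signs
from the complementary sum. -/
theorem listQ_pow_mul (p : ℕ → R) (c : R) (l : List ℕ) :
    listQ (fun k ↦ c ^ k * p k) l = c ^ l.sum * listQ p l := by
  induction hk : l.length using Nat.strong_induction_on generalizing l with
  | _ k ih =>
    cases l with
    | nil => simp [listQ]
    | cons a t =>
      rcases Nat.even_or_odd t.length with h | h
      · have h1 : Odd (a :: t).length := by rw [List.length_cons]; exact h.add_one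
        rw [listQ_of_odd _ h1, listQ_of_odd _ h1, Finset.mul_sum]
        refine Finset.sum_congr rfl fun j _ ↦ ?_
        have h3 := length_eraseIdx_fin j
        rw [ih _ (by omega) _ rfl, ← sum_eraseIdx_add _ j]
        ring
      · rw [listQ_of_even _ h, listQ_of_even _ h, Finset.mul_sum]
        refine Finset.sum_congr rfl fun j _ ↦ ?_
        have h3 := length_eraseIdx_fin j
        rw [List.length_cons] at hk
        rw [ih _ (by omega) _ rfl, pairQ_pow_mul, List.sum_cons, ← sum_eraseIdx_add _ j]
        ring

variable {M : Type*} [AddCommGroup M] [Module R M] {ω : LinearMap.BilinForm R M} (hω : ω.IsAlt)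

theorem pfaffian_wedge_of_even (p : ℕ → R) (c : R) (v : ℕ → M)
    (hv : ∀ i j, 0 < j → j < i → ω (v i) (v j) = c * pairQ p i j)
    {l : List ℕ} (hl : l.Pairwise (· > ·)) (h0 : ∀ i ∈ l, 0 < i) (he : Even l.length) :
    pfaffian ω hω (wedge (l.map v)) = c ^ (l.length / 2) * listQ p l := by
  induction hk : l.length using Nat.strong_induction_on generalizing l with
  | _ k ih =>
    cases l with
    | nil => subst hk; simp [listQ, pfaffian_one]
    | cons a t =>
      rw [List.length_cons] at hk he
      have ht : Odd t.length := by
        by_contra h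
        exact (Nat.not_even_iff_odd.2 (Nat.not_odd_iff_even.1 h).add_one) he
      rw [List.map_cons, pfaffian_cons, listQ_of_even _ ht, Finset.mul_sum]
      refine Finset.sum_congr rfl fun j _ ↦ ?_
      have h3 := length_eraseIdx_fin j
      have hm : t[j] ∈ t := List.getElem_mem _
      rw [List.pairwise_cons] at hl
      obtain ⟨b, hb⟩ := ht
      rw [hv a t[j] (h0 _ (List.mem_cons_of_mem _ hm)) (hl.1 _ hm),
        ih _ (by omega) (hl.2.eraseIdx _) (fun i hi ↦ h0 i (List.mem_cons_of_mem _
          (List.mem_of_mem_eraseIdx hi))) ⟨b, by omega⟩ rfl]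
      have h4 : k / 2 = (t.eraseIdx j).length / 2 + 1 := by omega
      rw [h4, pow_succ]
      ring

/-- The recursion for an odd number of parts is the expansion of a Pfaffian along an additional
vector that pairs with the `i`-th one to `p i`. -/
theorem pfaffian_wedge_mul_ι (p : ℕ → R) (c : R) (v : ℕ → M) (z : M)
    (hv : ∀ i j, 0 < j → j < i → ω (v i) (v j) = c * pairQ p i j)
    (hz : ∀ i, 0 < i → ω (v i) z = c * p i)
    {l : List ℕ} (hl : l.Pairwise (· > ·)) (h0 : ∀ i ∈ l, 0 < i) (ho : Odd l.length) :
    pfaffian ω hω (wedge (l.map v) * ExteriorAlgebra.ι R z) =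
      c ^ ((l.length + 1) / 2) * listQ p l := by
  rw [wedge_mul_ι, List.length_map, ho.neg_one_pow, neg_one_mul, map_neg, ← wedge_cons,
    pfaffian_cons, listQ_of_odd _ ho, Finset.mul_sum, ← Finset.sum_neg_distrib]
  refine Finset.sum_congr rfl fun j _ ↦ ?_
  have h3 := length_eraseIdx_fin j
  have hm : l[j] ∈ l := List.getElem_mem _
  obtain ⟨b, hb⟩ := ho
  rw [pfaffian_wedge_of_even hω p c v hv (hl.eraseIdx _)
    (fun i hi ↦ h0 i (List.mem_of_mem_eraseIdx hi)) ⟨b, by omega⟩, ← hω.neg_eq, hz _ (h0 _ hm)]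
  have h4 : (l.length + 1) / 2 = (l.eraseIdx j).length / 2 + 1 := by omega
  rw [h4, pow_succ]
  ring

end Sequences

/-! ### Sums over pairs of complementary strict partitions -/

section Complementary

variable {R M : Type*} [CommRing R] [AddCommGroup M] [Module R M]

/-- The list `[m, …, 1]`. -/
def descList : ℕ → List ℕ
  | 0 => []
  | m + 1 => (m + 1) :: descList m

theorem mem_descList {i m : ℕ} : i ∈ descList m ↔ 0 < i ∧ i ≤ m := by
  induction m with
  | zero => simp [descList]; omega
  | succ m ih => rw [descList, List.mem_cons, ih]; omega

theorem Icc_one_succ (m : ℕ) : Finset.Icc 1 (m + 1) = insert (m + 1) (Finset.Icc 1 m) := by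
  ext; simp; omega

theorem sort_insert_succ {m : ℕ} {I : Finset ℕ} (hI : I ⊆ Finset.Icc 1 m) :
    (insert (m + 1) I).sort (· ≥ ·) = (m + 1) :: I.sort (· ≥ ·) := by
  refine Finset.sort_insert _ (fun b hb ↦ ?_) fun h ↦ ?_
  · have := Finset.mem_Icc.1 (hI hb); omega
  · have := Finset.mem_Icc.1 (hI h); omega

theorem notMem_of_subset_Icc {m : ℕ} {I : Finset ℕ} (hI : I ⊆ Finset.Icc 1 m) : m + 1 ∉ I :=
  fun h ↦ by have := Finset.mem_Icc.1 (hI h); omega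

theorem sdiff_insert_succ {m : ℕ} {I : Finset ℕ} :
    Finset.Icc 1 (m + 1) \ insert (m + 1) I = Finset.Icc 1 m \ I := by
  rw [Icc_one_succ, Finset.insert_sdiff_insert, Finset.sdiff_insert_of_notMem (by simp)]

theorem sdiff_succ {m : ℕ} {I : Finset ℕ} (hI : I ⊆ Finset.Icc 1 m) :
    Finset.Icc 1 (m + 1) \ I = insert (m + 1) (Finset.Icc 1 m \ I) := by
  rw [Icc_one_succ, Finset.insert_sdiff_of_notMem _ (notMem_of_subset_Icc hI)]

theorem pairwise_sort_gt (I : Finset ℕ) : (I.sort (· ≥ ·)).Pairwise (· > ·) :=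
  ((I.pairwise_sort (· ≥ ·)).and (I.sort_nodup (· ≥ ·))).imp fun h ↦ lt_of_le_of_ne h.1 h.2.symm

theorem neg_one_pow_half (b : ℕ) :
    (-1 : R) ^ ((b + 2) / 2) = (-1) ^ ((b + 1) / 2) * (-1) ^ (b + 1) := by
  rcases Nat.even_or_odd' b with ⟨c, rfl | rfl⟩
  · have h1 : (2 * c + 2) / 2 = c + 1 := by omega
    have h2 : (2 * c + 1) / 2 = c := by omega
    rw [h1, h2, pow_succ, (odd_two_mul_add_one c).neg_one_pow]
  · have h1 : (2 * c + 1 + 2) / 2 = c + 1 := by omega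
    have h2 : (2 * c + 1 + 1) / 2 = c + 1 := by omega
    have h3 : Even (2 * c + 1 + 1) := ⟨c + 1, by ring⟩
    rw [h1, h2, h3.neg_one_pow, mul_one]

/-- Moving the `η`-factors to the right, the factor of index `k` passes the smaller indices outside
its set `J`. In total this is `∑ k - |J|(|J|+1)/2` transpositions, and the subtracted number has the
parity of `⌊(|J|+1)/2⌋`. -/
theorem wedge_descList_add (ξ η : ℕ → M) (m : ℕ) :
    (wedge ((descList m).map fun k ↦ ξ k + η k) : ExteriorAlgebra R M) =
      ∑ I ∈ (Finset.Icc 1 m).powerset,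
        (-1 : R) ^ (∑ k ∈ Finset.Icc 1 m \ I, k + ((Finset.Icc 1 m \ I).card + 1) / 2) •
          (wedge ((I.sort (· ≥ ·)).map ξ) *
            wedge (((Finset.Icc 1 m \ I).sort (· ≥ ·)).map η)) := by
  induction m with
  | zero => simp [descList]
  | succ m ih =>
    rw [descList, List.map_cons, wedge_cons, ih, map_add, add_mul, add_comm, Icc_one_succ,
      Finset.sum_powerset_insert (by simp), ← Icc_one_succ, Finset.mul_sum, Finset.mul_sum]
    congr 1
    · refine Finset.sum_congr rfl fun I hI ↦ ?_
      rw [Finset.mem_powerset] at hI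
      have hn := notMem_of_subset_Icc (Finset.sdiff_subset (s := Finset.Icc 1 m) (t := I))
      have hc : (Finset.Icc 1 m \ I).card + I.card = m := by
        rw [Finset.card_sdiff_add_card_eq_card hI, Nat.card_Icc, Nat.add_sub_cancel]
      rw [sdiff_succ hI, sort_insert_succ Finset.sdiff_subset, Finset.sum_insert hn,
        Finset.card_insert_of_notMem hn, List.map_cons, wedge_cons, ← mul_assoc (wedge _),
        wedge_mul_ι, List.length_map, Finset.length_sort, mul_smul_comm, mul_assoc, mul_assoc,
        ← mul_assoc (ExteriorAlgebra.ι R _)]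
      have h1 (k : ℕ) (x : ExteriorAlgebra R M) : (-1) ^ k * x = (-1 : R) ^ k • x := by
        rcases Nat.even_or_odd k with h | h <;> simp [h.neg_one_pow]
      rw [h1, smul_smul]
      congr 1
      rw [add_assoc _ 1 1, one_add_one_eq_two, pow_add, pow_add, pow_add, neg_one_pow_half]
      have h2 : (-1 : R) ^ (m + 1) = (-1) ^ (Finset.Icc 1 m \ I).card * (-1) ^ I.card * (-1) := by
        rw [← pow_add, ← pow_succ, hc]
      have h3 : ((-1 : R) ^ (Finset.Icc 1 m \ I).card) * (-1) ^ (Finset.Icc 1 m \ I).card = 1 := by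
        rw [← pow_add, Even.neg_one_pow ⟨_, rfl⟩]
      have h4 : ((-1 : R) ^ I.card) * (-1) ^ I.card = 1 := by
        rw [← pow_add, Even.neg_one_pow ⟨_, rfl⟩]
      rw [h2, pow_succ _ (Finset.Icc 1 m \ I).card]
      generalize (-1 : R) ^ (Finset.Icc 1 m \ I).card = a at *
      generalize (-1 : R) ^ I.card = b at *
      generalize (-1 : R) ^ (∑ k ∈ Finset.Icc 1 m \ I, k) = s
      generalize (-1 : R) ^ (((Finset.Icc 1 m \ I).card + 1) / 2) = t
      linear_combination (-s * t * b * b) * h3 - s * t * h4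
    · refine Finset.sum_congr rfl fun I hI ↦ ?_
      rw [Finset.mem_powerset] at hI
      rw [sdiff_insert_succ, sort_insert_succ hI, List.map_cons, wedge_cons, mul_smul_comm,
        mul_assoc]

variable {ω : LinearMap.BilinForm R M} (hω : ω.IsAlt)

theorem wedge_mul_ι_eq (l : List M) (v : M) : wedge l * ExteriorAlgebra.ι R v =
    (wedge (l ++ [v]) : ExteriorAlgebra R M) := by
  rw [wedge_append, wedge_singleton]

/-- The Pfaffian functional kills odd products, so of the two terms exactly the one with an even
number of factors counts. Adding `v 0` thus treats both parities at once, as `pairQ p i 0 = p i`. -/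
theorem listQ_eq_pfaffian (p : ℕ → R) (c : R) (v : ℕ → M) (hp : p 0 = 1)
    (hv : ∀ i j, j < i → ω (v i) (v j) = c * pairQ p i j)
    {l : List ℕ} (hl : l.Pairwise (· > ·)) (h0 : ∀ i ∈ l, 0 < i) :
    pfaffian ω hω (wedge (l.map v)) + pfaffian ω hω (wedge (l.map v) * ExteriorAlgebra.ι R (v 0)) =
      c ^ ((l.length + 1) / 2) * listQ p l := by
  rcases Nat.even_or_odd l.length with h | h
  · rw [pfaffian_wedge_of_even hω p c v (fun i j _ ↦ hv i j) hl h0 h, wedge_mul_ι_eq,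
      pfaffian_wedge_of_odd, add_zero]
    · obtain ⟨b, hb⟩ := h
      congr 2
      omega
    · rw [List.length_append, List.length_map, List.length_singleton]
      exact h.add_one
  · rw [pfaffian_wedge_of_odd, zero_add]
    · refine pfaffian_wedge_mul_ι hω p c v (v 0) (fun i j _ ↦ hv i j) (fun i hi ↦ ?_) hl h0 h
      rw [hv i 0 hi, pairQ]
      simp [hp]
    · rwa [List.length_map]

variable {p r : ℕ → R} {ξ η : ℕ → M}

/-- The two boundary factors adjoin `ξ_0` and `η_0` wherever the parity calls for them. In the
surviving terms `ξ_0` moves past an even number of factors to reach its own block, so no sign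
appears. -/
theorem pfaffian_wedge_mul_wedge_mul (hp : p 0 = 1) (hr : r 0 = 1)
    (hξ : ∀ i j, j < i → ω (ξ i) (ξ j) = pairQ p i j)
    (hη : ∀ i j, j < i → ω (η i) (η j) = -pairQ r i j)
    (hξη : ∀ i j, ω (ξ i) (η j) = 0) {A B : List ℕ}
    (hA : A.Pairwise (· > ·)) (hA0 : ∀ i ∈ A, 0 < i)
    (hB : B.Pairwise (· > ·)) (hB0 : ∀ i ∈ B, 0 < i) :
    pfaffian ω hω (wedge (A.map ξ) * wedge (B.map η) *
      ((1 + ExteriorAlgebra.ι R (η 0)) * (1 + ExteriorAlgebra.ι R (ξ 0)))) =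
      listQ p A * ((-1) ^ ((B.length + 1) / 2) * listQ r B) := by
  have h1 := listQ_eq_pfaffian hω p 1 ξ hp (fun i j hij ↦ by rw [hξ i j hij, one_mul]) hA hA0
  have h2 := listQ_eq_pfaffian hω r (-1) η hr (fun i j hij ↦ by rw [hη i j hij, neg_one_mul])
    hB hB0
  rw [one_pow, one_mul] at h1
  rw [← h1, ← h2]
  have hor : ∀ v ∈ A.map ξ ++ [ξ 0], ∀ w ∈ B.map η ++ [η 0], ω v w = 0 := by
    intro v hv w hw
    obtain ⟨i, rfl⟩ : ∃ i, ξ i = v := by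
      rw [List.mem_append, List.mem_map, List.mem_singleton] at hv
      rcases hv with ⟨i, _, h⟩ | h
      · exact ⟨i, h⟩
      · exact ⟨0, h.symm⟩
    obtain ⟨j, rfl⟩ : ∃ j, η j = w := by
      rw [List.mem_append, List.mem_map, List.mem_singleton] at hw
      rcases hw with ⟨i, _, h⟩ | h
      · exact ⟨i, h⟩
      · exact ⟨0, h.symm⟩
    exact hξη i j
  have e1 := pfaffian_wedge_mul_wedge hω (A.map ξ) (B.map η) fun v hv w hw ↦
    hor v (List.mem_append_left _ hv) w (List.mem_append_left _ hw)
  have e2 := pfaffian_wedge_mul_wedge hω (A.map ξ) (B.map η ++ [η 0]) fun v hv w hw ↦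
    hor v (List.mem_append_left _ hv) w hw
  have e3 := pfaffian_wedge_mul_wedge hω (A.map ξ ++ [ξ 0]) (B.map η) fun v hv w hw ↦
    hor v hv w (List.mem_append_left _ hw)
  have e4 := pfaffian_wedge_mul_wedge hω (A.map ξ ++ [ξ 0]) (B.map η ++ [η 0]) hor
  rw [← wedge_mul_ι_eq] at e2 e3
  rw [← wedge_mul_ι_eq, ← wedge_mul_ι_eq] at e4
  have key : wedge (A.map ξ) * wedge (B.map η) *
      ((1 + ExteriorAlgebra.ι R (η 0)) * (1 + ExteriorAlgebra.ι R (ξ 0))) =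
      wedge (A.map ξ) * wedge (B.map η) +
      wedge (A.map ξ) * (wedge (B.map η) * ExteriorAlgebra.ι R (η 0)) +
      (wedge (A.map ξ) * (wedge (B.map η) * ExteriorAlgebra.ι R (ξ 0)) +
      wedge (A.map ξ) * (wedge (B.map η ++ [η 0]) * ExteriorAlgebra.ι R (ξ 0))) := by
    rw [← wedge_mul_ι_eq]
    simp only [mul_add, add_mul, mul_one, one_mul, mul_assoc]
  rw [key, wedge_mul_ι _ (ξ 0), wedge_mul_ι _ (ξ 0), ← wedge_mul_ι_eq, List.length_append,
    List.length_map, List.length_singleton]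
  rcases Nat.even_or_odd B.length with h | h
  · have h3 : pfaffian ω hω (wedge (B.map η) * ExteriorAlgebra.ι R (η 0)) = 0 := by
      rw [wedge_mul_ι_eq]
      refine pfaffian_wedge_of_odd _ _ ?_
      rw [List.length_append, List.length_map, List.length_singleton]
      exact h.add_one
    rw [h3] at e2 e4 ⊢
    rw [h.neg_one_pow, h.add_one.neg_one_pow, one_mul, neg_one_mul, mul_neg,
      ← mul_assoc _ (ExteriorAlgebra.ι R (ξ 0)) (wedge (B.map η)),
      ← mul_assoc _ (ExteriorAlgebra.ι R (ξ 0)) (wedge (B.map η) * ExteriorAlgebra.ι R (η 0))]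
    simp only [map_add, map_neg, e1, e2, e3, e4]
    ring
  · have h3 : pfaffian ω hω (wedge (B.map η)) = 0 := by
      refine pfaffian_wedge_of_odd _ _ ?_
      rwa [List.length_map]
    rw [h3] at e1 e3 ⊢
    rw [h.neg_one_pow, h.add_one.neg_one_pow, one_mul, neg_one_mul, mul_neg,
      ← mul_assoc _ (ExteriorAlgebra.ι R (ξ 0)) (wedge (B.map η)),
      ← mul_assoc _ (ExteriorAlgebra.ι R (ξ 0)) (wedge (B.map η) * ExteriorAlgebra.ι R (η 0))]
    simp only [map_add, map_neg, e1, e2, e3, e4]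
    ring

/-- The form is negative on the `η`-block precisely so that the factor `(-1)^⌈|J|/2⌉` of the
Pfaffian cancels the one from sorting the factors. -/
theorem sum_listQ_mul_listQ (hp : p 0 = 1) (hr : r 0 = 1)
    (hξ : ∀ i j, j < i → ω (ξ i) (ξ j) = pairQ p i j)
    (hη : ∀ i j, j < i → ω (η i) (η j) = -pairQ r i j)
    (hξη : ∀ i j, ω (ξ i) (η j) = 0) (m : ℕ) :
    ∑ I ∈ (Finset.Icc 1 m).powerset, listQ p (I.sort (· ≥ ·)) *
      ((-1) ^ (∑ k ∈ Finset.Icc 1 m \ I, k) * listQ r ((Finset.Icc 1 m \ I).sort (· ≥ ·))) =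
    pfaffian ω hω (wedge ((descList m).map fun k ↦ ξ k + η k) *
      ((1 + ExteriorAlgebra.ι R (η 0)) * (1 + ExteriorAlgebra.ι R (ξ 0)))) := by
  rw [wedge_descList_add, Finset.sum_mul, map_sum]
  refine Finset.sum_congr rfl fun I hI ↦ ?_
  rw [Finset.mem_powerset] at hI
  rw [smul_mul_assoc, map_smul, pfaffian_wedge_mul_wedge_mul hω hp hr hξ hη hξη
    (pairwise_sort_gt _) ?_ (pairwise_sort_gt _) ?_, Finset.length_sort, smul_eq_mul, pow_add]
  · have h3 : ((-1 : R) ^ (((Finset.Icc 1 m \ I).card + 1) / 2)) *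
        (-1) ^ (((Finset.Icc 1 m \ I).card + 1) / 2) = 1 := by
      rw [← pow_add, Even.neg_one_pow ⟨_, rfl⟩]
    linear_combination (-1) * listQ p (I.sort (· ≥ ·)) * (-1) ^ (∑ k ∈ Finset.Icc 1 m \ I, k) *
      listQ r ((Finset.Icc 1 m \ I).sort (· ≥ ·)) * h3
  · intro i hi
    rw [Finset.mem_sort] at hi
    exact (Finset.mem_Icc.1 (hI hi)).1
  · intro i hi
    rw [Finset.mem_sort] at hi
    exact (Finset.mem_Icc.1 (Finset.sdiff_subset hi)).1

/-- The vector `w = ∑ κ_i (ξ_i + η_i)` is orthogonal to all factors except the boundary vector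
`η_0`. Replacing the top factor by `w` leaves a correction `κ_0 χ_0`, and the hypothesis on `η_0`
makes the two contributions cancel. -/
theorem pfaffian_descList_eq_zero (m : ℕ) (hm : 0 < m) (κ : ℕ → R) (hκ : κ m = 1)
    (h0 : ∀ j ≤ m, ∑ i ∈ Finset.range (m + 1), κ i * ω (ξ i + η i) (ξ j + η j) = 0)
    (h1 : ∑ i ∈ Finset.range (m + 1), κ i * ω (ξ i + η i) (η 0) = κ 0) :
    pfaffian ω hω (wedge ((descList m).map fun k ↦ ξ k + η k) *
      ((1 + ExteriorAlgebra.ι R (η 0)) * (1 + ExteriorAlgebra.ι R (ξ 0)))) = 0 := by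
  obtain ⟨m, rfl⟩ : ∃ k, m = k + 1 := ⟨m - 1, by omega⟩
  set χ : ℕ → M := fun k ↦ ξ k + η k with hχ
  set w : M := ∑ i ∈ Finset.range (m + 1 + 1), κ i • χ i with hw
  have hwχ (j : ℕ) (hj : j ≤ m + 1) : ω w (χ j) = 0 := by
    rw [hw, map_sum, LinearMap.sum_apply, ← h0 j hj]
    exact Finset.sum_congr rfl fun i _ ↦ by
      rw [map_smul, LinearMap.smul_apply, smul_eq_mul]
  have hwη : ω w (η 0) = κ 0 := by
    rw [hw, map_sum, LinearMap.sum_apply, ← h1]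
    exact Finset.sum_congr rfl fun i _ ↦ by
      rw [map_smul, LinearMap.smul_apply, smul_eq_mul]
  set W : ExteriorAlgebra R M := wedge ((descList m).map χ) with hW
  -- The intermediate summands of `w` repeat a factor of `W`.
  have hwW : ExteriorAlgebra.ι R w * W = κ 0 • (ExteriorAlgebra.ι R (χ 0) * W) +
      ExteriorAlgebra.ι R (χ (m + 1)) * W := by
    rw [hw, map_sum, Finset.sum_mul, Finset.sum_range_succ, Finset.sum_range_succ', hκ, one_smul,
      Finset.sum_eq_zero, zero_add, map_smul, smul_mul_assoc]
    intro i hi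
    rw [Finset.mem_range] at hi
    rw [map_smul, smul_mul_assoc, hW, ι_mul_wedge_of_mem, smul_zero]
    exact List.mem_map_of_mem (mem_descList.2 ⟨by omega, by omega⟩)
  have hE : (1 + ExteriorAlgebra.ι R (η 0)) * (1 + ExteriorAlgebra.ι R (ξ 0)) =
      1 + (ExteriorAlgebra.ι R (χ 0) -
        ExteriorAlgebra.ι R (χ 0) * ExteriorAlgebra.ι R (η 0)) := by
    have h2 := ι_mul_ι_comm (R := R) (η 0) (ξ 0)
    simp only [hχ, map_add, mul_add, add_mul, mul_one, one_mul, h2, ExteriorAlgebra.ι_sq_zero]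
    abel
  rw [descList, List.map_cons, wedge_cons, ← hW, eq_sub_of_add_eq' hwW.symm, sub_mul, map_sub,
    smul_mul_assoc, map_smul, hE, mul_assoc, pfaffian_ι_mul]
  -- Contraction with `w` acts only on `η_0`. The sign of passing over `W` occurs twice, the second
  -- time when `χ_0` returns to the front.
  have h3 : CliffordAlgebra.contractLeft (ω w) (W * (1 + (ExteriorAlgebra.ι R (χ 0) -
      ExteriorAlgebra.ι R (χ 0) * ExteriorAlgebra.ι R (η 0)))) =
      κ 0 • (ExteriorAlgebra.ι R (χ 0) * W) := by
    have h4 : CliffordAlgebra.contractLeft (ω w) (1 + (ExteriorAlgebra.ι R (χ 0) -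
        ExteriorAlgebra.ι R (χ 0) * ExteriorAlgebra.ι R (η 0))) =
        κ 0 • ExteriorAlgebra.ι R (χ 0) := by
      have h5 : CliffordAlgebra.contractLeft (ω w) (ExteriorAlgebra.ι R (χ 0)) = 0 := by
        refine (CliffordAlgebra.contractLeft_ι _ _ _).trans ?_
        rw [hwχ 0 (by omega), map_zero]
      have h6 : CliffordAlgebra.contractLeft (ω w)
          (ExteriorAlgebra.ι R (χ 0) * ExteriorAlgebra.ι R (η 0)) =
          -(κ 0 • ExteriorAlgebra.ι R (χ 0)) := by
        refine (CliffordAlgebra.contractLeft_ι_mul _ _ _).trans ?_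
        have h7 : CliffordAlgebra.contractLeft (ω w) (ExteriorAlgebra.ι R (η 0)) =
            algebraMap R (ExteriorAlgebra R M) (κ 0) := by
          refine (CliffordAlgebra.contractLeft_ι _ _ _).trans ?_
          rw [hwη]
        rw [h7, hwχ 0 (by omega), zero_smul, zero_sub, Algebra.smul_def]
        exact congrArg _ (Algebra.commutes _ _).symm
      rw [map_add, map_sub, h5, h6, CliffordAlgebra.contractLeft_one, zero_add, zero_sub, neg_neg]
    rw [hW, contractLeft_wedge_mul, h4, mul_smul_comm, wedge_mul_ι, mul_smul_comm, ← mul_assoc,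
      ← pow_add, Even.neg_one_pow ⟨_, rfl⟩, one_mul]
    intro v hv
    obtain ⟨j, hj, rfl⟩ := List.mem_map.1 hv
    exact hwχ j ((mem_descList.1 hj).2.trans (Nat.le_succ m))
  have h8 : ExteriorAlgebra.ι R (χ 0) * W * (1 + (ExteriorAlgebra.ι R (χ 0) -
      ExteriorAlgebra.ι R (χ 0) * ExteriorAlgebra.ι R (η 0))) = ExteriorAlgebra.ι R (χ 0) * W := by
    have h9 := ι_mul_wedge_mul_ι (R := R) ((descList m).map χ) (χ 0)
    rw [← hW, ← mul_assoc] at h9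
    rw [mul_add, mul_one, mul_sub, ← mul_assoc, h9, zero_mul, sub_zero, add_zero]
  rw [h3, h8, map_smul, sub_self]

end Complementary

/-! ### Vanishing of the sum over complementary strict partitions -/

section Vanishing

variable {R : Type*} [CommRing R]

theorem exists_isAlt {ι : Type*} (A : ι → ι → R) (h0 : ∀ i, A i i = 0)
    (h1 : ∀ i j, A i j = -A j i) : ∃ ω : LinearMap.BilinForm R (ι →₀ R), ω.IsAlt ∧
      ∀ i j, ω (Finsupp.single i 1) (Finsupp.single j 1) = A i j := by
  set ω : LinearMap.BilinForm R (ι →₀ R) :=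
    Finsupp.linearCombination R fun i ↦ Finsupp.linearCombination R (A i) with hω
  have h2 (i j : ι) (a b : R) : ω (Finsupp.single i a) (Finsupp.single j b) = a * (b * A i j) := by
    simp [hω]
  have h3 (f g : ι →₀ R) : ω f g = -ω g f := by
    induction f using Finsupp.induction_linear with
    | zero => simp
    | add f f' hf hf' =>
      rw [map_add, map_add, LinearMap.add_apply, hf, hf', neg_add]
    | single i a =>
      induction g using Finsupp.induction_linear with
      | zero => simp
      | add f f' hf hf' =>
        rw [map_add, map_add, LinearMap.add_apply, hf, hf', neg_add]
      | single j b =>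
        rw [h2, h2, h1 i j]
        ring
  refine ⟨ω, fun f ↦ ?_, fun i j ↦ by rw [h2, one_mul, one_mul]⟩
  induction f using Finsupp.induction_linear with
  | zero => simp
  | add f f' hf hf' =>
    rw [map_add, map_add, LinearMap.add_apply, LinearMap.add_apply, hf, hf', h3 f' f]
    ring
  | single i a => rw [h2, h0, mul_zero, mul_zero]

/-- The skew-symmetric matrix with the entries `pairQ p i j` for `i > j`. -/
def skewQ (p : ℕ → R) (i j : ℕ) : R :=
  if j < i then pairQ p i j else if i < j then -pairQ p j i else 0

theorem skewQ_self (p : ℕ → R) (i : ℕ) : skewQ p i i = 0 := by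
  simp [skewQ]

theorem skewQ_of_lt (p : ℕ → R) {i j : ℕ} (h : j < i) : skewQ p i j = pairQ p i j :=
  if_pos h

theorem skewQ_neg (p : ℕ → R) (i j : ℕ) : skewQ p i j = -skewQ p j i := by
  rcases lt_trichotomy i j with h | h | h
  · simp [skewQ, h, h.le]
  · simp [skewQ, h]
  · simp [skewQ, h, h.not_gt]

theorem sum_Icc_one {A : Type*} [AddCommMonoid A] (f : ℕ → A) (j : ℕ) :
    ∑ q ∈ Finset.Icc 1 j, f q = ∑ q ∈ Finset.range j, f (q + 1) := by
  induction j with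
  | zero => simp
  | succ j ih => rw [Icc_one_succ, Finset.sum_insert (by simp), ih, Finset.sum_range_succ, add_comm]

theorem pairQ_zero_right (p : ℕ → R) (i : ℕ) : pairQ p i 0 = p i * p 0 := by
  simp [pairQ]

theorem pairQ_succ_add (p : ℕ → R) (i j : ℕ) :
    pairQ p i (j + 1) + pairQ p (i + 1) j = p i * p (j + 1) - p (i + 1) * p j := by
  have h : ∑ q ∈ Finset.range j,
        (-1) ^ (q + 1 + 1) * p (i + (q + 1 + 1)) * p (j + 1 - (q + 1 + 1)) =
      -∑ q ∈ Finset.range j, (-1) ^ (q + 1) * p (i + 1 + (q + 1)) * p (j - (q + 1)) := by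
    rw [← Finset.sum_neg_distrib]
    refine Finset.sum_congr rfl fun q _ ↦ ?_
    have h1 : i + (q + 1 + 1) = i + 1 + (q + 1) := by ring
    rw [h1, Nat.add_sub_add_right]
    ring
  rw [pairQ, pairQ, sum_Icc_one, sum_Icc_one, Finset.sum_range_succ', h]
  simp only [zero_add, pow_one, Nat.add_sub_cancel]
  ring

/-- The recursion moves both indices along the antidiagonal, so the symmetric part depends only on
`i + j` up to sign; by `pairQ_zero_add` it is a coefficient of `2 P(-t) P(t)`. -/
theorem pairQ_add_pairQ_swap (p : ℕ → R) (i j : ℕ) : pairQ p i j + pairQ p j i =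
    (-1) ^ j * (pairQ p (i + j) 0 + pairQ p 0 (i + j)) := by
  induction j generalizing i with
  | zero => simp
  | succ j ih =>
    have h := ih (i + 1)
    have h1 : i + (j + 1) = i + 1 + j := by ring
    rw [h1, pow_succ, mul_neg_one, neg_mul, ← h]
    linear_combination pairQ_succ_add p i j + pairQ_succ_add p j i

theorem pairQ_zero_add (P : PowerSeries R) (N : ℕ) :
    pairQ (fun k ↦ PowerSeries.coeff k P) N 0 + pairQ (fun k ↦ PowerSeries.coeff k P) 0 N =
      2 * PowerSeries.coeff N (PowerSeries.evalNegHom P * P) := by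
  rw [pairQ_zero_right, pairQ, sum_Icc_one, PowerSeries.coeff_mul,
    Finset.Nat.sum_antidiagonal_eq_sum_range_succ_mk, Finset.sum_range_succ']
  simp only [PowerSeries.evalNegHom, PowerSeries.coeff_rescale, zero_add, pow_zero, one_mul,
    Nat.sub_zero]
  ring

theorem pairQ_sub_swap {P Q : PowerSeries R}
    (h : PowerSeries.evalNegHom P * P = PowerSeries.evalNegHom Q * Q) (i j : ℕ) :
    pairQ (fun k ↦ PowerSeries.coeff k P) i j - pairQ (fun k ↦ PowerSeries.coeff k Q) i j =
      -(pairQ (fun k ↦ PowerSeries.coeff k P) j i - pairQ (fun k ↦ PowerSeries.coeff k Q) j i) := by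
  have h1 := pairQ_add_pairQ_swap (fun k ↦ PowerSeries.coeff k P) i j
  have h2 := pairQ_add_pairQ_swap (fun k ↦ PowerSeries.coeff k Q) i j
  rw [pairQ_zero_add, h, ← pairQ_zero_add] at h1
  linear_combination h1 - h2

/-- When `P(-t) P(t)` and `Q(-t) Q(t)` agree, the symmetric parts cancel. The difference of the
unsymmetrized expressions is then already skew, on the diagonal because 2 is not a zero divisor. -/
theorem skewQ_sub [IsDomain R] (h2 : (2 : R) ≠ 0) {P Q : PowerSeries R}
    (h : PowerSeries.evalNegHom P * P = PowerSeries.evalNegHom Q * Q) (i j : ℕ) :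
    skewQ (fun k ↦ PowerSeries.coeff k P) i j - skewQ (fun k ↦ PowerSeries.coeff k Q) i j =
      pairQ (fun k ↦ PowerSeries.coeff k P) i j - pairQ (fun k ↦ PowerSeries.coeff k Q) i j := by
  rcases lt_trichotomy i j with hij | rfl | hij
  · rw [skewQ_neg, skewQ_neg _ i j, skewQ_of_lt _ hij, skewQ_of_lt _ hij, pairQ_sub_swap h i j]
    ring
  · rw [skewQ_self, skewQ_self, sub_zero]
    have h3 := pairQ_sub_swap h i i
    have h4 : (2 : R) * (pairQ (fun k ↦ PowerSeries.coeff k P) i i -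
        pairQ (fun k ↦ PowerSeries.coeff k Q) i i) = 0 := by linear_combination h3
    exact ((mul_eq_zero.1 h4).resolve_left h2).symm
  · rw [skewQ_of_lt _ hij, skewQ_of_lt _ hij]

/-- The recursion `pairQ_succ_add` expresses `t` times column `j + 1` through column `j` and
multiples of `P` and `Q`. Multiplication by `V` gives vanishing coefficients for all of these, which
the induction propagates; hence the bound is carried for all `k ≥ m`. -/
theorem coeff_mul_mk_pairQ {P Q V : PowerSeries R} {m : ℕ}
    (hP0 : PowerSeries.coeff 0 P = 1) (hQ0 : PowerSeries.coeff 0 Q = 1)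
    (h : PowerSeries.evalNegHom P * P = PowerSeries.evalNegHom Q * Q)
    (hP : ∀ k, m ≤ k → PowerSeries.coeff k (V * P) = 0)
    (hQ : ∀ k, m ≤ k → PowerSeries.coeff k (V * Q) = 0) (j k : ℕ) (hk : m ≤ k) :
    PowerSeries.coeff k (V * PowerSeries.mk fun i ↦ pairQ (fun k ↦ PowerSeries.coeff k P) i j -
      pairQ (fun k ↦ PowerSeries.coeff k Q) i j) = 0 := by
  set D : ℕ → ℕ → R := fun i j ↦ pairQ (fun k ↦ PowerSeries.coeff k P) i j -
      pairQ (fun k ↦ PowerSeries.coeff k Q) i j with hD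
  change PowerSeries.coeff k (V * PowerSeries.mk fun i ↦ D i j) = 0
  induction j generalizing k with
  | zero =>
    have h1 : (PowerSeries.mk fun i ↦ D i 0) = P - Q := by
      ext i
      rw [PowerSeries.coeff_mk, map_sub]
      simp only [hD, pairQ_zero_right, hP0, hQ0, mul_one]
    rw [h1, mul_sub, map_sub, hP k hk, hQ k hk, sub_zero]
  | succ j ih =>
    have h1 : PowerSeries.X * (PowerSeries.mk fun i ↦ D i (j + 1)) =
        PowerSeries.X * (PowerSeries.C (PowerSeries.coeff (j + 1) P) * P -
          PowerSeries.C (PowerSeries.coeff (j + 1) Q) * Q) -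
        (PowerSeries.C (PowerSeries.coeff j P) * P - PowerSeries.C (PowerSeries.coeff j Q) * Q) -
        PowerSeries.mk fun i ↦ D i j := by
      ext i
      cases i with
      | zero =>
        have h2 : D 0 j = -D j 0 := pairQ_sub_swap h 0 j
        simp only [map_sub, PowerSeries.coeff_zero_X_mul, PowerSeries.coeff_C_mul,
          PowerSeries.coeff_mk, h2, hP0, hQ0]
        simp only [hD, pairQ_zero_right, hP0, hQ0]
        ring
      | succ i =>
        simp only [map_sub, PowerSeries.coeff_succ_X_mul, PowerSeries.coeff_C_mul,
          PowerSeries.coeff_mk]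
        simp only [hD]
        linear_combination pairQ_succ_add (fun k ↦ PowerSeries.coeff k P) i j -
          pairQ_succ_add (fun k ↦ PowerSeries.coeff k Q) i j
    have h3 : V * (PowerSeries.X * (PowerSeries.mk fun i ↦ D i (j + 1))) =
        PowerSeries.X * (PowerSeries.C (PowerSeries.coeff (j + 1) P) * (V * P) -
          PowerSeries.C (PowerSeries.coeff (j + 1) Q) * (V * Q)) -
        (PowerSeries.C (PowerSeries.coeff j P) * (V * P) -
          PowerSeries.C (PowerSeries.coeff j Q) * (V * Q)) -
        V * PowerSeries.mk fun i ↦ D i j := by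
      rw [h1]
      ring
    have h4 := congrArg (PowerSeries.coeff (k + 1)) h3
    rw [mul_left_comm, PowerSeries.coeff_succ_X_mul] at h4
    rw [h4]
    simp only [map_sub, PowerSeries.coeff_succ_X_mul, PowerSeries.coeff_C_mul,
      hP k hk, hQ k hk, hP (k + 1) (by omega), hQ (k + 1) (by omega), ih (k + 1) (by omega)]
    ring

theorem sum_listQ_mul_listQ_eq_zero [IsDomain R] (h2 : (2 : R) ≠ 0) {m : ℕ} (hm : 0 < m)
    {Z W : PowerSeries R} (hZ0 : PowerSeries.constantCoeff Z = 1)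
    (hW0 : PowerSeries.constantCoeff W = 1) (hZ : ∀ k, m ≤ k → PowerSeries.coeff k Z = 0) :
    ∑ I ∈ (Finset.Icc 1 m).powerset, listQ (fun k ↦ PowerSeries.coeff k (Z * W))
      (I.sort (· ≥ ·)) * ((-1) ^ (∑ k ∈ Finset.Icc 1 m \ I, k) *
        listQ (fun k ↦ PowerSeries.coeff k (PowerSeries.evalNegHom Z * W))
          ((Finset.Icc 1 m \ I).sort (· ≥ ·))) = 0 := by
  set P := Z * W with hP
  set Q := PowerSeries.evalNegHom Z * W with hQ
  set p : ℕ → R := fun k ↦ PowerSeries.coeff k P with hp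
  set r : ℕ → R := fun k ↦ PowerSeries.coeff k Q with hr
  have hneg (f : PowerSeries R) : PowerSeries.evalNegHom (PowerSeries.evalNegHom f) = f := by
    simp [PowerSeries.evalNegHom, PowerSeries.rescale_rescale]
  have hneg0 (k : ℕ) (f : PowerSeries R) : PowerSeries.coeff k (PowerSeries.evalNegHom f) =
      (-1) ^ k * PowerSeries.coeff k f := by
    rw [PowerSeries.evalNegHom, PowerSeries.coeff_rescale]
  have hp0 : p 0 = 1 := by
    simp only [hp, hP, PowerSeries.coeff_zero_eq_constantCoeff_apply, map_mul, hZ0, hW0, mul_one]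
  have hr0 : r 0 = 1 := by
    have := hneg0 0 Z
    rw [PowerSeries.coeff_zero_eq_constantCoeff_apply, pow_zero, one_mul,
      PowerSeries.coeff_zero_eq_constantCoeff_apply] at this
    simp only [hr, hQ, PowerSeries.coeff_zero_eq_constantCoeff_apply, map_mul, this, hZ0, hW0,
      mul_one]
  have hPQ : PowerSeries.evalNegHom P * P = PowerSeries.evalNegHom Q * Q := by
    rw [hP, hQ, map_mul, map_mul, hneg]
    ring
  set V := PowerSeries.invOfUnit W 1 with hV
  have hVW : V * W = 1 := PowerSeries.invOfUnit_mul W 1 (by simpa using hW0)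
  have hVP : V * P = Z := by rw [hP, mul_left_comm, hVW, mul_one]
  have hVQ : V * Q = PowerSeries.evalNegHom Z := by rw [hQ, mul_left_comm, hVW, mul_one]
  have hVP0 (k : ℕ) (hk : m ≤ k) : PowerSeries.coeff k (V * P) = 0 := by rw [hVP, hZ k hk]
  have hVQ0 (k : ℕ) (hk : m ≤ k) : PowerSeries.coeff k (V * Q) = 0 := by
    rw [hVQ, hneg0, hZ k hk, mul_zero]
  -- An orthogonal sum of two copies of the sequence space, with opposite signs on the two forms.
  obtain ⟨ω, hω, hωA⟩ := exists_isAlt (R := R) (ι := ℕ ⊕ ℕ)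
    (Sum.elim (fun i ↦ Sum.elim (skewQ p i) fun _ ↦ 0)
      fun i ↦ Sum.elim (fun _ ↦ 0) fun j ↦ -skewQ r i j)
    (by rintro (i | i) <;> simp [skewQ_self])
    (by
      rintro (i | i) (j | j)
      · exact skewQ_neg p i j
      · simp
      · simp
      · simp [skewQ_neg r i j])
  set ξ : ℕ → (ℕ ⊕ ℕ →₀ R) := fun i ↦ Finsupp.single (Sum.inl i) 1 with hξ
  set η : ℕ → (ℕ ⊕ ℕ →₀ R) := fun i ↦ Finsupp.single (Sum.inr i) 1 with hη
  have hξξ (i j : ℕ) : ω (ξ i) (ξ j) = skewQ p i j := hωA _ _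
  have hηη (i j : ℕ) : ω (η i) (η j) = -skewQ r i j := hωA _ _
  have hξη (i j : ℕ) : ω (ξ i) (η j) = 0 := hωA _ _
  have hηξ (i j : ℕ) : ω (η i) (ξ j) = 0 := hωA _ _
  rw [sum_listQ_mul_listQ hω hp0 hr0 (fun i j hij ↦ by rw [hξξ, skewQ_of_lt _ hij])
    (fun i j hij ↦ by rw [hηη, skewQ_of_lt _ hij]) hξη]
  -- The combination comes from the reversed coefficients of `1/W`, so pairing with it reads off the
  -- coefficient of degree `m` of a product.
  refine pfaffian_descList_eq_zero hω m hm (fun i ↦ PowerSeries.coeff (m - i) V) ?_ ?_ ?_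
  · have h3 := congrArg PowerSeries.constantCoeff hVW
    rw [map_mul, hW0, mul_one, map_one] at h3
    rw [Nat.sub_self, PowerSeries.coeff_zero_eq_constantCoeff_apply, h3]
  · intro j _
    have h3 := coeff_mul_mk_pairQ hp0 hr0 hPQ hVP0 hVQ0 j m le_rfl
    rw [mul_comm, PowerSeries.coeff_mul, Finset.Nat.sum_antidiagonal_eq_sum_range_succ_mk] at h3
    rw [← h3]
    refine Finset.sum_congr rfl fun i _ ↦ ?_
    rw [map_add, map_add, LinearMap.add_apply, LinearMap.add_apply, hξξ, hηη, hξη, hηξ, zero_add,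
      add_zero, ← sub_eq_add_neg, skewQ_sub h2 hPQ, PowerSeries.coeff_mk, mul_comm]
  -- The coefficient of degree `m` of `V Q` is zero. Its term of index 0 is `κ 0`, while `η_0` pairs
  -- to zero with itself, so only the other terms appear on the left.
  · have h3 := hVQ0 m le_rfl
    rw [mul_comm, PowerSeries.coeff_mul, Finset.Nat.sum_antidiagonal_eq_sum_range_succ_mk,
      Finset.sum_range_succ'] at h3
    have h4 (i : ℕ) : ω (ξ i + η i) (η 0) = -skewQ r i 0 := by
      rw [map_add, LinearMap.add_apply, hξη, hηη, zero_add]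
    simp only [h4]
    rw [Finset.sum_range_succ', skewQ_self, neg_zero, mul_zero, add_zero]
    have h5 (i : ℕ) : skewQ r (i + 1) 0 = r (i + 1) := by
      rw [skewQ_of_lt _ (Nat.succ_pos i), pairQ_zero_right, hr0, mul_one]
    simp only [h5, mul_neg, Finset.sum_neg_distrib]
    have h6 : PowerSeries.coeff 0 Q = 1 := hr0
    rw [h6, one_mul, Nat.sub_zero] at h3
    rw [Nat.sub_zero, neg_eq_iff_add_eq_zero, ← h3]
    congr 1
    exact Finset.sum_congr rfl fun i _ ↦ mul_comm _ _

/-- This is the expansion of a Pfaffian with the index 0 occurring at both ends, hence zero. -/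
theorem sum_mul_listQ_eraseIdx_eq_zero (p : ℕ → R) (hp : p 0 = 1) {t : List ℕ}
    (ht : t.Pairwise (· > ·)) (h0 : ∀ i ∈ t, 0 < i) (he : Even t.length) :
    ∑ j : Fin t.length, (-1) ^ (j : ℕ) * p t[j] * listQ p (t.eraseIdx j) = 0 := by
  obtain ⟨ω, hω, hωA⟩ := exists_isAlt (skewQ p) (skewQ_self p) (skewQ_neg p)
  set v : ℕ → (ℕ →₀ R) := fun i ↦ Finsupp.single i 1 with hv
  have hvv (i j : ℕ) (hij : j < i) : ω (v i) (v j) = 1 * pairQ p i j := by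
    rw [one_mul, ← skewQ_of_lt p hij]
    exact hωA _ _
  have hvz (i : ℕ) (hi : 0 < i) : ω (v i) (v 0) = 1 * p i := by
    rw [hvv i 0 hi, pairQ_zero_right, hp, mul_one]
  have h1 := pfaffian_cons_mul hω (v 0) v t (ExteriorAlgebra.ι R (v 0)) (by
    refine (CliffordAlgebra.contractLeft_ι _ _ _).trans ?_
    rw [hω (v 0), map_zero])
  rw [wedge_cons, mul_assoc, ι_mul_wedge_mul_ι, map_zero] at h1
  rw [← neg_eq_zero, h1, ← Finset.sum_neg_distrib]
  refine Finset.sum_congr rfl fun j _ ↦ ?_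
  have h3 := length_eraseIdx_fin j
  have hm : t[j] ∈ t := List.getElem_mem _
  rw [pfaffian_wedge_mul_ι hω p 1 v (v 0) (fun i j _ ↦ hvv i j) hvz (ht.eraseIdx _)
    (fun i hi ↦ h0 i (List.mem_of_mem_eraseIdx hi)) ?_, one_pow, ← hω.neg_eq, hvz _ (h0 _ hm)]
  · ring
  · rw [← h3] at he
    by_contra h
    exact (Nat.not_odd_iff_even.2 he) (Nat.not_odd_iff_even.1 h).add_one

/-- No terms lie beyond the maximal index, so `pairQ p N j = p N * p j`. With an even tail, the
terms removing another part add up to the vanishing alternating sum. -/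
theorem listQ_cons (p : ℕ → R) (hp : p 0 = 1) {N : ℕ} (hN : ∀ k, N < k → p k = 0) {t : List ℕ}
    (ht : t.Pairwise (· > ·)) (h0 : ∀ i ∈ t, 0 < i) : listQ p (N :: t) = p N * listQ p t := by
  have h1 (j : ℕ) : pairQ p N j = p N * p j := by
    rw [pairQ, Finset.sum_eq_zero, mul_zero, add_zero]
    intro q hq
    rw [hN (N + q) (by have := (Finset.mem_Icc.1 hq).1; omega), mul_zero, zero_mul]
  have h2 (t : List ℕ) (ho : Odd t.length) : listQ p (N :: t) = p N * listQ p t := by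
    rw [listQ_of_even p ho, listQ_of_odd p ho, Finset.mul_sum]
    refine Finset.sum_congr rfl fun j _ ↦ ?_
    rw [h1]
    ring
  rcases Nat.even_or_odd t.length with h | h
  · have h3 : Odd (N :: t).length := by rw [List.length_cons]; exact h.add_one
    rw [listQ_of_odd p h3]
    change ∑ j : Fin (t.length + 1), _ = _
    rw [Fin.sum_univ_succ]
    have h4 := sum_mul_listQ_eraseIdx_eq_zero p hp ht h0 h
    have h5 : ∑ j : Fin t.length, (-1) ^ ((j.succ : Fin (t.length + 1)) : ℕ) *
        p (N :: t)[(j.succ : Fin (t.length + 1))] *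
          listQ p ((N :: t).eraseIdx (j.succ : Fin (t.length + 1))) =
        -p N * ∑ j : Fin t.length, (-1) ^ (j : ℕ) * p t[j] * listQ p (t.eraseIdx j) := by
      rw [Finset.mul_sum]
      refine Finset.sum_congr rfl fun j _ ↦ ?_
      simp only [Fin.val_succ, List.eraseIdx_cons_succ, Fin.getElem_fin, List.getElem_cons_succ]
      have h6 := length_eraseIdx_fin j
      rw [h2 _ ?_]
      · ring
      · rw [← h6] at h
        by_contra h'
        exact (Nat.not_odd_iff_even.2 h) (Nat.not_odd_iff_even.1 h').add_one
    rw [h5, h4, mul_zero, add_zero]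
    simp
  · exact h2 t h

end Vanishing

/-! ### The specializations of the sum of products -/

section Specializations

variable {n : ℕ}

theorem Qtilde_eq_listQ (l : List ℕ) : Qtilde n l = listQ (esymm (Fin n) ZHalf) l := by
  induction hk : l.length using Nat.strong_induction_on generalizing l with
  | _ k ih =>
    cases l with
    | nil => rw [Qtilde, listQ]
    | cons a t =>
      rw [Qtilde, listQ]
      rw [List.length_cons] at hk
      split_ifs with h
      · refine Finset.sum_congr rfl fun j _ ↦ ?_
        have h3 := length_eraseIdx_fin j
        have h4 : (a :: t).length = t.length + 1 := rfl
        rw [ih _ (by omega) _ rfl]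
      · refine Finset.sum_congr rfl fun j _ ↦ ?_
        have h3 := length_eraseIdx_fin j
        rw [ih _ (by omega) _ rfl]
        rfl

theorem sum_sort (J : Finset ℕ) : (J.sort (· ≥ ·)).sum = ∑ k ∈ J, k := by
  have h := (Finset.sort_perm_toList (r := (· ≥ ·)) J).sum_nat
  rw [h]
  simp

theorem specialize_PtildeXY (w : Hyperoctahedral n) : specialize w (PtildeXY n) =
    C (half ^ (n - 1)) * ∑ I ∈ (Finset.Icc 1 (n - 1)).powerset,
      listQ (fun k ↦ act w (esymm (Fin n) ZHalf k)) (I.sort (· ≥ ·)) *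
        listQ (esymm (Fin n) ZHalf) ((Finset.Icc 1 (n - 1) \ I).sort (· ≥ ·)) := by
  rw [PtildeXY, specialize_eq, map_sum, Finset.mul_sum]
  refine Finset.sum_congr rfl fun I hI ↦ ?_
  rw [Finset.mem_powerset] at hI
  have hc : I.card + (Finset.Icc 1 (n - 1) \ I).card = n - 1 := by
    rw [add_comm, Finset.card_sdiff_add_card_eq_card hI, Nat.card_Icc, Nat.add_sub_cancel]
  have hC2 : half ^ (n - 1) = half ^ I.card * half ^ (Finset.Icc 1 (n - 1) \ I).card := by
    rw [← pow_add, hc]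
  have hC : act w (C (half ^ I.card) : Pol n) = C (half ^ I.card) := (act w).commutes _
  rw [map_mul, ← specialize_eq, ← specialize_eq, specialize_inX, specialize_inY, Ptilde, Ptilde,
    Qtilde_eq_listQ, Qtilde_eq_listQ, map_mul, map_listQ, hC, hC2, map_mul]
  ring

/-- Apply the general vanishing with `Z = A(t)` and `W = B(-t)`: then `Z W = E^w(t)` and `Z(-t) W =
E(-t)`. The signs `(-1)^k` in the latter cancel the sign in the complementary sum. -/
theorem specialize_PtildeXY_eq_zero {w : Hyperoctahedral n} (hw : w ∈ weylD n)
    (hw' : w ∉ weylA n) : specialize w (PtildeXY n) = 0 := by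
  have hn : 1 < n := by
    by_contra! h
    refine hw' (mem_weylA_iff.2 (funext fun a ↦ ?_))
    have h1 : ∏ i, w.left i = 1 := hw
    have : Subsingleton (Fin n) := Fin.subsingleton_iff_le_one.2 h
    rwa [Fintype.prod_subsingleton _ a] at h1
  have h2 : (2 : Pol n) ≠ 0 := fun h ↦ by
    have := two_mul_C_half_Pol (n := n)
    rw [h, zero_mul] at this
    exact zero_ne_one this
  have hc (δ : ℤˣ) : PowerSeries.constantCoeff (signSeries w δ) = 1 := by
    simp [signSeries, map_prod]
  have hc' (f : PowerSeries (Pol n)) : PowerSeries.constantCoeff (PowerSeries.evalNegHom f) =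
      PowerSeries.constantCoeff f := by
    rw [← PowerSeries.coeff_zero_eq_constantCoeff_apply, PowerSeries.evalNegHom,
      PowerSeries.coeff_rescale, pow_zero, one_mul,
      PowerSeries.coeff_zero_eq_constantCoeff_apply]
  have h := sum_listQ_mul_listQ_eq_zero h2 (m := n - 1) (by omega) (Z := signSeries w 1)
    (W := PowerSeries.evalNegHom (signSeries w (-1))) (hc 1) (by rw [hc', hc])
    fun k hk ↦ coeff_signSeries hw hw' hk
  rw [← map_act_esymmSeries, ← map_mul, signSeries_mul] at h
  have h3 : (fun k ↦ PowerSeries.coeff k (PowerSeries.evalNegHom (esymmSeries n))) =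
      fun k ↦ (-1) ^ k * esymm (Fin n) ZHalf k := funext fun k ↦ by
    rw [PowerSeries.evalNegHom, PowerSeries.coeff_rescale, coeff_esymmSeries]
  have h4 : (fun k ↦ PowerSeries.coeff k
      ((esymmSeries n).map ((act w : Pol n →ₐ[ZHalf] Pol n) : Pol n →+* Pol n))) =
      fun k ↦ act w (esymm (Fin n) ZHalf k) := funext fun k ↦ by
    rw [PowerSeries.coeff_map, coeff_esymmSeries]
    rfl
  rw [h3, h4] at h
  rw [specialize_PtildeXY, ← Finset.sum_congr rfl fun I _ ↦ ?_, h, mul_zero]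
  rw [listQ_pow_mul, sum_sort, ← mul_assoc ((-1) ^ _), ← pow_add, Even.neg_one_pow ⟨_, rfl⟩,
    one_mul]

theorem act_esymm_of_mem {w : Hyperoctahedral n} (hw : w ∈ weylA n) (k : ℕ) :
    act w (esymm (Fin n) ZHalf k) = esymm (Fin n) ZHalf k := by
  obtain ⟨σ, rfl⟩ := hw
  rw [act_inr]
  exact esymm_isSymmetric _ _ _ _

theorem specialize_PtildeXY_of_mem {w : Hyperoctahedral n} (hw : w ∈ weylA n) :
    specialize w (PtildeXY n) = C (half ^ (n - 1)) *
      ∑ I ∈ (Finset.Icc 1 (n - 1)).powerset,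
        listQ (esymm (Fin n) ZHalf) (I.sort (· ≥ ·)) *
          listQ (esymm (Fin n) ZHalf) ((Finset.Icc 1 (n - 1) \ I).sort (· ≥ ·)) := by
  rw [specialize_PtildeXY]
  simp only [act_esymm_of_mem hw]

/-- The new largest part belongs either to `I` or to its complement and splits off as `e_n` in both
cases; the resulting factor 2 cancels the additional `1/2`. -/
theorem dropLast_specialize_PtildeXY (hn : 0 < n) :
    dropLast n (specialize 1 (PtildeXY (n + 1))) =
      esymm (Fin n) ZHalf n * specialize 1 (PtildeXY n) := by
  obtain ⟨m, rfl⟩ : ∃ m, n = m + 1 := ⟨n - 1, by omega⟩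
  rw [specialize_PtildeXY_of_mem (one_mem _), specialize_PtildeXY_of_mem (one_mem _), map_mul,
    map_sum]
  have hC (c : ZHalf) : dropLast (m + 1) (C c) = C c := (dropLast (m + 1)).commutes c
  have h (l : List ℕ) : dropLast (m + 1) (listQ (esymm (Fin (m + 1 + 1)) ZHalf) l) =
      listQ (esymm (Fin (m + 1)) ZHalf) l := by
    rw [map_listQ]
    simp only [dropLast_esymm]
  have hp {J : Finset ℕ} (hJ : J ⊆ Finset.Icc 1 m) :
      listQ (esymm (Fin (m + 1)) ZHalf) ((m + 1) :: J.sort (· ≥ ·)) =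
        esymm (Fin (m + 1)) ZHalf (m + 1) * listQ (esymm (Fin (m + 1)) ZHalf) (J.sort (· ≥ ·)) :=
    listQ_cons _ (esymm_zero _ _) (fun k hk ↦ esymm_eq_zero_of_lt hk) (pairwise_sort_gt J)
      fun i hi ↦ (Finset.mem_Icc.1 (hJ ((Finset.mem_sort _).1 hi))).1
  simp only [hC, map_mul, h, Nat.add_sub_cancel]
  rw [Icc_one_succ, Finset.sum_powerset_insert (by simp), ← Icc_one_succ]
  have h1 : ∑ I ∈ (Finset.Icc 1 m).powerset,
      listQ (esymm (Fin (m + 1)) ZHalf) (I.sort (· ≥ ·)) *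
        listQ (esymm (Fin (m + 1)) ZHalf) ((Finset.Icc 1 (m + 1) \ I).sort (· ≥ ·)) =
      esymm (Fin (m + 1)) ZHalf (m + 1) * ∑ I ∈ (Finset.Icc 1 m).powerset,
        listQ (esymm (Fin (m + 1)) ZHalf) (I.sort (· ≥ ·)) *
          listQ (esymm (Fin (m + 1)) ZHalf) ((Finset.Icc 1 m \ I).sort (· ≥ ·)) := by
    rw [Finset.mul_sum]
    refine Finset.sum_congr rfl fun I hI ↦ ?_
    rw [Finset.mem_powerset] at hI
    rw [sdiff_succ hI, sort_insert_succ Finset.sdiff_subset, hp Finset.sdiff_subset]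
    ring
  have h2 : ∑ I ∈ (Finset.Icc 1 m).powerset,
      listQ (esymm (Fin (m + 1)) ZHalf) ((insert (m + 1) I).sort (· ≥ ·)) *
        listQ (esymm (Fin (m + 1)) ZHalf)
          ((Finset.Icc 1 (m + 1) \ insert (m + 1) I).sort (· ≥ ·)) =
      esymm (Fin (m + 1)) ZHalf (m + 1) * ∑ I ∈ (Finset.Icc 1 m).powerset,
        listQ (esymm (Fin (m + 1)) ZHalf) (I.sort (· ≥ ·)) *
          listQ (esymm (Fin (m + 1)) ZHalf) ((Finset.Icc 1 m \ I).sort (· ≥ ·)) := by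
    rw [Finset.mul_sum]
    refine Finset.sum_congr rfl fun I hI ↦ ?_
    rw [Finset.mem_powerset] at hI
    rw [sdiff_insert_succ, sort_insert_succ hI, hp hI]
    ring
  rw [h1, h2, pow_succ, map_mul]
  linear_combination (C (half ^ m) * esymm (Fin (m + 1)) ZHalf (m + 1) *
    ∑ I ∈ (Finset.Icc 1 m).powerset,
        listQ (esymm (Fin (m + 1)) ZHalf) (I.sort (· ≥ ·)) *
          listQ (esymm (Fin (m + 1)) ZHalf) ((Finset.Icc 1 m \ I).sort (· ≥ ·))) *
    two_mul_C_half_Pol (n := m + 1)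

theorem scale_listQ_esymm (l : List ℕ) : scale n (listQ (esymm (Fin n) ZHalf) l) =
    Polynomial.X ^ l.sum * Polynomial.C (listQ (esymm (Fin n) ZHalf) l) := by
  rw [map_listQ]
  simp only [scale_esymm]
  rw [listQ_pow_mul, map_listQ]

theorem natDegree_scale_specialize_PtildeXY :
    (scale n (specialize 1 (PtildeXY n))).natDegree ≤ n.choose 2 := by
  have h1 : ∑ k ∈ Finset.Icc 1 (n - 1), k = n.choose 2 := by
    rw [sum_Icc_one]
    cases n with
    | zero => simp
    | succ m =>
      have := Finset.sum_range_succ' (fun i ↦ i) m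
      rw [add_zero] at this
      rw [Nat.add_sub_cancel, ← this, Finset.sum_range_id, Nat.choose_two_right]
  rw [specialize_PtildeXY_of_mem (one_mem _), map_mul, scale_C, map_sum]
  refine (Polynomial.natDegree_C_mul_le _ _).trans
    (Polynomial.natDegree_sum_le_of_forall_le _ _ fun I hI ↦ ?_)
  rw [Finset.mem_powerset] at hI
  rw [map_mul, scale_listQ_esymm, scale_listQ_esymm, mul_mul_mul_comm, ← pow_add, ← map_mul,
    sum_sort, sum_sort, add_comm, Finset.sum_sdiff hI, h1]
  refine Polynomial.natDegree_mul_le.trans ?_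
  rw [Polynomial.natDegree_C, add_zero]
  exact Polynomial.natDegree_X_pow_le _

theorem specialize_one_PtildeXY (hn : 0 < n) : specialize 1 (PtildeXY n) = sumProd n := by
  refine eq_sumProd (G := fun n ↦ specialize 1 (PtildeXY n)) ?_
    (fun n hn ↦ dropLast_specialize_PtildeXY hn) ?_ (fun n ↦ natDegree_scale_specialize_PtildeXY) hn
  · simp [specialize_PtildeXY, listQ]
  · intro n a b hab
    exact subst_specialize_one (fun w hw hw' ↦ specialize_PtildeXY_eq_zero hw hw') hab

/-! ### The congruences -/

theorem congrRel_of_specialize (hn : 0 < n) {f g : Pol₂ n}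
    (h : ∀ w ∈ weylD n, specialize w f = specialize w g) : CongrRel f g := by
  refine mem_relIdeal_of_specialize hn (fun w hw hw1 ↦ specialize_kernel_eq_zero hw hw1)
    (specialize_one_kernel hn) natDegree_scale₂_kernel fun w hw ↦ ?_
  rw [specialize_eq, map_sub, ← specialize_eq, ← specialize_eq, h w hw, sub_self]

theorem congrRel_fulton_PtildeXY (hn : 0 < n) : CongrRel (fulton n) (PtildeXY n) := by
  refine congrRel_of_specialize hn fun w hw ↦ ?_
  by_cases h : w ∈ weylA n
  · rw [specialize_fulton_of_mem h, specialize_one_fulton hn, specialize_PtildeXY_of_mem h,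
      ← specialize_PtildeXY_of_mem (one_mem _), specialize_one_PtildeXY hn]
  · rw [specialize_fulton_eq_zero hw h, specialize_PtildeXY_eq_zero hw h]

theorem congrRel_wordDivDiff_kernel (hn : 0 < n) {l : List (Simple n)}
    (hl : l.length = n * (n - 1)) (hw : (l.map Simple.toWeyl).prod = (longest n).1) (f : Pol n) :
    CongrRel (wordDivDiff l (inX f * (kernelA n * fulton n))) (inY f) := by
  have h := disc_mul_wordDivDiff (fun w hw hw1 ↦ specialize_kernel_eq_zero hw hw1)
    (specialize_one_kernel hn) natDegree_scale₂_kernel l hl hw (C : ZHalf →+* Pol n)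
    (inX f * (kernelA n * fulton n))
  set R := wordDivDiff l (inX f * (kernelA n * fulton n)) with hR
  -- On the diagonal only the identity term of the antisymmetrization survives, and the kernel
  -- contributes exactly `disc`.
  have h1 : specialize 1 R = f := by
    have h2 := congrArg (specialize 1) h
    have h3 (u : weylD n) : specializeHom 1 (((Equiv.Perm.sign u.1.right : ℤ) : Pol₂ n) *
        act u.1 (inX f * (kernelA n * fulton n))) =
        (Equiv.Perm.sign u.1.right : ℤ) *
          (act u.1 f * specialize u.1 (kernelA n * fulton n)) := by
      rw [map_mul, map_intCast, ← specialize_eq, specialize_act, mul_one, specialize_eq, map_mul,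
        ← specialize_eq, ← specialize_eq, specialize_inX]
    rw [← map_disc (C : ZHalf →+* Pol n), ← inX_eq, specialize_eq, specialize_eq, map_mul, map_sum,
      ← specialize_eq, ← specialize_eq, specialize_inX, act_one,
      Finset.sum_congr rfl fun u _ ↦ h3 u, Finset.sum_eq_single (1 : weylD n)] at h2
    · rw [OneMemClass.coe_one, specialize_one_kernel hn, act_one] at h2
      refine mul_left_cancel₀ (disc_ne_zero ZHalf) (h2.trans ?_)
      simp [mul_comm]
    · intro u _ hu
      rw [specialize_kernel_eq_zero u.2 fun h ↦ hu (Subtype.ext h), mul_zero, mul_zero]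
    · simp
  refine congrRel_of_specialize hn fun w hw ↦ ?_
  -- Invariance in `X` makes all specializations equal to the one just computed.
  have h3 := act_eq_self_of_disc_mul h ⟨w, hw⟩
  rw [specialize_inY, ← h1, ← mul_one w, ← specialize_act, h3]

theorem act_inX_of_isSymmetric (f : Pol n) (hf : f.IsSymmetric) (i : ℕ) (hi : i + 1 < n) :
    act (Simple.s i hi).toWeyl (inX f) = inX f := by
  have h : (Simple.s i hi).toWeyl =
      SemidirectProduct.inr (Equiv.swap ⟨i, by omega⟩ ⟨i + 1, hi⟩) := rfl
  rw [inX_eq, act_map, h, act_inr, hf]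

theorem act_fulton (i : ℕ) (hi : i + 1 < n) :
    act (Simple.s i hi).toWeyl (fulton n) = fulton n := by
  have h (k : ℤ) : act (Simple.s i hi).toWeyl (fultonEntry n k) = fultonEntry n k := by
    rw [fultonEntry]
    split_ifs
    · rw [map_add, act_inX_of_isSymmetric]
      · congr 1
        exact (act (Simple.s i hi).toWeyl).commutes _
      · rw [Ptilde_singleton]
        exact (IsSymmetric.C half).mul (esymm_isSymmetric _ _ _)
    · rw [map_one]
    · rw [map_zero]
  rw [fulton, AlgHom.map_det]
  exact congrArg _ (Matrix.ext fun _ _ ↦ h _)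

/-- The type A letters act first and are linear over `f F`, which is symmetric in `X`; they reduce
the remaining product to a sign. -/
theorem wordDivDiff_longWord_kernel (hn : 0 < n) (f : Pol n) (hf : f.IsSymmetric) :
    wordDivDiff (longWord n hn) (inX f * (kernelA n * fulton n)) =
      (-1) ^ n.choose 2 * angle (inX f) (fulton n) := by
  rw [longWord, wordDivDiff_append, mul_left_comm, mul_comm (kernelA n), wordDivDiff_mul,
    wordDivDiff_kernelA hn, mul_comm, wordDivDiff_neg_one_pow_mul, angle, divDiffV]
  intro s hs
  obtain ⟨i, hi, rfl⟩ := forall_mem_aWord _ _ s hs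
  rw [map_mul, act_inX_of_isSymmetric f hf, act_fulton]

theorem neg_one_pow_mul_self {R : Type*} [CommRing R] (k : ℕ) : (-1 : R) ^ k * (-1) ^ k = 1 := by
  rw [← pow_add, Even.neg_one_pow ⟨_, rfl⟩]

theorem congrRel_angle (hn : 0 < n) (f : Pol n) (hf : f.IsSymmetric) :
    CongrRel (angle (inX f) (fulton n)) ((-1) ^ n.choose 2 * inY f) := by
  have h := congrRel_wordDivDiff_kernel hn (length_longWord hn) (prod_longWord hn) f
  rw [wordDivDiff_longWord_kernel hn f hf] at h
  have h1 := Ideal.mul_mem_left _ ((-1) ^ n.choose 2) h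
  have h2 : (-1 : Pol₂ n) ^ n.choose 2 * (-1) ^ n.choose 2 = 1 := neg_one_pow_mul_self _
  rwa [mul_sub, ← mul_assoc, h2, one_mul] at h1

theorem congrRel_bracket (hn : 0 < n) (f : Pol n) :
    CongrRel (bracket (inX f) (kernelA n * fulton n)) (inY f) := by
  have h := (exists_isReduced (longest n)).choose_spec
  exact congrRel_wordDivDiff_kernel hn (length_of_isReduced_longest hn h) h.1 f

end Specializations

end TypeD

end

open TypeD in
theorem proposition2 (n : ℕ) (hn : 0 < n) :
    CongrRel (fulton n) (PtildeXY n) ∧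
    ((∀ w ∈ weylD n, w ∉ weylA n → specialize w (PtildeXY n) = 0) ∧
      (∀ w ∈ weylA n, specialize w (PtildeXY n) = specialize 1 (PtildeXY n)) ∧
      specialize 1 (PtildeXY n) = schur (rho n)) ∧
    (∀ f : Pol n, f.IsSymmetric →
      CongrRel (angle (inX f) (fulton n)) ((-1) ^ n.choose 2 * inY f)) ∧
    (∀ f : Pol n, CongrRel (bracket (inX f) (kernelA n * fulton n)) (inY f)) := by
  refine ⟨congrRel_fulton_PtildeXY hn, ⟨fun w hw hw' ↦ specialize_PtildeXY_eq_zero hw hw',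
    fun w hw ↦ ?_, ?_⟩, congrRel_angle hn, congrRel_bracket hn⟩
  · rw [specialize_PtildeXY_of_mem hw, specialize_PtildeXY_of_mem (one_mem _)]
  · rw [specialize_one_PtildeXY hn, schur_rho]
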